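/- Let $H\in(1/2,1)$, $\alpha\in(1-H,1/2)$, $\beta\in(1-\alpha,H)$, $\gamma>1/2$, $\kappa=\gamma/\beta$, and $\theta,x_0\in\mathbb R$. Let $B^H=\{B^H_t,t\ge 0\}$ be a fractional Brownian motion with Hurst parameter $H$ (a centered Gaussian process with continuous paths and $\mathsf E[B^H_tB^H_s]=\frac12(s^{2H}+t^{2H}-|t-s|^{2H})$) on a probability space $(\Omega,\mathcal F,\mathsf P)$, and let $X$ be a process with continuous paths such that, almost surely, $$X_t=x_0+\theta\int_0^t a(X_s)\,ds+\int_0^t b(X_s)\,dB^H_s\quad\text{for all } t\ge 0 .$$ Here the last integral is a pathwise generalized Lebesgue–Stieltjes integral: if $(D^{\alpha}_{s+}f)(x)=\frac1{\Gamma(1-\alpha)}\Big(\frac{f(x)}{(x-s)^{\alpha}}+\alpha\int_s^x\frac{f(x)-f(u)}{(x-u)^{1+\alpha}}du\Big)$ belongs to $L_1[s,t]$ and $(D^{1-\alpha}_{t-}g_{t-})(x)=\frac{1}{\Gamma(\alpha)}\Big(\frac{g(x)-g(t)}{(t-x)^{1-\alpha}}+(1-\alpha)\int_x^t\frac{g(x)-g(u)}{(u-x)^{2-\alpha}}du\Big)$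 belongs to $L_\infty[s,t]$, then $\int_s^t f\,dg=-\int_s^t (D^{\alpha}_{s+}f)(x)\,(D^{1-\alpha}_{t-}g_{t-})(x)\,dx$. Assume that there are constants $K,L,M>0$, $\delta\in(1/H-1,1]$ and, for every integer $N\ge1$, a constant $R_N>0$ such that: (A) $|a(x)|+|b(x)|\le K$ for all $x\in\mathbb R$; (B) $|a(x)-a(y)|+|b(x)-b(y)|\le L|x-y|$ for all $x,y\in\mathbb R$; (C) $b$ is differentiable and $|b'(x)-b'(y)|\le R_N|x-y|^{\delta}$ for all $x,y\in[-N,N]$; (D) $|a(x)|\ge M$ and $|b(x)|\ge M$ for all $x\in\mathbb R$. For $n\ge 1$ and $0\le k\le 2^{2n}$ let $t^n_k=k2^{-n}$, let $\lambda=1/2-H$, and define $$\hat\theta_n^{(1)}=\frac{\sum_{k=1}^{2^{2n}-1}(t_k^n)^{\lambda}(2^n-t_k^n)^{\lambda}\,b(X_{t_{k-1}^n})^{-1}\big(X_{t_k^n}-X_{t_{k-1}^n}\big)}{\sum_{k=1}^{2^{2n}-1}(t_k^n)^{\lambda}(2^n-t_k^n)^{\lambda}\,b(X_{t_{k-1}^n})^{-1}a(X_{t_{k-1}^n})\,2^{-n}}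 .$$ Then $\hat\theta_n^{(1)}\to\theta$ almost surely as $n\to\infty$. Moreover, there is a random variable $\eta$ with $\mathsf E|\eta|^p<\infty$ for all $p>0$ such that, almost surely, for all $n\ge1$, $$|\hat\theta_n^{(1)}-\theta|\le \eta\, n^{\kappa+\gamma}\,2^{-\rho n},\qquad \rho=\min(1-H,\,2\beta-1).$$ -/

import Mathlib

open MeasureTheory ProbabilityTheory Filter Topology Set
open scoped NNReal ENNReal

noncomputable section

/-- Left-sided Weyl-Marchaud fractional derivative of order `s` on an interval with left
end point `a`:
`(D_{a+}^s f)(x) = Γ(1-s)⁻¹ (f(x)/(x-a)^s + s ∫_a^x (f(x)-f(u))/(x-u)^{1+s} du)`. -/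
def leftFracDeriv (s a : ℝ) (f : ℝ → ℝ) (x : ℝ) : ℝ :=
  1 / Real.Gamma (1 - s) *
    (f x / (x - a) ^ s + s * ∫ u in a..x, (f x - f u) / (x - u) ^ (1 + s))

/-- Right-sided Weyl-Marchaud fractional derivative of order `s` on an interval with right
end point `b`, without the complex phase factor:
`Γ(1-s)⁻¹ (g(x)/(b-x)^s + s ∫_x^b (g(x)-g(u))/(u-x)^{1+s} du)`.
The phase `(-1)^s` is accounted for in `glsIntegral`. -/
def rightFracDeriv (s b : ℝ) (g : ℝ → ℝ) (x : ℝ) : ℝ :=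
  1 / Real.Gamma (1 - s) *
    (g x / (b - x) ^ s + s * ∫ u in x..b, (g x - g u) / (u - x) ^ (1 + s))

/-- The function `f` is integrable with respect to `g` on `[a,b]` in the generalized
Lebesgue-Stieltjes sense (with auxiliary order `α`): the fractional derivatives
`D_{a+}^α f` and `D_{b-}^{1-α} g_{b-}`, where `g_{b-} = g - g(b)`, exist almost everywhere on
`[a,b]` and belong to `L_1[a,b]` and `L_∞[a,b]` respectively. -/
structure IsGLSIntegrable (α a b : ℝ) (f g : ℝ → ℝ) : Prop where
  left_exists : ∀ᵐ x ∂(volume.restrict (Ioc a b)),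
    IntervalIntegrable (fun u => (f x - f u) / (x - u) ^ (1 + α)) volume a x
  left_memL1 : MemLp (leftFracDeriv α a f) 1 (volume.restrict (Ioc a b))
  right_exists : ∀ᵐ x ∂(volume.restrict (Ioc a b)),
    IntervalIntegrable (fun u => (g x - g u) / (u - x) ^ (1 + (1 - α))) volume x b
  right_memLtop :
    MemLp (rightFracDeriv (1 - α) b (fun y => g y - g b)) ∞ (volume.restrict (Ioc a b))

/-- The generalized Lebesgue-Stieltjes integral `∫_a^b f dg`, that is
`(-1)^α ∫_a^b (D_{a+}^α f)(x) (D_{b-}^{1-α} g_{b-})(x) dx`. The phase `(-1)^α` and the phase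
`(-1)^{1-α}` of the right-sided derivative multiply to the leading minus sign; with it,
`∫_a^b 1 dg = g(b) - g(a)`. -/
def glsIntegral (α a b : ℝ) (f g : ℝ → ℝ) : ℝ :=
  -∫ x in a..b, leftFracDeriv α a f x * rightFracDeriv (1 - α) b (fun y => g y - g b) x

/-- The process `B` (only its values at times `t ≥ 0` matter) is a fractional Brownian motion
with Hurst parameter `H`, in its version with continuous paths: a centered Gaussian process
with `E[B_t B_s] = (s^{2H} + t^{2H} - |t-s|^{2H}) / 2`. -/
structure IsFractionalBrownianMotion {Ω : Type*} [MeasurableSpace Ω] (P : Measure Ω)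
    (H : ℝ) (B : ℝ → Ω → ℝ) : Prop where
  gaussian : IsGaussianProcess (fun t : ℝ≥0 => B (t : ℝ)) P
  centered : ∀ t : ℝ, 0 ≤ t → ∫ ω, B t ω ∂P = 0
  covariance : ∀ s t : ℝ, 0 ≤ s → 0 ≤ t →
    ∫ ω, B t ω * B s ω ∂P = (s ^ (2 * H) + t ^ (2 * H) - |t - s| ^ (2 * H)) / 2
  continuous_paths : ∀ᵐ ω ∂P, ContinuousOn (fun t => B t ω) (Ici 0)

/-- The process `X` (only its values at times `t ≥ 0` matter) has continuous paths and solves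
`X_t = x₀ + θ ∫_0^t a(X_s) ds + ∫_0^t b(X_s) dB_s`, `t ≥ 0`, almost surely, where the last
integral exists as a pathwise generalized Lebesgue-Stieltjes integral. -/
structure IsSDESolution {Ω : Type*} [MeasurableSpace Ω] (P : Measure Ω)
    (α x₀ θ : ℝ) (a b : ℝ → ℝ) (B X : ℝ → Ω → ℝ) : Prop where
  measurable : ∀ t : ℝ, 0 ≤ t → Measurable (X t)
  continuous_paths : ∀ ω, ContinuousOn (fun t => X t ω) (Ici 0)
  integrable : ∀ᵐ ω ∂P, ∀ t : ℝ, 0 ≤ t →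
    IsGLSIntegrable α 0 t (fun s => b (X s ω)) (fun s => B s ω)
  equation : ∀ᵐ ω ∂P, ∀ t : ℝ, 0 ≤ t →
    X t ω = x₀ + θ * (∫ s in (0 : ℝ)..t, a (X s ω)) +
      glsIntegral α 0 t (fun s => b (X s ω)) (fun s => B s ω)

/-- The observation times `t_k^n = k 2^{-n}`. -/
def obsTime (n k : ℕ) : ℝ := (k : ℝ) / 2 ^ n

/-- The weight `(t_k^n)^λ (2^n - t_k^n)^λ` with `λ = 1/2 - H`. -/
def obsWeight (H : ℝ) (n k : ℕ) : ℝ :=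
  obsTime n k ^ (1 / 2 - H) * (2 ^ n - obsTime n k) ^ (1 / 2 - H)

/-- The weighted drift estimator computed from the path `x` observed at the times `t_k^n`. -/
def driftEstimator (H : ℝ) (a b : ℝ → ℝ) (n : ℕ) (x : ℝ → ℝ) : ℝ :=
  (∑ k ∈ Finset.Icc 1 (2 ^ (2 * n) - 1),
      obsWeight H n k * (b (x (obsTime n (k - 1))))⁻¹ *
        (x (obsTime n k) - x (obsTime n (k - 1)))) /
  (∑ k ∈ Finset.Icc 1 (2 ^ (2 * n) - 1),
      obsWeight H n k * (b (x (obsTime n (k - 1))))⁻¹ * a (x (obsTime n (k - 1))) *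
        (1 / 2 ^ n))

end

/-! On `[0, 2^n]` the solution is compared with its one-step Euler approximation. Up to a local
error, X(t_k) - X(t_{k-1}) equals θ a(X) 2^{-n} + ν b(X) ΔB, where ν is a constant produced by the
unnormalized fractional derivatives; its value is never needed. Multiplication by the weight and by
1/b(X) cancels b in the noise, so the numerator of the estimator is θ times its denominator, plus ν
times a Gaussian sum with deterministic weights (`weightedNoise`), plus the weighted local errors.
Since a/b is continuous and nonvanishing it has constant sign, and the denominator has the order of
the sum of the weights times 2^{-n}, at least a constant times (2^n)^{2-2H}. The noise has standard
deviation of order (2^n)^{1-H}, which gives the rate 1-H; local errors of order (2^{-n})^{2β} lose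
one factor 2^n, which gives the rate 2β-1.

The deterministic core is `IsRoughPathSolution.abs_local_error_le`. The integral is given on `[0,
t]` with a left derivative that is merely in L¹. A bootstrap through the equation
(`HolderOnIcc.lintegral_marchaudAbs_lt_top`) upgrades this to absolute convergence of the double
integral. Then the fractional integral inverts the left derivative (`fracIntegral_marchaudLeft`), so
for a C¹ driver G the integral is a multiple of ∫ f G'. Steklov means carry additivity in the
interval and splitting off constants over to Hölder drivers. An absorption argument on short
intervals, followed by chaining, bounds the Hölder constant of X on intervals of length at most one
by a constant times Λ^{1/β}, where Λ is the Hölder constant of the driver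
(`IsRoughPathSolution.abs_increment_le`). The local error is then of order Λ^{1/β+1} (t-s)^{2β}.

The probabilistic core is `IsFractionalBrownianMotion.exists_moment_bound`: all normalized dyadic
increments of B and all normalized noise sums form one countable Gaussian family, dominated by a
single random variable ζ with all moments times square roots of logarithmic weights. Dyadic chaining
gives Λ ≤ C ζ n^γ on `[0, 2^n]`. Substitution yields the power n^{γ/β+γ} = n^{κ+γ}, and η is a
multiple of ζ³ because 1/β+1 ≤ 3. -/

/-! ### Integrals of powers -/

theorem intervalIntegrable_sub_left_rpow {p : ℝ} (hp : -1 < p) (x a b : ℝ) :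
    IntervalIntegrable (fun u => (x - u) ^ p) volume a b := by
  have h := (intervalIntegral.intervalIntegrable_rpow' (a := x - a) (b := x - b) hp).comp_sub_left x
  simpa using h

theorem intervalIntegrable_sub_right_rpow {p : ℝ} (hp : -1 < p) (x a b : ℝ) :
    IntervalIntegrable (fun u => (u - x) ^ p) volume a b := by
  have h := (intervalIntegral.intervalIntegrable_rpow' (a := a - x) (b := b - x) hp).comp_sub_right x
  simpa using h

theorem integral_sub_left_rpow {p : ℝ} (hp : -1 < p) (s x : ℝ) :
    ∫ u in s..x, (x - u) ^ p = (x - s) ^ (p + 1) / (p + 1) := by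
  rw [intervalIntegral.integral_comp_sub_left (fun y => y ^ p) x, integral_rpow (Or.inl hp)]
  simp [Real.zero_rpow (by linarith : p + 1 ≠ 0)]

theorem integral_sub_right_rpow {p : ℝ} (hp : -1 < p) (s x : ℝ) :
    ∫ u in s..x, (u - s) ^ p = (x - s) ^ (p + 1) / (p + 1) := by
  rw [intervalIntegral.integral_comp_sub_right (fun y => y ^ p) s, integral_rpow (Or.inl hp)]
  simp [Real.zero_rpow (by linarith : p + 1 ≠ 0)]

theorem lintegral_Ioo_ofReal {h : ℝ → ℝ} {a b : ℝ} (hab : a ≤ b)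
    (hi : IntervalIntegrable h volume a b) (h0 : ∀ u ∈ Ioo a b, 0 ≤ h u) :
    ∫⁻ u in Ioo a b, ENNReal.ofReal (h u) = ENNReal.ofReal (∫ u in a..b, h u) := by
  rw [intervalIntegral.integral_of_le hab, integral_Ioc_eq_integral_Ioo,
    ofReal_integral_eq_lintegral_ofReal]
  · exact (intervalIntegrable_iff_integrableOn_Ioo_of_le hab).1 hi
  · exact (ae_restrict_iff' measurableSet_Ioo).2 (Eventually.of_forall h0)

theorem lintegral_sub_left_rpow {p : ℝ} (hp : -1 < p) {s x : ℝ} (hsx : s ≤ x) :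
    ∫⁻ u in Ioo s x, ENNReal.ofReal ((x - u) ^ p) = ENNReal.ofReal ((x - s) ^ (p + 1) / (p + 1)) := by
  rw [lintegral_Ioo_ofReal hsx (intervalIntegrable_sub_left_rpow hp x s x),
    integral_sub_left_rpow hp]
  exact fun u hu => Real.rpow_nonneg (by linarith [hu.2]) _

theorem lintegral_sub_right_rpow {p : ℝ} (hp : -1 < p) {s x : ℝ} (hsx : s ≤ x) :
    ∫⁻ u in Ioo s x, ENNReal.ofReal ((u - s) ^ p) = ENNReal.ofReal ((x - s) ^ (p + 1) / (p + 1)) := by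
  rw [lintegral_Ioo_ofReal hsx (intervalIntegrable_sub_right_rpow hp s s x),
    integral_sub_right_rpow hp]
  exact fun u hu => Real.rpow_nonneg (by linarith [hu.1]) _

/-! ### Unnormalized Marchaud derivatives and their measurability -/

/-- The left Marchaud derivative without its Gamma factor. -/
noncomputable def marchaudLeft (α : ℝ) (f : ℝ → ℝ) (s x : ℝ) : ℝ :=
  f x * (x - s) ^ (-α) + α * ∫ u in s..x, (f x - f u) * (x - u) ^ (-1 - α)

/-- The right Marchaud derivative of `g - g t` of order `1 - α` without its Gamma factor. -/
noncomputable def marchaudRight (α : ℝ) (g : ℝ → ℝ) (t x : ℝ) : ℝ :=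
  (g x - g t) * (t - x) ^ (α - 1) + (1 - α) * ∫ u in x..t, (g x - g u) * (u - x) ^ (α - 2)

theorem leftFracDeriv_eq (α : ℝ) (f : ℝ → ℝ) {s x : ℝ} (h : s ≤ x) :
    leftFracDeriv α s f x = 1 / Real.Gamma (1 - α) * marchaudLeft α f s x := by
  unfold leftFracDeriv marchaudLeft
  congr 2
  · rw [Real.rpow_neg (by linarith), div_eq_mul_inv]
  · congr 1
    refine intervalIntegral.integral_congr fun u hu => ?_
    rw [uIcc_of_le h] at hu
    rw [show -1 - α = -(1 + α) by ring, Real.rpow_neg (by linarith [hu.2]), div_eq_mul_inv]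

theorem rightFracDeriv_eq (α : ℝ) (g : ℝ → ℝ) {t x : ℝ} (h : x ≤ t) :
    rightFracDeriv (1 - α) t (fun y => g y - g t) x =
      1 / Real.Gamma α * marchaudRight α g t x := by
  unfold rightFracDeriv marchaudRight
  rw [show 1 - (1 - α) = α by ring]
  congr 2
  · rw [show α - 1 = -(1 - α) by ring, Real.rpow_neg (by linarith), div_eq_mul_inv]
  · congr 1
    refine intervalIntegral.integral_congr fun u hu => ?_
    rw [uIcc_of_le h] at hu
    beta_reduce
    rw [show α - 2 = -(1 + (1 - α)) by ring, Real.rpow_neg (by linarith [hu.1]), div_eq_mul_inv]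
    congr 1; ring

theorem glsIntegral_eq (α : ℝ) (f g : ℝ → ℝ) {s t : ℝ} (h : s ≤ t) :
    glsIntegral α s t f g = -(1 / (Real.Gamma (1 - α) * Real.Gamma α)) *
      ∫ x in s..t, marchaudLeft α f s x * marchaudRight α g t x := by
  unfold glsIntegral
  rw [neg_mul, ← intervalIntegral.integral_const_mul]
  congr 1
  refine intervalIntegral.integral_congr fun u hu => ?_
  rw [uIcc_of_le h] at hu
  rw [leftFracDeriv_eq _ _ hu.1, rightFracDeriv_eq _ _ hu.2]
  ring

theorem measurable_marchaud_integrand {f : ℝ → ℝ} (hf : Measurable f) (p : ℝ) :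
    Measurable (fun z : ℝ × ℝ => (f z.1 - f z.2) * (z.1 - z.2) ^ p) :=
  ((hf.comp measurable_fst).sub (hf.comp measurable_snd)).mul
    ((measurable_fst.sub measurable_snd).pow_const p)

/-- The moving end point is absorbed into the indicator of a measurable subset of the plane, once
for each orientation of the interval; measurability of parametric integrals then applies. -/
theorem stronglyMeasurable_intervalIntegral_right {F : ℝ → ℝ → ℝ}
    (hF : Measurable (Function.uncurry F)) (s : ℝ) :
    StronglyMeasurable (fun x => ∫ u in s..x, F x u) := by
  have key : ∀ A : Set (ℝ × ℝ), MeasurableSet A →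
      StronglyMeasurable (fun x => ∫ u, A.indicator (Function.uncurry F) (x, u)) := fun A hA =>
    StronglyMeasurable.integral_prod_right (f := fun x u => A.indicator (Function.uncurry F) (x, u))
      (hF.indicator hA).stronglyMeasurable
  have h1 := key {z | z.2 ∈ Ioc s z.1} ((measurableSet_lt measurable_const measurable_snd).inter
    (measurableSet_le measurable_snd measurable_fst))
  have h2 := key {z | z.2 ∈ Ioc z.1 s} ((measurableSet_lt measurable_fst measurable_snd).inter
    (measurableSet_le measurable_snd measurable_const))
  convert h1.sub h2 using 1
  ext x
  simp only [intervalIntegral, Pi.sub_apply]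
  congr 1
  · rw [← integral_indicator measurableSet_Ioc]; rfl
  · rw [← integral_indicator measurableSet_Ioc]; rfl

theorem measurable_marchaudLeft (α : ℝ) {f : ℝ → ℝ} (hf : Measurable f) (s : ℝ) :
    Measurable (marchaudLeft α f s) := by
  unfold marchaudLeft
  refine (hf.mul ((measurable_id.sub_const s).pow_const _)).add (Measurable.const_mul ?_ α)
  exact (stronglyMeasurable_intervalIntegral_right
    (F := fun x u => (f x - f u) * (x - u) ^ (-1 - α)) (measurable_marchaud_integrand hf (-1 - α)) s).measurable

theorem measurable_marchaudRight (α : ℝ) {g : ℝ → ℝ} (hg : Measurable g) (t : ℝ) :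
    Measurable (marchaudRight α g t) := by
  unfold marchaudRight
  refine ((hg.sub_const _).mul ((measurable_id.const_sub t).pow_const _)).add
    (Measurable.const_mul ?_ (1 - α))
  have h := (stronglyMeasurable_intervalIntegral_right
    (F := fun x u => (g x - g u) * (u - x) ^ (α - 2)) (s := t)
    (((hg.comp measurable_fst).sub (hg.comp measurable_snd)).mul
    ((measurable_snd.sub measurable_fst).pow_const _))).measurable.neg
  convert h using 1
  ext x
  simp only [Pi.neg_apply]
  rw [intervalIntegral.integral_symm]

/-! ### Right derivatives of Hölder drivers -/

/-- `g` is Hölder continuous on `[s, t]` with exponent `β` and constant `Λ`. -/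
def HolderOnIcc (β Λ : ℝ) (g : ℝ → ℝ) (s t : ℝ) : Prop :=
  ∀ u v, s ≤ u → u ≤ v → v ≤ t → |g v - g u| ≤ Λ * (v - u) ^ β

theorem HolderOnIcc.mono {β Λ : ℝ} {g : ℝ → ℝ} {s t s' t' : ℝ} (h : HolderOnIcc β Λ g s t)
    (hs : s ≤ s') (ht : t' ≤ t) : HolderOnIcc β Λ g s' t' :=
  fun u v h1 h2 h3 => h u v (hs.trans h1) h2 (h3.trans ht)

theorem HolderOnIcc.kernel_bound {β Λ α : ℝ} {g : ℝ → ℝ} {s t : ℝ} (hg : HolderOnIcc β Λ g s t)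
    {x u : ℝ} (hx : s ≤ x) (hxu : x < u) (hu : u ≤ t) :
    |(g x - g u) * (u - x) ^ (α - 2)| ≤ Λ * (u - x) ^ (α + β - 2) := by
  have hp : 0 < u - x := by linarith
  rw [abs_mul, abs_sub_comm, abs_of_nonneg (Real.rpow_nonneg hp.le (α - 2)),
    show α + β - 2 = β + (α - 2) by ring, Real.rpow_add hp, ← mul_assoc]
  exact mul_le_mul_of_nonneg_right (hg x u hx hxu.le hu) (Real.rpow_nonneg hp.le _)

theorem HolderOnIcc.intervalIntegrable {β Λ α : ℝ} {g : ℝ → ℝ} {s t : ℝ}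
    (hg : HolderOnIcc β Λ g s t) (hgm : Measurable g) (hαβ : 1 < α + β) {x : ℝ} (hx : s ≤ x)
    (hxt : x ≤ t) :
    IntervalIntegrable (fun u => (g x - g u) * (u - x) ^ (α - 2)) volume x t := by
  have h1 := ((intervalIntegrable_sub_right_rpow (p := α + β - 2) (by linarith) x x t).const_mul Λ)
  refine h1.mono_fun ?_ ?_
  · exact ((hgm.const_sub _).mul ((measurable_id.sub_const x).pow_const _)).aestronglyMeasurable
  · rw [uIoc_of_le hxt]
    refine (ae_restrict_iff' measurableSet_Ioc).2 (Eventually.of_forall fun u hu => ?_)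
    exact (hg.kernel_bound hx hu.1 hu.2).trans (le_abs_self _)

/-- The Hölder bound turns the kernel into (u-x)^{α+β-2}, integrable at x exactly because 1 < α+β.
The 1 in the constant is the boundary term, the fraction comes from the integral. -/
theorem HolderOnIcc.abs_marchaudRight_le {β Λ α : ℝ} {g : ℝ → ℝ} {s t : ℝ}
    (hg : HolderOnIcc β Λ g s t) (hα : α < 1) (hαβ : 1 < α + β) {x : ℝ}
    (hx : s ≤ x) (hxt : x < t) :
    |marchaudRight α g t x| ≤ (1 + (1 - α) / (α + β - 1)) * Λ * (t - x) ^ (α + β - 1) := by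
  have hp : 0 < t - x := by linarith
  have h1 : |(g x - g t) * (t - x) ^ (α - 1)| ≤ Λ * (t - x) ^ (α + β - 1) := by
    rw [abs_mul, abs_sub_comm, abs_of_nonneg (Real.rpow_nonneg hp.le (α - 1)),
      show α + β - 1 = β + (α - 1) by ring, Real.rpow_add hp, ← mul_assoc]
    exact mul_le_mul_of_nonneg_right (hg x t hx hxt.le le_rfl) (Real.rpow_nonneg hp.le _)
  have h2 : |∫ u in x..t, (g x - g u) * (u - x) ^ (α - 2)| ≤
      Λ * ((t - x) ^ (α + β - 1) / (α + β - 1)) := by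
    have h3 := intervalIntegral.norm_integral_le_of_norm_le (μ := volume) (a := x) (b := t)
      (f := fun u => (g x - g u) * (u - x) ^ (α - 2))
      (g := fun u => Λ * (u - x) ^ (α + β - 2)) hxt.le
      (Eventually.of_forall fun u hu => hg.kernel_bound hx hu.1 hu.2)
      ((intervalIntegrable_sub_right_rpow (p := α + β - 2) (by linarith) x x t).const_mul Λ)
    rw [intervalIntegral.integral_const_mul, integral_sub_right_rpow (by linarith)] at h3
    rw [show α + β - 2 + 1 = α + β - 1 by ring] at h3
    exact h3
  unfold marchaudRight
  refine (abs_add_le _ _).trans ?_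
  rw [abs_mul (1 - α), abs_of_pos (by linarith : 0 < 1 - α)]
  have := mul_le_mul_of_nonneg_left h2 (by linarith : 0 ≤ 1 - α)
  calc _ ≤ Λ * (t - x) ^ (α + β - 1) + (1 - α) * (Λ * ((t - x) ^ (α + β - 1) / (α + β - 1))) :=
        add_le_add h1 this
    _ = _ := by ring

theorem lintegral_triangle_swap {F : ℝ → ℝ → ℝ≥0∞} (hF : Measurable (Function.uncurry F))
    (a b : ℝ) :
    ∫⁻ x in Ioo a b, ∫⁻ u in Ioo a x, F x u = ∫⁻ u in Ioo a b, ∫⁻ x in Ioo u b, F x u := by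
  set A : Set (ℝ × ℝ) := {z | a < z.2 ∧ z.2 < z.1 ∧ z.1 < b}
  have hA : MeasurableSet A := (measurableSet_lt measurable_const measurable_snd).inter
    ((measurableSet_lt measurable_snd measurable_fst).inter
      (measurableSet_lt measurable_fst measurable_const))
  have h := lintegral_lintegral_swap (μ := (volume : Measure ℝ)) (ν := (volume : Measure ℝ))
    (f := fun x u => A.indicator (Function.uncurry F) (x, u)) (hF.indicator hA).aemeasurable
  have e1 : ∀ x, ∫⁻ u, A.indicator (Function.uncurry F) (x, u) =
      (Ioo a b).indicator (fun x => ∫⁻ u in Ioo a x, F x u) x := by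
    intro x
    by_cases hx : x ∈ Ioo a b
    · rw [indicator_of_mem hx, ← lintegral_indicator measurableSet_Ioo]
      refine lintegral_congr fun u => ?_
      simp only [indicator, A, mem_ofPred_eq, mem_Ioo, Function.uncurry]
      congr 1
      simp [hx.2]
    · rw [indicator_of_notMem hx]
      rw [← lintegral_zero (μ := (volume : Measure ℝ))]
      refine lintegral_congr fun u => indicator_of_notMem (fun hz => hx ⟨hz.1.trans hz.2.1, hz.2.2⟩) _
  have e2 : ∀ u, ∫⁻ x, A.indicator (Function.uncurry F) (x, u) =
      (Ioo a b).indicator (fun u => ∫⁻ x in Ioo u b, F x u) u := by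
    intro u
    by_cases hx : u ∈ Ioo a b
    · rw [indicator_of_mem hx, ← lintegral_indicator measurableSet_Ioo]
      refine lintegral_congr fun x => ?_
      simp only [indicator, A, mem_ofPred_eq, mem_Ioo, Function.uncurry]
      congr 1
      simp [hx.1]
    · rw [indicator_of_notMem hx]
      rw [← lintegral_zero (μ := (volume : Measure ℝ))]
      refine lintegral_congr fun x => indicator_of_notMem (fun hz => hx ⟨hz.1, hz.2.1.trans hz.2.2⟩) _
  simp_rw [e1, e2, lintegral_indicator measurableSet_Ioo] at h
  exact h

theorem measurable_lintegral_Ioo_left {F : ℝ → ℝ → ℝ≥0∞} (hF : Measurable (Function.uncurry F))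
    (a : ℝ) : Measurable (fun x => ∫⁻ u in Ioo a x, F x u) := by
  set A : Set (ℝ × ℝ) := {z | a < z.2 ∧ z.2 < z.1}
  have hA : MeasurableSet A := (measurableSet_lt measurable_const measurable_snd).inter
    (measurableSet_lt measurable_snd measurable_fst)
  have h := Measurable.lintegral_prod_right' (ν := (volume : Measure ℝ)) (hF.indicator hA)
  convert h using 2 with x
  rw [← lintegral_indicator measurableSet_Ioo]
  rfl

/-- Write g x - g u = (g x - g s) + (g s - g u) for u beyond s. The first part integrates explicitly
and cancels the change of the boundary term, so moving the right end point from s to t involves only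
increments of g inside [s, t]. -/
theorem HolderOnIcc.marchaudRight_sub {β Λ α : ℝ} {g : ℝ → ℝ} {x s t : ℝ}
    (hg : HolderOnIcc β Λ g x t) (hgm : Measurable g) (hα : α < 1) (hαβ : 1 < α + β)
    (hxs : x < s) (hst : s ≤ t) :
    marchaudRight α g t x - marchaudRight α g s x =
      (g s - g t) * (t - x) ^ (α - 1) + (1 - α) * ∫ u in s..t, (g s - g u) * (u - x) ^ (α - 2) := by
  have hk : IntervalIntegrable (fun u => (u - x) ^ (α - 2)) volume s t := by
    refine ContinuousOn.intervalIntegrable (ContinuousOn.rpow_const (by fun_prop) fun u hu => ?_)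
    rw [uIcc_of_le hst] at hu
    exact Or.inl (by linarith [hu.1])
  have i1 : IntervalIntegrable (fun u => (g x - g u) * (u - x) ^ (α - 2)) volume x s :=
    (hg.mono le_rfl hst).intervalIntegrable hgm hαβ le_rfl hxs.le
  have i2 : IntervalIntegrable (fun u => (g x - g u) * (u - x) ^ (α - 2)) volume x t :=
    hg.intervalIntegrable hgm hαβ le_rfl (hxs.le.trans hst)
  have i3 := i1.symm.trans i2
  have e1 : ∫ u in s..t, (g s - g u) * (u - x) ^ (α - 2) =
      (∫ u in s..t, (g x - g u) * (u - x) ^ (α - 2)) - (g x - g s) * ∫ u in s..t, (u - x) ^ (α - 2) := by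
    rw [← intervalIntegral.integral_const_mul, ← intervalIntegral.integral_sub i3 (hk.const_mul _)]
    congr 1; ext u; ring
  have e2 : (1 - α) * ∫ u in s..t, (u - x) ^ (α - 2) = (s - x) ^ (α - 1) - (t - x) ^ (α - 1) := by
    rw [intervalIntegral.integral_comp_sub_right (fun y => y ^ (α - 2)) x, integral_rpow]
    · rw [show α - 2 + 1 = α - 1 by ring]
      have : α - 1 ≠ 0 := by linarith
      field_simp; ring
    · refine Or.inr ⟨by linarith, ?_⟩
      rw [uIcc_of_le (by linarith)]
      exact fun h => by linarith [h.1]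
  unfold marchaudRight
  rw [e1, ← intervalIntegral.integral_add_adjacent_intervals i1 i3]
  linear_combination (g x - g s) * e2

/-- The full factor (t-s)^β is extracted at the price of the singularity (t-x)^{α-1}, which is still
integrable in t. This is what makes the later bootstrap close. -/
theorem HolderOnIcc.abs_marchaudRight_sub_le {β Λ α : ℝ} {g : ℝ → ℝ} {x s t : ℝ}
    (hg : HolderOnIcc β Λ g x t) (hgm : Measurable g) (hβ : 0 < β) (hΛ : 0 ≤ Λ)
    (hα : α < 1) (hαβ : 1 < α + β) (hxs : x < s) (hst : s ≤ t) :
    |marchaudRight α g t x - marchaudRight α g s x| ≤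
      (1 + (1 - α) / (α + β - 1)) * Λ * ((t - s) ^ β * (t - x) ^ (α - 1)) := by
  have hp : 0 < t - x := by linarith
  have hq : 0 ≤ t - s := by linarith
  rw [hg.marchaudRight_sub hgm hα hαβ hxs hst]
  have h1 : |(g s - g t) * (t - x) ^ (α - 1)| ≤ Λ * ((t - s) ^ β * (t - x) ^ (α - 1)) := by
    rw [abs_mul, abs_sub_comm, abs_of_nonneg (Real.rpow_nonneg hp.le (α - 1)), ← mul_assoc]
    exact mul_le_mul_of_nonneg_right (hg s t hxs.le hst le_rfl) (Real.rpow_nonneg hp.le _)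
  have h2 : |∫ u in s..t, (g s - g u) * (u - x) ^ (α - 2)| ≤
      Λ * ((t - s) ^ β * (t - x) ^ (α - 1)) / (α + β - 1) := by
    have h3 := intervalIntegral.norm_integral_le_of_norm_le (μ := volume) (a := s) (b := t)
      (f := fun u => (g s - g u) * (u - x) ^ (α - 2))
      (g := fun u => Λ * ((t - s) ^ β * (t - x) ^ (-β)) * (u - x) ^ (α + β - 2)) hst
      (Eventually.of_forall fun u hu => by
        have hux : 0 < u - x := by linarith [hu.1]
        rw [Real.norm_eq_abs, abs_mul, abs_sub_comm, abs_of_nonneg (Real.rpow_nonneg hux.le (α - 2))]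
        have a1 := mul_le_mul_of_nonneg_right (hg s u hxs.le hu.1.le hu.2)
          (Real.rpow_nonneg hux.le (α - 2))
        refine a1.trans ?_
        rw [show α + β - 2 = (α - 2) + β by ring, Real.rpow_add hux, mul_assoc, mul_assoc Λ]
        refine mul_le_mul_of_nonneg_left ?_ hΛ
        rw [mul_comm ((u - x) ^ (α - 2)), ← mul_assoc]
        refine mul_le_mul_of_nonneg_right ?_ (Real.rpow_nonneg hux.le (α - 2))
        rw [Real.rpow_neg hp.le, mul_assoc, mul_comm (((t - x) ^ β)⁻¹), ← mul_assoc,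
          ← Real.mul_rpow hq hux.le, ← div_eq_mul_inv, le_div_iff₀ (Real.rpow_pos_of_pos hp _),
          ← Real.mul_rpow (by linarith [hu.1]) hp.le]
        -- Since x < s, the quotient (u-s)/(u-x) increases in u, hence is at most (t-s)/(t-x).
        refine Real.rpow_le_rpow (mul_nonneg (by linarith [hu.1]) hp.le) ?_ hβ.le
        nlinarith [hu.1, hu.2])
      ((intervalIntegrable_sub_right_rpow (p := α + β - 2) (by linarith) x s t).const_mul _)
    rw [intervalIntegral.integral_const_mul] at h3
    have h4 : ∫ u in s..t, (u - x) ^ (α + β - 2) ≤ (t - x) ^ (α + β - 1) / (α + β - 1) := by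
      have e := intervalIntegral.integral_add_adjacent_intervals
        (intervalIntegrable_sub_right_rpow (p := α + β - 2) (by linarith) x x s)
        (intervalIntegrable_sub_right_rpow (p := α + β - 2) (by linarith) x s t)
      rw [integral_sub_right_rpow (by linarith), integral_sub_right_rpow (by linarith),
        show α + β - 2 + 1 = α + β - 1 by ring] at e
      have : 0 ≤ (s - x) ^ (α + β - 1) / (α + β - 1) :=
        div_nonneg (Real.rpow_nonneg (by linarith) _) (by linarith)
      linarith
    refine h3.trans ((mul_le_mul_of_nonneg_left h4 (mul_nonneg hΛ (mul_nonneg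
      (Real.rpow_nonneg hq _) (Real.rpow_nonneg hp.le _)))).trans (le_of_eq ?_))
    rw [show α + β - 1 = (α - 1) + β by ring, Real.rpow_add hp, Real.rpow_neg hp.le]
    have := (Real.rpow_pos_of_pos hp β).ne'
    field_simp
  refine (abs_add_le _ _).trans ?_
  rw [abs_mul (1 - α), abs_of_pos (by linarith : 0 < 1 - α)]
  have := mul_le_mul_of_nonneg_left h2 (by linarith : 0 ≤ 1 - α)
  refine (add_le_add h1 this).trans (le_of_eq (by ring))

theorem HolderOnIcc.integrable_mul_marchaudRight {β Λ α : ℝ} {g ψ : ℝ → ℝ} {s t : ℝ}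
    (hg : HolderOnIcc β Λ g s t) (hgm : Measurable g) (hα : α < 1) (hαβ : 1 < α + β) (hΛ : 0 ≤ Λ)
    (hψ : IntegrableOn ψ (Ioo s t)) :
    IntegrableOn (fun x => ψ x * marchaudRight α g t x) (Ioo s t) := by
  refine hψ.mul_bdd (c := (1 + (1 - α) / (α + β - 1)) * Λ * (t - s) ^ (α + β - 1))
    (measurable_marchaudRight α hgm t).aestronglyMeasurable ?_
  refine (ae_restrict_iff' measurableSet_Ioo).2 (Eventually.of_forall fun x hx => ?_)
  refine (hg.abs_marchaudRight_le hα hαβ hx.1.le hx.2).trans ?_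
  have h0 : 0 ≤ (1 - α) / (α + β - 1) := div_nonneg (by linarith) (by linarith)
  gcongr <;> linarith [hx.1, hx.2]

/-- Only ψ ∈ L¹ is available here. The difference splits into the change of the right derivative on
(0, s) and the new piece on (s, t); on the latter (t-x)^{α+β-1} ≤ (t-s)^β (t-x)^{α-1}, so both
pieces obey the same pointwise bound. -/
theorem HolderOnIcc.enorm_integral_sub_le {β Λ α : ℝ} {g ψ : ℝ → ℝ} {s t : ℝ}
    (hg : HolderOnIcc β Λ g 0 t) (hgm : Measurable g) (hβ : 0 < β) (hα : α < 1)
    (hαβ : 1 < α + β) (hΛ : 0 ≤ Λ)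
    (hψ : IntegrableOn ψ (Ioo 0 t)) (hs : 0 < s) (hst : s ≤ t) :
    ‖(∫ x in (0 : ℝ)..t, ψ x * marchaudRight α g t x) -
        ∫ x in (0 : ℝ)..s, ψ x * marchaudRight α g s x‖ₑ ≤
      ENNReal.ofReal ((1 + (1 - α) / (α + β - 1)) * Λ * (t - s) ^ β) *
        ∫⁻ x in Ioo 0 t, ‖ψ x‖ₑ * ENNReal.ofReal ((t - x) ^ (α - 1)) := by
  set C := (1 + (1 - α) / (α + β - 1)) * Λ
  have hC : 0 ≤ C := mul_nonneg (add_nonneg zero_le_one (div_nonneg (by linarith) (by linarith))) hΛ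
  have it := hg.integrable_mul_marchaudRight hgm hα hαβ hΛ hψ
  have is := (hg.mono le_rfl hst).integrable_mul_marchaudRight hgm hα hαβ hΛ
    (hψ.mono_set (Ioo_subset_Ioo_right hst))
  have it1 : IntervalIntegrable (fun x => ψ x * marchaudRight α g t x) volume 0 t :=
    (intervalIntegrable_iff_integrableOn_Ioo_of_le (hs.le.trans hst)).2 it
  have is1 : IntervalIntegrable (fun x => ψ x * marchaudRight α g s x) volume 0 s :=
    (intervalIntegrable_iff_integrableOn_Ioo_of_le hs.le).2 is
  have it2 : IntervalIntegrable (fun x => ψ x * marchaudRight α g t x) volume 0 s :=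
    it1.mono_set (by rw [uIcc_of_le hs.le, uIcc_of_le (hs.le.trans hst)]; exact Icc_subset_Icc_right hst)
  have it3 := it2.symm.trans it1
  have e : (∫ x in (0 : ℝ)..t, ψ x * marchaudRight α g t x) -
        ∫ x in (0 : ℝ)..s, ψ x * marchaudRight α g s x =
      (∫ x in Ioo 0 s, ψ x * (marchaudRight α g t x - marchaudRight α g s x)) +
        ∫ x in Ioo s t, ψ x * marchaudRight α g t x := by
    rw [← intervalIntegral.integral_add_adjacent_intervals it2 it3, add_sub_right_comm,
      ← intervalIntegral.integral_sub it2 is1, intervalIntegral.integral_of_le hs.le,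
      intervalIntegral.integral_of_le hst, integral_Ioc_eq_integral_Ioo,
      integral_Ioc_eq_integral_Ioo]
    simp only [mul_sub]
  have ptw : ∀ (D : ℝ → ℝ) (u v : ℝ), (∀ x ∈ Ioo u v, |D x| ≤ C * ((t - s) ^ β * (t - x) ^ (α - 1))) →
      ‖∫ x in Ioo u v, ψ x * D x‖ₑ ≤ ∫⁻ x in Ioo u v, ENNReal.ofReal (C * (t - s) ^ β) *
        (‖ψ x‖ₑ * ENNReal.ofReal ((t - x) ^ (α - 1))) := by
    intro D u v hD
    refine (enorm_integral_le_lintegral_enorm _).trans (setLIntegral_mono' measurableSet_Ioo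
      fun x hx => ?_)
    rw [enorm_mul, mul_left_comm, ← ENNReal.ofReal_mul (mul_nonneg hC (Real.rpow_nonneg (by linarith) _))]
    gcongr
    rw [Real.enorm_eq_ofReal_abs]
    exact ENNReal.ofReal_le_ofReal ((hD x hx).trans (le_of_eq (by ring)))
  rw [e, ← lintegral_const_mul' _ _ ENNReal.ofReal_ne_top]
  refine (enorm_add_le _ _).trans ?_
  refine (add_le_add (ptw _ 0 s fun x hx => ?_) (ptw _ s t fun x hx => ?_)).trans ?_
  · exact (hg.mono hx.1.le le_rfl).abs_marchaudRight_sub_le hgm hβ hΛ hα hαβ hx.2 hst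
  · refine (hg.abs_marchaudRight_le hα hαβ (hs.trans hx.1).le hx.2).trans ?_
    have h3 : (t - x) ^ (α + β - 1) = (t - x) ^ β * (t - x) ^ (α - 1) := by
      rw [← Real.rpow_add (by linarith [hx.2])]; congr 1; ring
    rw [h3]
    refine mul_le_mul_of_nonneg_left (mul_le_mul_of_nonneg_right ?_
      (Real.rpow_nonneg (by linarith [hx.2]) _)) hC
    exact Real.rpow_le_rpow (by linarith [hx.2]) (by linarith [hx.1]) hβ.le
  · rw [← lintegral_union measurableSet_Ioo
      (Set.disjoint_left.2 fun x h1 h2 => absurd h1.2 (not_lt.2 h2.1.le))]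
    refine lintegral_mono_set (union_subset (Ioo_subset_Ioo_right hst) (Ioo_subset_Ioo_left hs.le))

/-! ### Absolute convergence of the left derivative -/

/-- The inner integral of the Marchaud derivative with absolute values. -/
noncomputable def marchaudAbs (α : ℝ) (f : ℝ → ℝ) (s x : ℝ) : ℝ≥0∞ :=
  ∫⁻ u in Ioo s x, ‖f x - f u‖ₑ * ENNReal.ofReal ((x - u) ^ (-1 - α))

theorem measurable_marchaudAbs_integrand (α : ℝ) {f : ℝ → ℝ} (hf : Measurable f) :
    Measurable (Function.uncurry fun x u : ℝ => ‖f x - f u‖ₑ * ENNReal.ofReal ((x - u) ^ (-1 - α))) :=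
  ((hf.comp measurable_fst).sub (hf.comp measurable_snd)).enorm.mul
    ((measurable_fst.sub measurable_snd).pow_const _).ennreal_ofReal

theorem measurable_marchaudAbs (α : ℝ) {f : ℝ → ℝ} (hf : Measurable f) (s : ℝ) :
    Measurable (marchaudAbs α f s) :=
  measurable_lintegral_Ioo_left (measurable_marchaudAbs_integrand α hf) s

theorem marchaudAbs_anti (α : ℝ) (f : ℝ → ℝ) {s s' : ℝ} (h : s ≤ s') (x : ℝ) :
    marchaudAbs α f s' x ≤ marchaudAbs α f s x :=
  lintegral_mono_set (Ioo_subset_Ioo_left h)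

/-- Integrability of the left derivative does not control the integral of |f x - f u|, because of
possible cancellation. The increment hypothesis `hf`, which the equation supplies, repairs this: it
bounds |f t - f s| by a constant times (1 + I t)(t-s)^β, where I is the fractional integral of |ψ|.
By Tonelli I is integrable on (0, T), and (t-s)^{β-α-1} is integrable in s because α < β. -/
theorem HolderOnIcc.lintegral_marchaudAbs_lt_top {β Λ α A T : ℝ} {f g : ℝ → ℝ}
    (hg : HolderOnIcc β Λ g 0 T) (hgm : Measurable g) (hfm : Measurable f)
    (hβα : α < β) (hα0 : 0 < α) (hα : α < 1) (hαβ : 1 < α + β) (hΛ : 0 ≤ Λ) (hA : 0 ≤ A)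
    (hψ : IntegrableOn (marchaudLeft α f 0) (Ioo 0 T))
    (hf : ∀ s t, 0 < s → s < t → t < T → |f t - f s| ≤ A * (t - s) ^ β + A *
      |(∫ x in (0 : ℝ)..t, marchaudLeft α f 0 x * marchaudRight α g t x) -
        ∫ x in (0 : ℝ)..s, marchaudLeft α f 0 x * marchaudRight α g s x|) :
    ∫⁻ x in Ioo 0 T, marchaudAbs α f 0 x < ∞ := by
  set ψ := marchaudLeft α f 0
  set C := (1 + (1 - α) / (α + β - 1)) * Λ
  have hC : 0 ≤ C := mul_nonneg (add_nonneg zero_le_one (div_nonneg (by linarith) (by linarith))) hΛ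
  have hψm : Measurable ψ := measurable_marchaudLeft α hfm 0
  set I : ℝ → ℝ≥0∞ := fun t => ∫⁻ x in Ioo 0 t, ‖ψ x‖ₑ * ENNReal.ofReal ((t - x) ^ (α - 1))
  have hFm : Measurable (Function.uncurry fun t x : ℝ => ‖ψ x‖ₑ * ENNReal.ofReal ((t - x) ^ (α - 1))) :=
    (hψm.comp measurable_snd).enorm.mul
      ((measurable_fst.sub measurable_snd).pow_const _).ennreal_ofReal
  have hI : ∫⁻ t in Ioo 0 T, I t < ∞ := by
    rw [lintegral_triangle_swap hFm]
    have : ∀ x ∈ Ioo 0 T, ∫⁻ t in Ioo x T, ‖ψ x‖ₑ * ENNReal.ofReal ((t - x) ^ (α - 1)) ≤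
        ‖ψ x‖ₑ * ENNReal.ofReal (T ^ α / α) := by
      intro x hx
      rw [lintegral_const_mul' _ _ enorm_ne_top, lintegral_sub_right_rpow (by linarith) hx.2.le,
        sub_add_cancel]
      gcongr <;> linarith [hx.1, hx.2]
    refine (setLIntegral_mono' measurableSet_Ioo this).trans_lt ?_
    rw [lintegral_mul_const' _ _ ENNReal.ofReal_ne_top]
    exact ENNReal.mul_lt_top hψ.2 ENNReal.ofReal_lt_top
  have key : ∀ t ∈ Ioo 0 T, marchaudAbs α f 0 t ≤
      (ENNReal.ofReal A * (1 + ENNReal.ofReal C * I t)) * ENNReal.ofReal (T ^ (β - α) / (β - α)) := by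
    intro t ht
    have hinc : ∀ s ∈ Ioo 0 t, ‖f t - f s‖ₑ * ENNReal.ofReal ((t - s) ^ (-1 - α)) ≤
        (ENNReal.ofReal A * (1 + ENNReal.ofReal C * I t)) *
          ENNReal.ofReal ((t - s) ^ (β - α - 1)) := by
      intro s hs
      have hts : 0 < t - s := by linarith [hs.2]
      have h1 := (hg.mono le_rfl ht.2.le).enorm_integral_sub_le hgm (by linarith) hα hαβ hΛ
        (hψ.mono_set (Ioo_subset_Ioo_right ht.2.le)) hs.1 hs.2.le
      have h2 : ‖f t - f s‖ₑ ≤ ENNReal.ofReal A * (1 + ENNReal.ofReal C * I t) *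
          ENNReal.ofReal ((t - s) ^ β) := by
        rw [Real.enorm_eq_ofReal_abs]
        refine (ENNReal.ofReal_le_ofReal (hf s t hs.1 hs.2 ht.2)).trans ?_
        rw [ENNReal.ofReal_add (by positivity) (by positivity), ENNReal.ofReal_mul hA,
          ENNReal.ofReal_mul hA, ← Real.enorm_eq_ofReal_abs]
        rw [ENNReal.ofReal_mul hC] at h1
        calc _ ≤ ENNReal.ofReal A * ENNReal.ofReal ((t - s) ^ β) + ENNReal.ofReal A *
              (ENNReal.ofReal C * ENNReal.ofReal ((t - s) ^ β) * I t) := by gcongr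
          _ = _ := by ring
      refine (mul_le_mul_left h2 _).trans (le_of_eq ?_)
      rw [mul_assoc, ← ENNReal.ofReal_mul (by positivity), ← Real.rpow_add hts]
      congr 3; ring
    refine (setLIntegral_mono' measurableSet_Ioo hinc).trans ?_
    rw [lintegral_const_mul _ (by fun_prop), lintegral_sub_left_rpow (by linarith) ht.1.le, sub_add_cancel]
    gcongr <;> linarith [ht.1, ht.2]
  refine (setLIntegral_mono' measurableSet_Ioo key).trans_lt ?_
  rw [lintegral_mul_const' _ _ ENNReal.ofReal_ne_top, lintegral_const_mul' _ _ ENNReal.ofReal_ne_top,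
    lintegral_add_left measurable_const, lintegral_const_mul' _ _ ENNReal.ofReal_ne_top]
  refine ENNReal.mul_lt_top (ENNReal.mul_lt_top ENNReal.ofReal_lt_top (ENNReal.add_lt_top.2 ⟨?_,
    ENNReal.mul_lt_top ENNReal.ofReal_lt_top hI⟩)) ENNReal.ofReal_lt_top
  simp

/-! ### Inversion of the left derivative by the fractional integral -/

/-- The profile of the difference quotient of `x ↦ (max (1 - x) 0) ^ α` at `0`. -/
noncomputable def powerProfile (α ρ : ℝ) : ℝ := (1 - (max (1 - ρ) 0) ^ α) * ρ ^ (-1 - α)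

theorem powerProfile_nonneg {α ρ : ℝ} (hα : 0 < α) (hρ : 0 < ρ) : 0 ≤ powerProfile α ρ := by
  refine mul_nonneg (sub_nonneg.2 (Real.rpow_le_one (le_max_right _ _) ?_ hα.le))
    (Real.rpow_nonneg hρ.le _)
  exact max_le (by linarith) zero_le_one

/-- On (0, 1] the inequality 1-ρ ≤ (1-ρ)^α bounds the profile by ρ^{-α}; beyond 1 the profile is
exactly ρ^{-1-α}. -/
theorem integrableOn_powerProfile {α : ℝ} (hα : 0 < α) (hα1 : α < 1) :
    IntegrableOn (powerProfile α) (Ioi 0) := by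
  have hm : Measurable (powerProfile α) := by unfold powerProfile; fun_prop
  rw [← Ioc_union_Ioi_eq_Ioi (zero_le_one (α := ℝ))]
  refine IntegrableOn.union ?_ ?_
  · have h := (intervalIntegrable_iff_integrableOn_Ioc_of_le zero_le_one).1
      (intervalIntegral.intervalIntegrable_rpow' (a := 0) (b := 1) (r := -α) (by linarith))
    refine Integrable.mono' h hm.aestronglyMeasurable
      ((ae_restrict_iff' measurableSet_Ioc).2 (Eventually.of_forall fun ρ hρ => ?_))
    rw [Real.norm_eq_abs, abs_of_nonneg (powerProfile_nonneg hα hρ.1)]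
    unfold powerProfile
    rw [max_eq_left (by linarith [hρ.2]), show -α = 1 + (-1 - α) by ring, Real.rpow_add hρ.1,
      Real.rpow_one]
    refine mul_le_mul_of_nonneg_right ?_ (Real.rpow_nonneg hρ.1.le _)
    have h1 : (1 - ρ) ^ (1 : ℝ) ≤ (1 - ρ) ^ α :=
      Real.rpow_le_rpow_of_exponent_ge' (by linarith [hρ.2]) (by linarith [hρ.1]) hα.le hα1.le
    rw [Real.rpow_one] at h1
    linarith
  · refine (integrableOn_Ioi_rpow_of_lt (a := -1 - α) (by linarith) zero_lt_one).congr_fun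
      (fun ρ hρ => ?_) measurableSet_Ioi
    unfold powerProfile
    rw [max_eq_right (by linarith [mem_Ioi.1 hρ]), Real.zero_rpow hα.ne', sub_zero, one_mul]

/-- The kernel is homogeneous of degree -1, so its integral over the half-line does not depend on c.
This is the source of the constant in the inversion formula. -/
theorem powerProfile_scale {α c r : ℝ} (hc : 0 < c) (hr : 0 < r) :
    (c ^ α - (max (c - r) 0) ^ α) * r ^ (-1 - α) = c⁻¹ * powerProfile α (c⁻¹ * r) := by
  unfold powerProfile
  have h1 : max (c - r) 0 = c * max (1 - c⁻¹ * r) 0 := by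
    rw [mul_max_of_nonneg _ _ hc.le]; congr 1 <;> field_simp; simp
  rw [h1, Real.mul_rpow hc.le (le_max_right _ _), Real.mul_rpow (inv_nonneg.2 hc.le) hr.le,
    Real.inv_rpow hc.le, show -1 - α = -(1 + α) by ring, Real.rpow_neg hc.le, inv_inv,
    Real.rpow_add hc, Real.rpow_one]
  field_simp

theorem integrableOn_powerProfile_scale {α c : ℝ} (hα : 0 < α) (hα1 : α < 1) (hc : 0 < c) :
    IntegrableOn (fun r => (c ^ α - (max (c - r) 0) ^ α) * r ^ (-1 - α)) (Ioi 0) := by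
  refine IntegrableOn.congr_fun ?_ (fun r hr => (powerProfile_scale hc hr).symm) measurableSet_Ioi
  refine Integrable.const_mul ?_ _
  have := (integrableOn_Ioi_comp_mul_left_iff (powerProfile α) 0 (inv_pos.2 hc)).2
  rw [mul_zero] at this
  exact this (integrableOn_powerProfile hα hα1)

theorem integral_powerProfile_scale {α c : ℝ} (hc : 0 < c) :
    ∫ r in Ioi 0, (c ^ α - (max (c - r) 0) ^ α) * r ^ (-1 - α) = ∫ ρ in Ioi 0, powerProfile α ρ := by
  rw [setIntegral_congr_fun measurableSet_Ioi fun r hr => powerProfile_scale hc hr,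
    integral_const_mul, integral_comp_mul_left_Ioi _ _ (inv_pos.2 hc)]
  simp [hc.ne']

/-- Once f is extended by zero to the left of s, the boundary term of the derivative becomes the
tail r ≥ x-s of one integral over the half-line. -/
theorem lintegral_tail_diff {α K s x : ℝ} {f : ℝ → ℝ} (hα : 0 < α) (hK : ∀ y, |f y| ≤ K)
    (hx : s < x) :
    ∫⁻ r in Ioi 0, ‖((Ioi s).indicator f x - (Ioi s).indicator f (x - r)) * r ^ (-1 - α)‖ₑ ≤
      marchaudAbs α f s x + ENNReal.ofReal (K * ((x - s) ^ (-α) / α)) := by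
  have hxs : 0 < x - s := by linarith
  have hK0 : 0 ≤ K := (abs_nonneg _).trans (hK 0)
  have hsub : Ioi (0 : ℝ) ⊆ Ioo 0 (x - s) ∪ Ici (x - s) := fun r hr => by
    rcases lt_or_ge r (x - s) with h | h
    · exact Or.inl ⟨hr, h⟩
    · exact Or.inr h
  refine (lintegral_mono_set hsub).trans ((lintegral_union_le _ _ _).trans (add_le_add ?_ ?_))
  · unfold marchaudAbs
    rw [← lintegral_indicator measurableSet_Ioo, ← lintegral_indicator measurableSet_Ioo,
      ← lintegral_sub_left_eq_self _ x]
    refine lintegral_mono fun r => ?_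
    by_cases hr : x - r ∈ Ioo 0 (x - s)
    · have hr2 : r ∈ Ioo s x := ⟨by linarith [hr.2], by linarith [hr.1]⟩
      rw [indicator_of_mem hr, indicator_of_mem hr2, indicator_of_mem (mem_Ioi.2 hx), sub_sub_cancel,
        indicator_of_mem (mem_Ioi.2 hr2.1), enorm_mul]
      rw [Real.enorm_of_nonneg (Real.rpow_nonneg hr.1.le _)]
    · rw [indicator_of_notMem hr]; exact zero_le
  · have h1 : ∀ r ∈ Ici (x - s), ‖((Ioi s).indicator f x - (Ioi s).indicator f (x - r)) *
        r ^ (-1 - α)‖ₑ ≤ ENNReal.ofReal (K * r ^ (-1 - α)) := by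
      intro r hr
      have hr0 : 0 < r := hxs.trans_le hr
      rw [indicator_of_mem (mem_Ioi.2 hx), indicator_of_notMem (by simpa using by linarith [mem_Ici.1 hr]),
        sub_zero, Real.enorm_eq_ofReal_abs, abs_mul, abs_of_nonneg (Real.rpow_nonneg hr0.le _)]
      gcongr
      exact hK x
    refine (setLIntegral_mono' measurableSet_Ici h1).trans (le_of_eq ?_)
    rw [setLIntegral_congr Ioi_ae_eq_Ici.symm, ← ofReal_integral_eq_lintegral_ofReal]
    · rw [integral_const_mul, integral_Ioi_rpow_of_lt (by linarith) hxs,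
        show -1 - α + 1 = -α by ring, neg_div_neg_eq]
    · exact (integrableOn_Ioi_rpow_of_lt (by linarith) hxs).const_mul K
    · exact (ae_restrict_iff' measurableSet_Ioi).2 (Eventually.of_forall fun r hr =>
        mul_nonneg hK0 (Real.rpow_nonneg (hxs.trans hr).le _))

/-- The form of the left derivative as a single difference integral over r > 0 is the one to which
translation in x applies. -/
theorem integral_tail_diff {α K s x : ℝ} {f : ℝ → ℝ} (hα : 0 < α) (hfm : Measurable f)
    (hK : ∀ y, |f y| ≤ K) (hx : s < x) (hfin : marchaudAbs α f s x < ∞) :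
    α * ∫ r in Ioi 0, ((Ioi s).indicator f x - (Ioi s).indicator f (x - r)) * r ^ (-1 - α) =
      marchaudLeft α f s x := by
  have hxs : 0 < x - s := by linarith
  have hint : IntegrableOn (fun r => ((Ioi s).indicator f x - (Ioi s).indicator f (x - r)) *
      r ^ (-1 - α)) (Ioi 0) := by
    refine ⟨Measurable.aestronglyMeasurable ?_, ?_⟩
    · exact (((hfm.indicator measurableSet_Ioi).comp (measurable_id.const_sub x)).const_sub _).mul
        (measurable_id.pow_const _)
    · exact (lintegral_tail_diff hα hK hx).trans_lt (ENNReal.add_lt_top.2 ⟨hfin, ENNReal.ofReal_lt_top⟩)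
  rw [← Ioc_union_Ioi_eq_Ioi hxs.le] at hint ⊢
  rw [setIntegral_union (Ioc_disjoint_Ioi le_rfl) measurableSet_Ioi
    (hint.mono_set subset_union_left) (hint.mono_set subset_union_right)]
  have e1 : ∫ r in Ioi (x - s), ((Ioi s).indicator f x - (Ioi s).indicator f (x - r)) * r ^ (-1 - α)
      = f x * ((x - s) ^ (-α) / α) := by
    rw [setIntegral_congr_fun (g := fun r => f x * r ^ (-1 - α)) measurableSet_Ioi fun r hr => ?_]
    · rw [integral_const_mul, integral_Ioi_rpow_of_lt (by linarith) hxs,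
        show -1 - α + 1 = -α by ring, neg_div_neg_eq]
    · simp only
      rw [indicator_of_mem (mem_Ioi.2 hx), indicator_of_notMem (by simpa using by linarith [mem_Ioi.1 hr]),
        sub_zero]
  have e2 : ∫ r in Ioc 0 (x - s), ((Ioi s).indicator f x - (Ioi s).indicator f (x - r)) * r ^ (-1 - α)
      = ∫ u in s..x, (f x - f u) * (x - u) ^ (-1 - α) := by
    have h := intervalIntegral.integral_comp_sub_left (a := 0) (b := x - s)
      (fun u => (f x - f u) * (x - u) ^ (-1 - α)) x
    simp only [sub_sub_cancel, sub_zero] at h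
    rw [← h, intervalIntegral.integral_of_le hxs.le, integral_Ioc_eq_integral_Ioo,
      integral_Ioc_eq_integral_Ioo]
    refine setIntegral_congr_fun measurableSet_Ioo fun r hr => ?_
    rw [indicator_of_mem (mem_Ioi.2 hx), indicator_of_mem (mem_Ioi.2 (by linarith [hr.2]))]
  rw [e1, e2]
  unfold marchaudLeft
  field_simp
  ring

/-- Put k(x) = ((τ-x)₊)^α. Fubini and a translation move the difference from the zero extension F of
f to k; for every x < τ the integral of (k(x) - k(x+r)) r^{-1-α} over r > 0 is the same constant by
scaling, and only the integral of f remains. -/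
theorem integral_rpow_mul_marchaudLeft {α K s τ : ℝ} {f : ℝ → ℝ} (hα : 0 < α) (hα1 : α < 1)
    (hfm : Measurable f) (hK : ∀ y, |f y| ≤ K) (hsτ : s ≤ τ)
    (hW : ∫⁻ x in Ioo s τ, marchaudAbs α f s x < ∞) :
    ∫ x in Ioo s τ, (τ - x) ^ α * marchaudLeft α f s x =
      α * (∫ ρ in Ioi 0, powerProfile α ρ) * ∫ x in Ioo s τ, f x := by
  have hK0 : 0 ≤ K := (abs_nonneg _).trans (hK 0)
  set c := ∫ ρ in Ioi 0, powerProfile α ρ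
  set F := (Ioi s).indicator f
  have hFm : Measurable F := hfm.indicator measurableSet_Ioi
  have hFK : ∀ y, |F y| ≤ K := fun y => by
    by_cases hy : y ∈ Ioi s
    · simp only [F, indicator_of_mem hy]; exact hK y
    · simp only [F, indicator_of_notMem hy, abs_zero]; exact hK0
  set k : ℝ → ℝ := fun x => (max (τ - x) 0) ^ α
  have hkm : Measurable k := by fun_prop
  have hk0 : ∀ x, τ ≤ x → k x = 0 := fun x hx => by
    simp only [k]; rw [max_eq_right (by linarith), Real.zero_rpow hα.ne']
  have hkn : ∀ x, 0 ≤ k x := fun x => Real.rpow_nonneg (le_max_right _ _) _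
  have hkT : ∀ x, s < x → k x ≤ (τ - s) ^ α := fun x hx =>
    Real.rpow_le_rpow (le_max_right _ _) (max_le (by linarith) (by linarith)) hα.le
  have hF0 : ∀ x, x ≤ s → F x = 0 := fun x hx => indicator_of_notMem (by simpa using hx) _
  -- joint integrability of the difference kernel
  have hD : Integrable (Function.uncurry fun x r : ℝ => (F x - F (x - r)) * r ^ (-1 - α) * k x)
      (volume.prod (volume.restrict (Ioi 0))) := by
    have hm : Measurable (Function.uncurry fun x r : ℝ => (F x - F (x - r)) * r ^ (-1 - α) * k x) :=
      (((hFm.comp measurable_fst).sub (hFm.comp (measurable_fst.sub measurable_snd))).mul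
        (measurable_snd.pow_const _)).mul (hkm.comp measurable_fst)
    refine ⟨hm.aestronglyMeasurable, ?_⟩
    rw [hasFiniteIntegral_iff_enorm, lintegral_prod _ hm.enorm.aemeasurable]
    have hb : ∀ x, ∫⁻ r in Ioi 0, ‖(F x - F (x - r)) * r ^ (-1 - α) * k x‖ₑ ≤
        (Ioo s τ).indicator (fun x => (marchaudAbs α f s x +
          ENNReal.ofReal (K * ((x - s) ^ (-α) / α))) * ENNReal.ofReal ((τ - s) ^ α)) x := by
      intro x
      by_cases hx : x ∈ Ioo s τ
      · rw [indicator_of_mem hx]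
        simp_rw [enorm_mul _ (k x)]
        rw [lintegral_mul_const' _ _ enorm_ne_top, Real.enorm_of_nonneg (hkn x)]
        exact mul_le_mul' (lintegral_tail_diff hα hK hx.1) (ENNReal.ofReal_le_ofReal (hkT x hx.1))
      · rw [indicator_of_notMem hx]
        have : ∀ r ∈ Ioi (0 : ℝ), ‖(F x - F (x - r)) * r ^ (-1 - α) * k x‖ₑ ≤ 0 := by
          intro r hr
          rcases le_or_gt x s with h | h
          · rw [hF0 x h, hF0 (x - r) (by linarith [mem_Ioi.1 hr])]; simp
          · rw [hk0 x (not_lt.1 fun h' => hx ⟨h, h'⟩)]; simp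
        exact (setLIntegral_mono' measurableSet_Ioi this).trans (by simp)
    refine (lintegral_mono hb).trans_lt ?_
    rw [lintegral_indicator measurableSet_Ioo, lintegral_mul_const' _ _ ENNReal.ofReal_ne_top]
    refine ENNReal.mul_lt_top ?_ ENNReal.ofReal_lt_top
    rw [lintegral_add_left (measurable_marchaudAbs α hfm s)]
    refine ENNReal.add_lt_top.2 ⟨hW, ?_⟩
    rw [lintegral_Ioo_ofReal hsτ]
    · exact ENNReal.ofReal_lt_top
    · exact ((intervalIntegrable_sub_right_rpow (by linarith) s s τ).div_const α).const_mul K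
    · exact fun u hu => mul_nonneg hK0 (div_nonneg (Real.rpow_nonneg (by linarith [hu.1]) _) hα.le)
  -- joint integrability after the translation
  have hE : Integrable (Function.uncurry fun x r : ℝ => F x * ((k x - k (x + r)) * r ^ (-1 - α)))
      (volume.prod (volume.restrict (Ioi 0))) := by
    have hm : Measurable (Function.uncurry fun x r : ℝ => F x * ((k x - k (x + r)) * r ^ (-1 - α))) :=
      (hFm.comp measurable_fst).mul (((hkm.comp measurable_fst).sub
        (hkm.comp (measurable_fst.add measurable_snd))).mul (measurable_snd.pow_const _))
    refine ⟨hm.aestronglyMeasurable, ?_⟩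
    rw [hasFiniteIntegral_iff_enorm, lintegral_prod _ hm.enorm.aemeasurable]
    have hb : ∀ x, ∫⁻ r in Ioi 0, ‖F x * ((k x - k (x + r)) * r ^ (-1 - α))‖ₑ ≤
        (Ioo s τ).indicator (fun _ => ENNReal.ofReal K * ENNReal.ofReal c) x := by
      intro x
      by_cases hx : x ∈ Ioo s τ
      · rw [indicator_of_mem hx]
        simp_rw [enorm_mul (F x)]
        rw [lintegral_const_mul' _ _ enorm_ne_top, Real.enorm_eq_ofReal_abs]
        refine mul_le_mul' (ENNReal.ofReal_le_ofReal (hFK x)) (le_of_eq ?_)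
        -- Since k is nonincreasing, the absolute value can be dropped and the integral in r is
        -- exactly the scale-invariant constant c.
        have hc : 0 < τ - x := by linarith [hx.2]
        rw [show c = _ from (integral_powerProfile_scale hc).symm, ofReal_integral_eq_lintegral_ofReal
          (integrableOn_powerProfile_scale hα hα1 hc)]
        · refine setLIntegral_congr_fun measurableSet_Ioi fun r hr => ?_
          rw [Real.enorm_of_nonneg]
          · simp only [k]; rw [max_eq_left hc.le, sub_sub]
          · refine mul_nonneg (sub_nonneg.2 ?_) (Real.rpow_nonneg (le_of_lt hr) _)
            exact Real.rpow_le_rpow (le_max_right _ _)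
              (max_le_max (by linarith [mem_Ioi.1 hr]) le_rfl) hα.le
        · refine (ae_restrict_iff' measurableSet_Ioi).2 (Eventually.of_forall fun r hr => ?_)
          simp only [Pi.zero_apply]
          rw [powerProfile_scale hc hr]
          exact mul_nonneg (inv_nonneg.2 hc.le)
            (powerProfile_nonneg hα (mul_pos (inv_pos.2 hc) hr))
      · rw [indicator_of_notMem hx]
        have : ∀ r ∈ Ioi (0 : ℝ), ‖F x * ((k x - k (x + r)) * r ^ (-1 - α))‖ₑ ≤ 0 := by
          intro r hr
          rcases le_or_gt x s with h | h
          · rw [hF0 x h]; simp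
          · have h2 : τ ≤ x := not_lt.1 fun h' => hx ⟨h, h'⟩
            rw [hk0 x h2, hk0 (x + r) (by linarith [mem_Ioi.1 hr])]; simp
        exact (setLIntegral_mono' measurableSet_Ioi this).trans (by simp)
    refine (lintegral_mono hb).trans_lt ?_
    rw [lintegral_indicator measurableSet_Ioo, lintegral_const]
    exact ENNReal.mul_lt_top (ENNReal.mul_lt_top ENNReal.ofReal_lt_top ENNReal.ofReal_lt_top) (by simp)
  have hFk : ∀ r, 0 ≤ r → Integrable (fun x => F x * k (x + r)) := by
    intro r hr
    have h1 : IntegrableOn (fun x => F x * k (x + r)) (Ioo s τ) := by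
      refine Measure.integrableOn_of_bounded (M := K * (τ - s) ^ α) (by simp)
        (hFm.mul (hkm.comp (measurable_id.add_const r))).aestronglyMeasurable
        ((ae_restrict_iff' measurableSet_Ioo).2 (Eventually.of_forall fun x hx => ?_))
      rw [Real.norm_eq_abs, abs_mul, abs_of_nonneg (hkn _)]
      exact mul_le_mul (hFK x) (hkT _ (by linarith [hx.1])) (hkn _) hK0
    refine (integrableOn_iff_integrable_of_support_subset fun x hx => ?_).1 h1
    by_contra h
    apply hx
    rcases le_or_gt x s with h' | h'
    · simp [hF0 x h']
    · rw [hk0 (x + r) (by linarith [not_lt.1 fun h'' => h ⟨h', h''⟩]), mul_zero]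
  -- Summation by parts for a fixed shift r: the integral of F(x-r) k(x) equals that of F(x) k(x+r).
  -- The two joint integrability statements justify exchanging the integrals before and after.
  have key : ∫ x, ∫ r in Ioi 0, (F x - F (x - r)) * r ^ (-1 - α) * k x =
      ∫ x, ∫ r in Ioi 0, F x * ((k x - k (x + r)) * r ^ (-1 - α)) := by
    rw [integral_integral_swap hD, integral_integral_swap hE]
    refine setIntegral_congr_fun measurableSet_Ioi fun r hr => ?_
    have hr0 : (0 : ℝ) ≤ r := le_of_lt hr
    have i1 := hFk 0 le_rfl
    simp only [add_zero] at i1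
    have i2 := hFk r hr0
    have i3 := i2.comp_sub_right r
    simp only [sub_add_cancel] at i3
    have e := integral_sub_right_eq_self (μ := (volume : Measure ℝ)) (fun x => F x * k (x + r)) r
    simp only [sub_add_cancel] at e
    calc ∫ x, (F x - F (x - r)) * r ^ (-1 - α) * k x
        = ∫ x, r ^ (-1 - α) * (F x * k x - F (x - r) * k x) := by congr 1; ext x; ring
      _ = r ^ (-1 - α) * ((∫ x, F x * k x) - ∫ x, F x * k (x + r)) := by
          rw [integral_const_mul, integral_sub i1 i3, e]
      _ = ∫ x, r ^ (-1 - α) * (F x * k x - F x * k (x + r)) := by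
          rw [integral_const_mul, integral_sub i1 i2]
      _ = _ := by congr 1; ext x; ring
  have eL : α * ∫ x, ∫ r in Ioi 0, (F x - F (x - r)) * r ^ (-1 - α) * k x =
      ∫ x in Ioo s τ, (τ - x) ^ α * marchaudLeft α f s x := by
    rw [← setIntegral_eq_integral_of_forall_compl_eq_zero (s := Ioo s τ), ← integral_const_mul]
    · refine setIntegral_congr_ae measurableSet_Ioo ?_
      filter_upwards [(ae_restrict_iff' measurableSet_Ioo).1 (ae_lt_top
        (measurable_marchaudAbs α hfm s) hW.ne)] with x hx hxm
      rw [integral_mul_const, ← integral_tail_diff hα hfm hK hxm.1 (hx hxm)]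
      simp only [k]
      rw [max_eq_left (by linarith [hxm.2])]
      ring
    · intro x hx
      rw [setIntegral_congr_fun (g := fun _ => (0 : ℝ)) measurableSet_Ioi fun r hr => ?_]
      · simp
      · simp only
        rcases le_or_gt x s with h | h
        · rw [hF0 x h, hF0 (x - r) (by linarith [mem_Ioi.1 hr])]; simp
        · rw [hk0 x (not_lt.1 fun h' => hx ⟨h, h'⟩)]; simp
  have eR : ∫ x, ∫ r in Ioi 0, F x * ((k x - k (x + r)) * r ^ (-1 - α)) =
      c * ∫ x in Ioo s τ, f x := by
    rw [← setIntegral_eq_integral_of_forall_compl_eq_zero (s := Ioo s τ), ← integral_const_mul]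
    · refine setIntegral_congr_fun measurableSet_Ioo fun x hx => ?_
      have hc : 0 < τ - x := by linarith [hx.2]
      rw [integral_const_mul, mul_comm]
      congr 1
      · rw [show c = _ from (integral_powerProfile_scale hc).symm]
        refine setIntegral_congr_fun measurableSet_Ioi fun r hr => ?_
        simp only [k]
        rw [max_eq_left hc.le, sub_sub]
      · exact indicator_of_mem (mem_Ioi.2 hx.1) _
    · intro x hx
      rw [setIntegral_congr_fun (g := fun _ => (0 : ℝ)) measurableSet_Ioi fun r hr => ?_]
      · simp
      · simp only
        rcases le_or_gt x s with h | h
        · rw [hF0 x h]; simp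
        · have h2 : τ ≤ x := not_lt.1 fun h' => hx ⟨h, h'⟩
          rw [hk0 x h2, hk0 (x + r) (by linarith [mem_Ioi.1 hr])]; simp
  rw [← eL, key, eR]; ring

theorem marchaudLeft_enorm_le {α K s x : ℝ} {f : ℝ → ℝ} (hα : 0 < α)
    (hK : |f x| ≤ K) (hx : s < x) :
    ‖marchaudLeft α f s x‖ₑ ≤ ENNReal.ofReal (K * (x - s) ^ (-α)) +
      ENNReal.ofReal α * marchaudAbs α f s x := by
  unfold marchaudLeft
  refine (enorm_add_le _ _).trans (add_le_add ?_ ?_)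
  · rw [Real.enorm_eq_ofReal_abs, abs_mul, abs_of_nonneg (Real.rpow_nonneg (by linarith) (-α))]
    refine ENNReal.ofReal_le_ofReal (mul_le_mul_of_nonneg_right hK (Real.rpow_nonneg (by linarith) _))
  · rw [enorm_mul, Real.enorm_of_nonneg hα.le]
    gcongr
    rw [intervalIntegral.integral_of_le hx.le, integral_Ioc_eq_integral_Ioo]
    refine (enorm_integral_le_lintegral_enorm _).trans (le_of_eq ?_)
    refine setLIntegral_congr_fun measurableSet_Ioo fun u hu => ?_
    rw [enorm_mul, Real.enorm_of_nonneg (Real.rpow_nonneg (by linarith [hu.2]) _)]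

theorem integrableOn_marchaudLeft {α K s t : ℝ} {f : ℝ → ℝ} (hα : 0 < α) (hα1 : α < 1)
    (hfm : Measurable f) (hK : ∀ y, |f y| ≤ K) (hst : s ≤ t)
    (hW : ∫⁻ x in Ioo s t, marchaudAbs α f s x < ∞) :
    IntegrableOn (marchaudLeft α f s) (Ioo s t) := by
  refine ⟨(measurable_marchaudLeft α hfm s).aestronglyMeasurable, ?_⟩
  refine (setLIntegral_mono' measurableSet_Ioo
    fun x hx => marchaudLeft_enorm_le hα (hK x) hx.1).trans_lt ?_
  rw [lintegral_add_right _ ((measurable_marchaudAbs α hfm s).const_mul _),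
    lintegral_const_mul' _ _ ENNReal.ofReal_ne_top]
  refine ENNReal.add_lt_top.2 ⟨?_, ENNReal.mul_lt_top ENNReal.ofReal_lt_top hW⟩
  rw [lintegral_Ioo_ofReal hst ((intervalIntegrable_sub_right_rpow (by linarith) s s t).const_mul K)]
  · exact ENNReal.ofReal_lt_top
  · exact fun u hu => mul_nonneg ((abs_nonneg _).trans (hK 0)) (Real.rpow_nonneg (by linarith [hu.1]) _)

theorem integrable_fracKernel {α s t : ℝ} {ψ : ℝ → ℝ} (hα : 0 < α) (hψm : Measurable ψ)
    (hψ : IntegrableOn ψ (Ioo s t)) :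
    Integrable ({z : ℝ × ℝ | z.1 < z.2}.indicator fun z => (z.2 - z.1) ^ (α - 1) * ψ z.1)
      ((volume.restrict (Ioo s t)).prod (volume.restrict (Ioo s t))) := by
  have hA : MeasurableSet {z : ℝ × ℝ | z.1 < z.2} := measurableSet_lt measurable_fst measurable_snd
  have hm : Measurable ({z : ℝ × ℝ | z.1 < z.2}.indicator fun z => (z.2 - z.1) ^ (α - 1) * ψ z.1) :=
    (((measurable_snd.sub measurable_fst).pow_const _).mul (hψm.comp measurable_fst)).indicator hA
  refine ⟨hm.aestronglyMeasurable, ?_⟩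
  rw [hasFiniteIntegral_iff_enorm, lintegral_prod _ hm.enorm.aemeasurable]
  have hb : ∀ x ∈ Ioo s t, ∫⁻ u in Ioo s t,
      ‖({z : ℝ × ℝ | z.1 < z.2}.indicator fun z => (z.2 - z.1) ^ (α - 1) * ψ z.1) (x, u)‖ₑ ≤
        ENNReal.ofReal ((t - s) ^ α / α) * ‖ψ x‖ₑ := by
    intro x hx
    have h1 : ∫⁻ u in Ioo s t,
        ‖({z : ℝ × ℝ | z.1 < z.2}.indicator fun z => (z.2 - z.1) ^ (α - 1) * ψ z.1) (x, u)‖ₑ ≤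
        ∫⁻ u in Ioo x t, ENNReal.ofReal ((u - x) ^ (α - 1)) * ‖ψ x‖ₑ := by
      rw [← lintegral_indicator measurableSet_Ioo, ← lintegral_indicator measurableSet_Ioo]
      refine lintegral_mono fun u => ?_
      by_cases hu : u ∈ Ioo x t
      · rw [indicator_of_mem hu, indicator_of_mem (show u ∈ Ioo s t from ⟨hx.1.trans hu.1, hu.2⟩),
          indicator_of_mem (show (x, u) ∈ {z : ℝ × ℝ | z.1 < z.2} from hu.1), enorm_mul,
          Real.enorm_of_nonneg (Real.rpow_nonneg (by simpa using hu.1.le) _)]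
      · rw [indicator_of_notMem hu]
        by_cases hu2 : u ∈ Ioo s t
        · rw [indicator_of_mem hu2, indicator_of_notMem]
          · simp
          · exact fun h => hu ⟨h, hu2.2⟩
        · rw [indicator_of_notMem hu2]
    refine h1.trans ?_
    rw [lintegral_mul_const' _ _ enorm_ne_top, lintegral_sub_right_rpow (by linarith) hx.2.le,
      sub_add_cancel]
    gcongr
    · linarith [hx.2]
    · linarith [hx.1]
  refine (setLIntegral_mono' measurableSet_Ioo hb).trans_lt ?_
  rw [lintegral_const_mul' _ _ ENNReal.ofReal_ne_top]
  exact ENNReal.mul_lt_top ENNReal.ofReal_lt_top hψ.2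

theorem integral_indicator_lt_right {s t x : ℝ} (hx : x ∈ Ioo s t) (k : ℝ → ℝ) :
    ∫ u in Ioo s t, (if x < u then k u else 0) = ∫ u in Ioo x t, k u := by
  rw [← integral_indicator measurableSet_Ioo, ← integral_indicator measurableSet_Ioo]
  congr 1; ext u
  simp only [indicator, mem_Ioo]
  split_ifs <;> grind

theorem integral_indicator_lt_left {s t u : ℝ} (hu : u ∈ Ioo s t) (k : ℝ → ℝ) :
    ∫ x in Ioo s t, (if x < u then k x else 0) = ∫ x in Ioo s u, k x := by
  rw [← integral_indicator measurableSet_Ioo, ← integral_indicator measurableSet_Ioo]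
  congr 1; ext x
  simp only [indicator, mem_Ioo]
  split_ifs <;> grind

/-- Fubini on the triangle x < u: the fractional integral passes from h to ψ. -/
theorem integral_fracKernel_swap {α s t C : ℝ} {ψ h : ℝ → ℝ} (hα : 0 < α) (hψm : Measurable ψ)
    (hψ : IntegrableOn ψ (Ioo s t)) (hm : Measurable h) (hC : ∀ u, |h u| ≤ C) :
    ∫ x in Ioo s t, ψ x * ∫ u in Ioo x t, (u - x) ^ (α - 1) * h u =
      ∫ u in Ioo s t, h u * ∫ x in Ioo s u, (u - x) ^ (α - 1) * ψ x := by
  have hi : Integrable (Function.uncurry fun x u : ℝ => h u *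
      ({z : ℝ × ℝ | z.1 < z.2}.indicator fun z => (z.2 - z.1) ^ (α - 1) * ψ z.1) (x, u))
      ((volume.restrict (Ioo s t)).prod (volume.restrict (Ioo s t))) :=
    (integrable_fracKernel hα hψm hψ).bdd_mul (c := C)
      (hm.comp measurable_snd).aestronglyMeasurable (Eventually.of_forall fun z => hC z.2)
  have := integral_integral_swap hi
  simp only [indicator, mem_ofPred_eq] at this
  refine Eq.trans ?_ (this.trans ?_)
  · refine setIntegral_congr_fun measurableSet_Ioo fun x hx => ?_
    rw [← integral_const_mul, ← integral_indicator_lt_right hx]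
    refine setIntegral_congr_fun measurableSet_Ioo fun u hu => ?_
    split_ifs <;> ring
  · refine setIntegral_congr_fun measurableSet_Ioo fun u hu => ?_
    rw [integral_const_mul, integral_indicator_lt_left hu]

theorem integrableOn_fracIntegral {α s t : ℝ} {ψ : ℝ → ℝ} (hα : 0 < α) (hψm : Measurable ψ)
    (hψ : IntegrableOn ψ (Ioo s t)) :
    IntegrableOn (fun u => ∫ x in Ioo s u, (u - x) ^ (α - 1) * ψ x) (Ioo s t) := by
  refine IntegrableOn.congr_fun (integrable_fracKernel hα hψm hψ).integral_prod_right
    (fun u hu => ?_) measurableSet_Ioo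
  rw [← integral_indicator_lt_left hu]
  rfl

/-- The constant relating the unnormalized left Marchaud derivative to its fractional integral. -/
noncomputable def marchaudConst (α : ℝ) : ℝ := ∫ ρ in Ioi 0, powerProfile α ρ

/-- Integrated over (s, τ), the left side becomes α⁻¹ ∫ (τ-x)^α ψ(x) dx by Fubini, which the
preceding power identity evaluates. Both sides thus have the same primitive in τ, and Lebesgue
differentiation gives equality almost everywhere. -/
theorem fracIntegral_marchaudLeft {α K s t : ℝ} {f : ℝ → ℝ} (hα : 0 < α) (hα1 : α < 1)
    (hfm : Measurable f) (hK : ∀ y, |f y| ≤ K) (hst : s ≤ t)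
    (hW : ∫⁻ x in Ioo s t, marchaudAbs α f s x < ∞) :
    ∀ᵐ u, u ∈ Ioo s t →
      ∫ x in Ioo s u, (u - x) ^ (α - 1) * marchaudLeft α f s x = marchaudConst α * f u := by
  set ψ := marchaudLeft α f s
  have hψm : Measurable ψ := measurable_marchaudLeft α hfm s
  have hψ : IntegrableOn ψ (Ioo s t) := integrableOn_marchaudLeft hα hα1 hfm hK hst hW
  have hfi : IntegrableOn f (Ioo s t) :=
    Measure.integrableOn_of_bounded (M := K) (by simp) hfm.aestronglyMeasurable
      (Eventually.of_forall hK)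
  have hD := (integrableOn_fracIntegral hα hψm hψ).sub (hfi.const_mul (marchaudConst α))
  have hD' : IntervalIntegrable (fun u => (∫ x in Ioo s u, (u - x) ^ (α - 1) * ψ x) -
      marchaudConst α * f u) volume s t := (intervalIntegrable_iff_integrableOn_Ioo_of_le hst).2 hD
  have hz : ∀ τ ∈ Ioo s t, ∫ u in s..τ, ((∫ x in Ioo s u, (u - x) ^ (α - 1) * ψ x) -
      marchaudConst α * f u) = 0 := by
    intro τ hτ
    have hsub : Ioo s τ ⊆ Ioo s t := Ioo_subset_Ioo_right hτ.2.le
    have hW' := (lintegral_mono_set (f := marchaudAbs α f s) hsub).trans_lt hW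
    have h1 := integral_fracKernel_swap (h := fun _ => 1) (C := 1) hα hψm (hψ.mono_set hsub)
      measurable_const (by simp)
    rw [intervalIntegral.integral_of_le hτ.1.le, integral_Ioc_eq_integral_Ioo,
      integral_sub ((integrableOn_fracIntegral hα hψm hψ).mono_set hsub)
        ((hfi.mono_set hsub).const_mul _), integral_const_mul]
    simp only [one_mul, mul_one] at h1
    rw [← h1, sub_eq_zero]
    have h2 := integral_rpow_mul_marchaudLeft hα hα1 hfm hK hτ.1.le hW'
    have h3 : ∫ x in Ioo s τ, ψ x * ∫ u in Ioo x τ, (u - x) ^ (α - 1) =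
        α⁻¹ * ∫ x in Ioo s τ, (τ - x) ^ α * ψ x := by
      rw [← integral_const_mul]
      refine setIntegral_congr_fun measurableSet_Ioo fun x hx => ?_
      rw [← integral_Ioc_eq_integral_Ioo, ← intervalIntegral.integral_of_le hx.2.le,
        integral_sub_right_rpow (by linarith), sub_add_cancel]
      field_simp
    rw [h3, h2, marchaudConst]
    field_simp
  filter_upwards [hD'.ae_hasDerivAt_integral] with u hu hum
  have h1 := hu (by rw [uIcc_of_le hst]; exact Ioo_subset_Icc_self hum) s left_mem_uIcc
  have h2 : HasDerivAt (fun x => ∫ u in s..x, ((∫ x in Ioo s u, (u - x) ^ (α - 1) * ψ x) -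
      marchaudConst α * f u)) 0 u :=
    (hasDerivAt_const u (0 : ℝ)).congr_of_eventuallyEq
      (by filter_upwards [isOpen_Ioo.mem_nhds hum] with τ hτ using hz τ hτ)
  exact sub_eq_zero.1 (h1.unique h2)

/-! ### Smooth drivers, Steklov approximation and the limit -/

/-- Integration by parts for (G x - G u)(u-x)^{α-1}. Its value at u = x is zero and it is continuous
there, since the Lipschitz bound leaves C (u-x)^α with α > 0; the value at t cancels the boundary
term of the derivative. -/
theorem marchaudRight_of_hasDerivAt {α C x t : ℝ} {G h : ℝ → ℝ} (hα : 0 < α)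
    (hG : ∀ u, HasDerivAt G (h u) u) (hh : Continuous h) (hC : ∀ u, |h u| ≤ C) (hxt : x ≤ t) :
    marchaudRight α G t x = -∫ u in Ioo x t, (u - x) ^ (α - 1) * h u := by
  have hGc : Continuous G := continuous_iff_continuousAt.2 fun u => (hG u).continuousAt
  have hlip : ∀ u v, |G v - G u| ≤ C * |v - u| := fun u v =>
    convex_univ.norm_image_sub_le_of_norm_hasDerivWithin_le (f' := h)
      (fun y _ => (hG y).hasDerivWithinAt) (fun y _ => hC y) (mem_univ u) (mem_univ v)
  have hH : HolderOnIcc 1 C G x t := fun u v _ huv _ => by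
    have := hlip u v
    rwa [abs_of_nonneg (sub_nonneg.2 huv), ← Real.rpow_one (v - u)] at this
  have i1 := hH.intervalIntegrable hGc.measurable (α := α) (by linarith) le_rfl hxt
  have i2 : IntervalIntegrable (fun u => (u - x) ^ (α - 1) * h u) volume x t :=
    (intervalIntegrable_sub_right_rpow (by linarith) x x t).mul_continuousOn hh.continuousOn
  have hcont : ContinuousOn (fun u => (G x - G u) * (u - x) ^ (α - 1)) (Icc x t) := by
    intro u hu
    rcases eq_or_lt_of_le hu.1 with rfl | hxu
    · have : Tendsto (fun u => C * (u - x) ^ α) (𝓝[Icc x t] x) (𝓝 0) := by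
        have h1 : ContinuousAt (fun u => C * (u - x) ^ α) x :=
          continuousAt_const.mul ((by fun_prop : ContinuousAt (fun u => u - x) x).rpow_const
            (Or.inr hα.le))
        have := h1.tendsto
        simp only [sub_self, Real.zero_rpow hα.ne', mul_zero] at this
        exact this.mono_left nhdsWithin_le_nhds
      unfold ContinuousWithinAt
      simp only [sub_self, zero_mul]
      refine squeeze_zero_norm' ?_ this
      filter_upwards [self_mem_nhdsWithin] with u hu
      have hux : 0 ≤ u - x := by linarith [hu.1]
      rcases eq_or_lt_of_le hux with h0 | h0
      · rw [← h0, Real.zero_rpow hα.ne', show u = x by linarith]; simp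
      · rw [norm_mul, Real.norm_eq_abs, abs_sub_comm, Real.norm_of_nonneg (Real.rpow_nonneg hux _)]
        have e : (u - x) ^ α = (u - x) * (u - x) ^ (α - 1) := by
          rw [← Real.rpow_one_add' hux (by linarith)]; congr 1; ring
        rw [e, ← mul_assoc]
        have := hlip x u
        rw [abs_of_nonneg hux] at this
        exact mul_le_mul_of_nonneg_right this (Real.rpow_nonneg hux _)
    · refine ContinuousAt.continuousWithinAt ?_
      exact (continuousAt_const.sub hGc.continuousAt).mul
        ((by fun_prop : ContinuousAt (fun u => u - x) u).rpow_const (Or.inl (by linarith)))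
  have hder : ∀ u ∈ Ioo x t, HasDerivAt (fun u => (G x - G u) * (u - x) ^ (α - 1))
      (-((u - x) ^ (α - 1) * h u) + (α - 1) * ((G x - G u) * (u - x) ^ (α - 2))) u := by
    intro u hu
    have h1 := ((hasDerivAt_id' u).sub_const x).rpow_const (p := α - 1)
      (Or.inl (by linarith [hu.1] : u - x ≠ 0))
    refine (((hG u).const_sub (G x)).mul h1).congr_deriv ?_
    rw [show α - 1 - 1 = α - 2 by ring]; ring
  have e := intervalIntegral.integral_eq_sub_of_hasDerivAt_of_le hxt hcont hder
    (i2.neg.add (i1.const_mul _))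
  have i3 : IntervalIntegrable (fun u => -((u - x) ^ (α - 1) * h u)) volume x t := i2.neg
  rw [intervalIntegral.integral_add i3 (i1.const_mul _), intervalIntegral.integral_neg,
    intervalIntegral.integral_const_mul] at e
  simp only [sub_self, zero_mul, sub_zero] at e
  rw [← integral_Ioc_eq_integral_Ioo, ← intervalIntegral.integral_of_le hxt]
  unfold marchaudRight
  linarith

/-- Fractional integration by parts: the right derivative of G is minus a fractional integral of h,
the swap transfers it to the left derivative of f, and there it inverts. -/
theorem integral_marchaud_of_hasDerivAt {α K C s t : ℝ} {f G h : ℝ → ℝ} (hα : 0 < α) (hα1 : α < 1)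
    (hfm : Measurable f) (hK : ∀ y, |f y| ≤ K) (hst : s ≤ t)
    (hW : ∫⁻ x in Ioo s t, marchaudAbs α f s x < ∞)
    (hG : ∀ u, HasDerivAt G (h u) u) (hh : Continuous h) (hC : ∀ u, |h u| ≤ C) :
    ∫ x in s..t, marchaudLeft α f s x * marchaudRight α G t x =
      -marchaudConst α * ∫ x in s..t, f x * h x := by
  rw [intervalIntegral.integral_of_le hst, intervalIntegral.integral_of_le hst,
    integral_Ioc_eq_integral_Ioo, integral_Ioc_eq_integral_Ioo]
  have h1 := integral_fracKernel_swap hα (measurable_marchaudLeft α hfm s)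
    (integrableOn_marchaudLeft hα hα1 hfm hK hst hW) hh.measurable hC
  have h2 : ∫ x in Ioo s t, marchaudLeft α f s x * marchaudRight α G t x =
      -∫ x in Ioo s t, marchaudLeft α f s x * ∫ u in Ioo x t, (u - x) ^ (α - 1) * h u := by
    rw [← integral_neg]
    refine setIntegral_congr_fun measurableSet_Ioo fun x hx => ?_
    rw [marchaudRight_of_hasDerivAt hα hG hh hC hx.2.le]; ring
  rw [h2, h1, neg_mul, ← integral_const_mul]
  congr 1
  refine setIntegral_congr_ae measurableSet_Ioo ?_
  filter_upwards [fracIntegral_marchaudLeft hα hα1 hfm hK hst hW] with u hu hum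
  rw [hu hum]; ring

/-- The Steklov mean of `g` over `[x, x + ε]`. -/
noncomputable def steklovMean (g : ℝ → ℝ) (ε x : ℝ) : ℝ := ε⁻¹ * ∫ y in (0 : ℝ)..ε, g (x + y)

theorem hasDerivAt_steklovMean {g : ℝ → ℝ} (hg : Continuous g) (ε x : ℝ) :
    HasDerivAt (steklovMean g ε) (ε⁻¹ * (g (x + ε) - g x)) x := by
  have hi : ∀ a b, IntervalIntegrable g volume a b := fun a b => hg.intervalIntegrable a b
  have e : steklovMean g ε =
      fun x => ε⁻¹ * ((∫ y in (0 : ℝ)..(x + ε), g y) - ∫ y in (0 : ℝ)..x, g y) := by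
    ext x
    unfold steklovMean
    rw [intervalIntegral.integral_comp_add_left (fun y => g y) x, add_zero,
      intervalIntegral.integral_interval_sub_left (hi _ _) (hi _ _)]
  have hP : ∀ x, HasDerivAt (fun x => ∫ y in (0 : ℝ)..x, g y) (g x) x := fun x =>
    intervalIntegral.integral_hasDerivAt_right (hi _ _)
      hg.aestronglyMeasurable.stronglyMeasurableAtFilter hg.continuousAt
  rw [e]
  exact (((hP (x + ε)).comp_add_const x ε).sub (hP x)).const_mul _

theorem abs_steklovMean_le {h : ℝ → ℝ} {ε C x : ℝ} (hε : 0 < ε)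
    (hC : ∀ y ∈ Icc 0 ε, |h (x + y)| ≤ C) : |steklovMean h ε x| ≤ C := by
  have h1 := intervalIntegral.norm_integral_le_of_norm_le_const (a := 0) (b := ε) (C := C)
    (f := fun y => h (x + y)) fun y hy => by
      rw [uIoc_of_le hε.le] at hy
      exact hC y ⟨hy.1.le, hy.2⟩
  rw [sub_zero, abs_of_pos hε, Real.norm_eq_abs] at h1
  unfold steklovMean
  rw [abs_mul, abs_of_pos (inv_pos.2 hε)]
  calc _ ≤ ε⁻¹ * (C * ε) := by gcongr
    _ = C := by field_simp

theorem steklovMean_sub {g : ℝ → ℝ} (hg : Continuous g) (ε u v : ℝ) :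
    steklovMean g ε v - steklovMean g ε u = steklovMean (fun y => g (v + y) - g (u + y)) ε 0 := by
  unfold steklovMean
  rw [← mul_sub, ← intervalIntegral.integral_sub]
  · simp
  · exact (hg.comp (by fun_prop)).intervalIntegrable _ _
  · exact (hg.comp (by fun_prop)).intervalIntegrable _ _

/-- An average of translates keeps the Hölder constant. The right derivatives of the approximations
are therefore bounded uniformly in ε. -/
theorem steklovMean_holder {β Λ : ℝ} {g : ℝ → ℝ} (hg : Continuous g)
    (hΛ : ∀ u v, u ≤ v → |g v - g u| ≤ Λ * (v - u) ^ β) {ε : ℝ} (hε : 0 < ε) (s t : ℝ) :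
    HolderOnIcc β Λ (steklovMean g ε) s t := fun u v _ huv _ => by
  rw [steklovMean_sub hg]
  refine abs_steklovMean_le hε fun y _ => ?_
  have := hΛ (u + (0 + y)) (v + (0 + y)) (by linarith)
  rwa [add_sub_add_right_eq_sub] at this

theorem tendsto_steklovMean {β Λ : ℝ} {g : ℝ → ℝ} (hg : Continuous g) (hβ : 0 < β) (hΛ0 : 0 ≤ Λ)
    (hΛ : ∀ u v, u ≤ v → |g v - g u| ≤ Λ * (v - u) ^ β) (x : ℝ) :
    Tendsto (fun n : ℕ => steklovMean g (1 / ((n : ℝ) + 1)) x) atTop (𝓝 (g x)) := by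
  rw [tendsto_iff_norm_sub_tendsto_zero]
  have h0 : Tendsto (fun n : ℕ => Λ * (1 / ((n : ℝ) + 1)) ^ β) atTop (𝓝 0) := by
    have := (tendsto_one_div_add_atTop_nhds_zero_nat (𝕜 := ℝ)).rpow_const (p := β) (Or.inr hβ.le)
    rw [Real.zero_rpow hβ.ne'] at this
    simpa using this.const_mul Λ
  refine squeeze_zero (fun _ => norm_nonneg _) (fun n => ?_) h0
  have hε : (0 : ℝ) < 1 / ((n : ℝ) + 1) := by positivity
  set ε := 1 / ((n : ℝ) + 1)
  have e : steklovMean g ε x - g x = steklovMean (fun y => g (x + y) - g x) ε 0 := by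
    have hc : Continuous fun y => g (x + y) := by fun_prop
    unfold steklovMean
    simp only [zero_add]
    rw [intervalIntegral.integral_sub (hc.intervalIntegrable _ _) (by simp)]
    simp only [ intervalIntegral.integral_const, smul_eq_mul, sub_zero]
    field_simp
  rw [e]
  refine abs_steklovMean_le hε fun y hy => ?_
  rw [zero_add]
  refine (hΛ x (x + y) (by linarith [hy.1])).trans ?_
  rw [add_sub_cancel_left]
  exact mul_le_mul_of_nonneg_left (Real.rpow_le_rpow hy.1 hy.2 hβ.le) hΛ0

theorem tendsto_marchaudRight {β Λ α s t : ℝ} {g : ℝ → ℝ} {G : ℕ → ℝ → ℝ} (hαβ : 1 < α + β)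
    (hG : ∀ n, HolderOnIcc β Λ (G n) s t) (hGm : ∀ n, Measurable (G n))
    (hlim : ∀ x, Tendsto (fun n => G n x) atTop (𝓝 (g x))) {x : ℝ} (hx : x ∈ Ioo s t) :
    Tendsto (fun n => marchaudRight α (G n) t x) atTop (𝓝 (marchaudRight α g t x)) := by
  unfold marchaudRight
  refine (((hlim x).sub (hlim t)).mul_const _).add (Tendsto.const_mul _ ?_)
  refine intervalIntegral.tendsto_integral_filter_of_dominated_convergence
    (fun u => Λ * (u - x) ^ (α + β - 2)) (Eventually.of_forall fun n => ?_)
    (Eventually.of_forall fun n => Eventually.of_forall fun u hu => ?_)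
    ((intervalIntegrable_sub_right_rpow (by linarith) x x t).const_mul Λ)
    (Eventually.of_forall fun u _ => ((hlim x).sub (hlim u)).mul_const _)
  · exact (((hGm n).const_sub _).mul ((measurable_id.sub_const x).pow_const _)).aestronglyMeasurable
  · rw [uIoc_of_le hx.2.le] at hu
    exact (hG n).kernel_bound hx.1.le hu.1 hu.2

/-- Linear identities that are evident for the ordinary integrals on the left pass to the fractional
integral on the right. The dominating function is |left derivative| times the uniform bound of the
right derivatives. -/
theorem tendsto_integral_marchaud {α β Λ K s t : ℝ} {f g : ℝ → ℝ} (hα : 0 < α) (hα1 : α < 1)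
    (hβ : 0 < β) (hαβ : 1 < α + β) (hfm : Measurable f) (hK : ∀ y, |f y| ≤ K) (hst : s ≤ t)
    (hW : ∫⁻ x in Ioo s t, marchaudAbs α f s x < ∞) (hg : Continuous g) (hΛ0 : 0 ≤ Λ)
    (hΛ : ∀ u v, u ≤ v → |g v - g u| ≤ Λ * (v - u) ^ β) :
    Tendsto (fun n : ℕ => -marchaudConst α * ∫ x in s..t,
      f x * ((1 / ((n : ℝ) + 1))⁻¹ * (g (x + 1 / ((n : ℝ) + 1)) - g x))) atTop
      (𝓝 (∫ x in s..t, marchaudLeft α f s x * marchaudRight α g t x)) := by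
  have e : ∀ n : ℕ, ∫ x in s..t, marchaudLeft α f s x *
      marchaudRight α (steklovMean g (1 / ((n : ℝ) + 1))) t x = -marchaudConst α * ∫ x in s..t,
      f x * ((1 / ((n : ℝ) + 1))⁻¹ * (g (x + 1 / ((n : ℝ) + 1)) - g x)) := by
    intro n
    have hε : (0 : ℝ) < 1 / ((n : ℝ) + 1) := by positivity
    refine integral_marchaud_of_hasDerivAt (C := (1 / ((n : ℝ) + 1))⁻¹ *
      (Λ * (1 / ((n : ℝ) + 1)) ^ β)) hα hα1 hfm hK hst hW
      (fun u => hasDerivAt_steklovMean hg _ u) (by fun_prop) fun u => ?_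
    rw [abs_mul, abs_of_pos (inv_pos.2 hε)]
    gcongr
    have := hΛ u (u + 1 / ((n : ℝ) + 1)) (by linarith)
    rwa [add_sub_cancel_left] at this
  simp_rw [← e]
  have hψ := integrableOn_marchaudLeft hα hα1 hfm hK hst hW
  have hH : ∀ n : ℕ, HolderOnIcc β Λ (steklovMean g (1 / ((n : ℝ) + 1))) s t := fun n =>
    steklovMean_holder hg hΛ (by positivity) s t
  have hm : ∀ n : ℕ, Measurable (steklovMean g (1 / ((n : ℝ) + 1))) := fun n =>
    (continuous_iff_continuousAt.2
      fun u => (hasDerivAt_steklovMean hg _ u).continuousAt).measurable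
  have h0 : 0 ≤ (1 - α) / (α + β - 1) := div_nonneg (by linarith) (by linarith)
  simp_rw [intervalIntegral.integral_of_le hst, integral_Ioc_eq_integral_Ioo]
  refine tendsto_integral_of_dominated_convergence
    (fun x => ‖marchaudLeft α f s x‖ *
      ((1 + (1 - α) / (α + β - 1)) * Λ * (t - s) ^ (α + β - 1))) (fun n => ?_)
    (hψ.norm.mul_const _) (fun n => ?_) ?_
  · exact ((measurable_marchaudLeft α hfm s).mul (measurable_marchaudRight α (hm n) t)).aestronglyMeasurable
  · refine (ae_restrict_iff' measurableSet_Ioo).2 (Eventually.of_forall fun x hx => ?_)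
    rw [norm_mul]
    refine mul_le_mul_of_nonneg_left ?_ (norm_nonneg _)
    refine ((hH n).abs_marchaudRight_le hα1 hαβ hx.1.le hx.2).trans ?_
    gcongr <;> linarith [hx.1, hx.2]
  · refine (ae_restrict_iff' measurableSet_Ioo).2 (Eventually.of_forall fun x hx => ?_)
    exact (tendsto_marchaudRight hαβ hH hm
      (fun y => tendsto_steklovMean hg hβ hΛ0 hΛ y) hx).const_mul _

/-! ### Additivity and splitting off constants -/

theorem lintegral_marchaudAbs_restart {α s t T : ℝ} {f : ℝ → ℝ} {r : ℝ} (hr : r ≤ s) (ht : t ≤ T)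
    (hW : ∫⁻ x in Ioo r T, marchaudAbs α f r x < ∞) :
    ∫⁻ x in Ioo s t, marchaudAbs α f s x < ∞ :=
  ((lintegral_mono (marchaudAbs_anti α f hr)).trans
    (lintegral_mono_set (Ioo_subset_Ioo hr ht))).trans_lt hW

/-- The fractional derivatives on [0, t], [0, s] and [s, t] are different functions, so additivity
is not formal. All three integrals are limits of ordinary integrals with one common integrand, for
which it is. -/
theorem integral_marchaud_additive {α β Λ K s t : ℝ} {f g : ℝ → ℝ} (hα : 0 < α) (hα1 : α < 1)
    (hβ : 0 < β) (hαβ : 1 < α + β) (hf : Continuous f) (hK : ∀ y, |f y| ≤ K) (hs : 0 ≤ s)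
    (hst : s ≤ t) (hW : ∫⁻ x in Ioo 0 t, marchaudAbs α f 0 x < ∞) (hg : Continuous g) (hΛ0 : 0 ≤ Λ)
    (hΛ : ∀ u v, u ≤ v → |g v - g u| ≤ Λ * (v - u) ^ β) :
    (∫ x in (0 : ℝ)..t, marchaudLeft α f 0 x * marchaudRight α g t x) -
      ∫ x in (0 : ℝ)..s, marchaudLeft α f 0 x * marchaudRight α g s x =
      ∫ x in s..t, marchaudLeft α f s x * marchaudRight α g t x := by
  have h1 := tendsto_integral_marchaud hα hα1 hβ hαβ hf.measurable hK (hs.trans hst) hW hg hΛ0 hΛ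
  have h2 := tendsto_integral_marchaud hα hα1 hβ hαβ hf.measurable hK hs
    (lintegral_marchaudAbs_restart le_rfl hst hW) hg hΛ0 hΛ
  have h3 := tendsto_integral_marchaud hα hα1 hβ hαβ hf.measurable hK hst
    (lintegral_marchaudAbs_restart hs le_rfl hW) hg hΛ0 hΛ
  refine tendsto_nhds_unique (h1.sub h2) (h3.congr fun n => ?_)
  have hi : ∀ a b, IntervalIntegrable (fun x => f x * ((1 / ((n : ℝ) + 1))⁻¹ *
      (g (x + 1 / ((n : ℝ) + 1)) - g x))) volume a b := fun a b =>
    (hf.mul (by fun_prop)).intervalIntegrable a b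
  rw [← mul_sub, intervalIntegral.integral_interval_sub_left (hi _ _) (hi _ _)]

/-- Before the limit the constant contributes κ times the integral of the derivative of the Steklov
mean, which is κ times its increment over [s, t]. -/
theorem integral_marchaud_sub_const {α β Λ K s t : ℝ} {f g : ℝ → ℝ} (hα : 0 < α) (hα1 : α < 1)
    (hβ : 0 < β) (hαβ : 1 < α + β) (hf : Continuous f) (hK : ∀ y, |f y| ≤ K)
    (hst : s ≤ t) (hW : ∫⁻ x in Ioo s t, marchaudAbs α f s x < ∞) (hg : Continuous g) (hΛ0 : 0 ≤ Λ)
    (hΛ : ∀ u v, u ≤ v → |g v - g u| ≤ Λ * (v - u) ^ β) (κ : ℝ) :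
    ∫ x in s..t, marchaudLeft α f s x * marchaudRight α g t x =
      (∫ x in s..t, marchaudLeft α (fun y => f y - κ) s x * marchaudRight α g t x) -
        marchaudConst α * κ * (g t - g s) := by
  have h1 := tendsto_integral_marchaud hα hα1 hβ hαβ hf.measurable hK hst hW hg hΛ0 hΛ
  have hW' : ∫⁻ x in Ioo s t, marchaudAbs α (fun y => f y - κ) s x < ∞ := by
    unfold marchaudAbs at hW ⊢
    simpa only [sub_sub_sub_cancel_right] using hW
  have h2 := tendsto_integral_marchaud (K := K + |κ|) hα hα1 hβ hαβ (hf.measurable.sub_const κ)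
    (fun y => (abs_sub _ _).trans (add_le_add_left (hK y) _)) hst hW' hg hΛ0 hΛ
  have h3 := ((tendsto_steklovMean hg hβ hΛ0 hΛ t).sub
    (tendsto_steklovMean hg hβ hΛ0 hΛ s)).const_mul (marchaudConst α * κ)
  refine tendsto_nhds_unique h1 ((h2.sub h3).congr fun n => ?_)
  have hc : Continuous fun x => (1 / ((n : ℝ) + 1))⁻¹ * (g (x + 1 / ((n : ℝ) + 1)) - g x) := by
    fun_prop
  have e := intervalIntegral.integral_eq_sub_of_hasDerivAt (a := s) (b := t)
    (fun u _ => hasDerivAt_steklovMean hg (1 / ((n : ℝ) + 1)) u) (hc.intervalIntegrable _ _)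
  rw [← e]
  simp_rw [sub_mul]
  have hi : IntervalIntegrable (fun x => f x * ((1 / ((n : ℝ) + 1))⁻¹ *
      (g (x + 1 / ((n : ℝ) + 1)) - g x))) volume s t := (hf.mul hc).intervalIntegrable _ _
  rw [intervalIntegral.integral_sub hi
    ((hc.intervalIntegrable _ _).const_mul κ), intervalIntegral.integral_const_mul]
  ring

/-! ### A priori estimates -/

/-- Replacing the base point u by an earlier s only enlarges the inner integral. All subintervals
[u, v] are then measured by one and the same weight, as the absorption argument requires. -/
theorem HolderOnIcc.enorm_integral_marchaud_le {α β Λ K u v s : ℝ} {f g : ℝ → ℝ}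
    (hα : 0 < α) (hα1 : α < 1) (hαβ : 1 < α + β) (hΛ : 0 ≤ Λ) (hfm : Measurable f)
    (hK : ∀ y, |f y| ≤ K) (hsu : s ≤ u) (huv : u ≤ v) (hg : HolderOnIcc β Λ g u v) :
    ‖∫ y in u..v, marchaudLeft α f u y * marchaudRight α g v y‖ₑ ≤
      ENNReal.ofReal ((1 + (1 - α) / (α + β - 1)) * Λ * (v - u) ^ (α + β - 1)) *
        (ENNReal.ofReal (K * ((v - u) ^ (1 - α) / (1 - α))) +
          ENNReal.ofReal α * ∫⁻ y in Ioo u v, marchaudAbs α f s y) := by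
  have hK0 : 0 ≤ K := (abs_nonneg _).trans (hK 0)
  have h0 : 0 ≤ (1 - α) / (α + β - 1) := div_nonneg (by linarith) (by linarith)
  rw [intervalIntegral.integral_of_le huv, integral_Ioc_eq_integral_Ioo]
  have h1 : ∀ y ∈ Ioo u v, ‖marchaudLeft α f u y * marchaudRight α g v y‖ₑ ≤
      ENNReal.ofReal ((1 + (1 - α) / (α + β - 1)) * Λ * (v - u) ^ (α + β - 1)) *
        (ENNReal.ofReal (K * (y - u) ^ (-α)) + ENNReal.ofReal α * marchaudAbs α f s y) := by
    intro y hy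
    rw [enorm_mul, mul_comm]
    refine mul_le_mul' ?_ ?_
    · rw [Real.enorm_eq_ofReal_abs]
      refine ENNReal.ofReal_le_ofReal ((hg.abs_marchaudRight_le hα1 hαβ hy.1.le hy.2).trans ?_)
      refine mul_le_mul_of_nonneg_left ?_ (mul_nonneg (by linarith) hΛ)
      exact Real.rpow_le_rpow (by linarith [hy.2]) (by linarith [hy.1]) (by linarith)
    · refine (marchaudLeft_enorm_le hα (hK y) hy.1).trans ?_
      gcongr
      exact marchaudAbs_anti α f hsu y
  refine (enorm_integral_le_lintegral_enorm _).trans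
    ((setLIntegral_mono' measurableSet_Ioo h1).trans (le_of_eq ?_))
  rw [lintegral_const_mul' _ _ ENNReal.ofReal_ne_top,
    lintegral_add_right _ ((measurable_marchaudAbs α hfm s).const_mul _),
    lintegral_const_mul' _ _ ENNReal.ofReal_ne_top,
    lintegral_Ioo_ofReal huv ((intervalIntegrable_sub_right_rpow (by linarith) u u v).const_mul K),
    intervalIntegral.integral_const_mul, integral_sub_right_rpow (by linarith),
    show -α + 1 = 1 - α by ring]
  exact fun y hy => mul_nonneg hK0 (Real.rpow_nonneg (by linarith [hy.1]) _)

/-- The exponent β-2 need not be integrable, but it is paired with the mass of w between u and v.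
With p = (β-2)/2, which lies in (-1, 0), one has (v-u)^{β-2} ≤ (y-u)^p (v-y)^p for u < y < v, and
two uses of Tonelli leave two integrable powers, each contributing (t-s)^{β/2}/(β/2). -/
theorem lintegral_weighted_triangle_le {β s t : ℝ} {w : ℝ → ℝ≥0∞} (hβ : 0 < β) (hβ2 : β < 2)
    (hw : Measurable w) :
    ∫⁻ v in Ioo s t, ∫⁻ u in Ioo s v, ENNReal.ofReal ((v - u) ^ (β - 2)) * ∫⁻ y in Ioo u v, w y ≤
      ENNReal.ofReal (4 / β ^ 2 * (t - s) ^ β) * ∫⁻ y in Ioo s t, w y := by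
  set p := (β - 2) / 2 with hp
  have hp1 : -1 < p := by linarith
  have hp2 : p + 1 = β / 2 := by rw [hp]; ring
  set q : ℝ≥0∞ := ENNReal.ofReal ((t - s) ^ (β / 2) / (β / 2))
  have hmeas : Measurable (Function.uncurry fun v y : ℝ => ENNReal.ofReal ((v - y) ^ p) * w y) :=
    ((measurable_fst.sub measurable_snd).pow_const _).ennreal_ofReal.mul (hw.comp measurable_snd)
  have h1 : ∀ v ∈ Ioo s t, ∫⁻ u in Ioo s v, ENNReal.ofReal ((v - u) ^ (β - 2)) *
      ∫⁻ y in Ioo u v, w y ≤ q * ∫⁻ y in Ioo s v, ENNReal.ofReal ((v - y) ^ p) * w y := by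
    intro v hv
    have h2 : ∀ u ∈ Ioo s v, ENNReal.ofReal ((v - u) ^ (β - 2)) * ∫⁻ y in Ioo u v, w y ≤
        ∫⁻ y in Ioo u v, ENNReal.ofReal ((y - u) ^ p) * (ENNReal.ofReal ((v - y) ^ p) * w y) := by
      intro u hu
      rw [← lintegral_const_mul _ hw]
      refine setLIntegral_mono' measurableSet_Ioo fun y hy => ?_
      rw [← mul_assoc, ← ENNReal.ofReal_mul (Real.rpow_nonneg (by linarith [hy.1]) _)]
      gcongr
      have huv : 0 < v - u := by linarith [hu.2]
      rw [show β - 2 = p + p by ring, Real.rpow_add huv]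
      refine mul_le_mul ?_ ?_ (Real.rpow_nonneg huv.le _) (Real.rpow_nonneg (by linarith [hy.1]) _)
      · exact Real.rpow_le_rpow_of_nonpos (by linarith [hy.1]) (by linarith [hy.2]) (by linarith)
      · exact Real.rpow_le_rpow_of_nonpos (by linarith [hy.2]) (by linarith [hy.1]) (by linarith)
    refine (setLIntegral_mono' measurableSet_Ioo h2).trans ?_
    have hm : Measurable (Function.uncurry fun y u : ℝ =>
        ENNReal.ofReal ((y - u) ^ p) * (ENNReal.ofReal ((v - y) ^ p) * w y)) :=
      ((measurable_fst.sub measurable_snd).pow_const _).ennreal_ofReal.mul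
        ((((measurable_const.sub measurable_fst).pow_const _).ennreal_ofReal).mul
          (hw.comp measurable_fst))
    rw [← lintegral_triangle_swap hm, ← lintegral_const_mul]
    · refine setLIntegral_mono' measurableSet_Ioo fun y hy => ?_
      rw [lintegral_mul_const _ (by fun_prop), lintegral_sub_left_rpow hp1 hy.1.le, hp2]
      refine mul_le_mul_left (ENNReal.ofReal_le_ofReal ?_) _
      gcongr
      · linarith [hy.1]
      · linarith [hy.2, hv.2]
    · fun_prop
  refine (setLIntegral_mono' measurableSet_Ioo h1).trans ?_
  rw [lintegral_const_mul _ (measurable_lintegral_Ioo_left hmeas s), lintegral_triangle_swap hmeas]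
  have h3 : ∀ y ∈ Ioo s t, ∫⁻ v in Ioo y t, ENNReal.ofReal ((v - y) ^ p) * w y ≤ q * w y := by
    intro y hy
    rw [lintegral_mul_const _ (by fun_prop), lintegral_sub_right_rpow hp1 hy.2.le, hp2]
    refine mul_le_mul_left (ENNReal.ofReal_le_ofReal ?_) _
    gcongr
    · linarith [hy.2]
    · linarith [hy.1]
  refine (mul_le_mul_right (setLIntegral_mono' measurableSet_Ioo h3) q).trans ?_
  rw [lintegral_const_mul _ hw, ← mul_assoc]
  rcases le_or_gt t s with hts | hts
  · simp [Ioo_eq_empty (not_lt.2 hts)]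
  · gcongr
    rw [← ENNReal.ofReal_mul (div_nonneg (Real.rpow_nonneg (by linarith) _) (by linarith))]
    refine ENNReal.ofReal_le_ofReal (le_of_eq ?_)
    have : (t - s) ^ β = (t - s) ^ (β / 2) * (t - s) ^ (β / 2) := by
      rw [← Real.rpow_add (by linarith)]; congr 1; ring
    rw [this]; field_simp; ring

/-- Inserting the increment bound into its own Marchaud integral gives W ≤ p (t-s)^{1-α} + q W with
p + q ≤ 1/2 by `hsmall`. Since W is known to be finite, the last term can be absorbed. -/
theorem lintegral_marchaudAbs_le_of_increment {α β D s t : ℝ} {f : ℝ → ℝ} (hα : 0 < α)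
    (hβα : α < β) (hβ1 : β < 1) (hD : 0 ≤ D) (hst : s ≤ t)
    (hfm : Measurable f) (hfin : ∫⁻ y in Ioo s t, marchaudAbs α f s y < ∞)
    (hinc : ∀ u v, s ≤ u → u < v → v ≤ t → ‖f v - f u‖ₑ ≤ ENNReal.ofReal (D * (v - u) ^ β) +
      ENNReal.ofReal (D * (v - u) ^ (α + β - 1)) * ∫⁻ y in Ioo u v, marchaudAbs α f s y)
    (hsmall : (1 / (β - α) + 4 / β ^ 2) * D * (t - s) ^ β ≤ 1 / 2) :
    ∫⁻ y in Ioo s t, marchaudAbs α f s y ≤ ENNReal.ofReal ((t - s) ^ (1 - α)) := by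
  set w := marchaudAbs α f s
  have hwm : Measurable w := measurable_marchaudAbs α hfm s
  set W := ∫⁻ y in Ioo s t, w y
  have hts : 0 ≤ t - s := by linarith
  have h1 : ∀ v ∈ Ioo s t, w v ≤ ENNReal.ofReal (D * ((t - s) ^ (β - α) / (β - α))) +
      ENNReal.ofReal D * ∫⁻ u in Ioo s v, ENNReal.ofReal ((v - u) ^ (β - 2)) *
        ∫⁻ y in Ioo u v, w y := by
    intro v hv
    have h2 : ∀ u ∈ Ioo s v, ‖f v - f u‖ₑ * ENNReal.ofReal ((v - u) ^ (-1 - α)) ≤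
        ENNReal.ofReal (D * (v - u) ^ (β - α - 1)) + ENNReal.ofReal D *
          (ENNReal.ofReal ((v - u) ^ (β - 2)) * ∫⁻ y in Ioo u v, w y) := by
      intro u hu
      have hp : 0 < v - u := by linarith [hu.2]
      refine (mul_le_mul_left (hinc u v hu.1.le hu.2 hv.2.le) _).trans (le_of_eq ?_)
      have e1 : D * (v - u) ^ β * (v - u) ^ (-1 - α) = D * (v - u) ^ (β - α - 1) := by
        rw [mul_assoc, ← Real.rpow_add hp]; congr 2; ring
      have e2 : D * (v - u) ^ (α + β - 1) * (v - u) ^ (-1 - α) = D * (v - u) ^ (β - 2) := by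
        rw [mul_assoc, ← Real.rpow_add hp]; congr 2; ring
      rw [add_mul, ← ENNReal.ofReal_mul (by positivity), e1, mul_right_comm,
        ← ENNReal.ofReal_mul (by positivity), e2, ENNReal.ofReal_mul hD,
        ENNReal.ofReal_mul hD, mul_assoc (ENNReal.ofReal D)]
    refine (setLIntegral_mono' measurableSet_Ioo h2).trans ?_
    rw [lintegral_add_left (by fun_prop), lintegral_const_mul' _ _ ENNReal.ofReal_ne_top]
    gcongr
    have h3 := lintegral_sub_left_rpow (p := β - α - 1) (by linarith) hv.1.le
    simp_rw [ENNReal.ofReal_mul hD]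
    rw [lintegral_const_mul' _ _ ENNReal.ofReal_ne_top, h3, sub_add_cancel]
    refine mul_le_mul_right (ENNReal.ofReal_le_ofReal ?_) _
    refine div_le_div_of_nonneg_right ?_ (by linarith)
    exact Real.rpow_le_rpow (by linarith [hv.1]) (by linarith [hv.2]) (by linarith)
  have h4 : W ≤ ENNReal.ofReal (1 / (β - α) * D * (t - s) ^ β) * ENNReal.ofReal ((t - s) ^ (1 - α)) +
      ENNReal.ofReal (4 / β ^ 2 * D * (t - s) ^ β) * W := by
    refine (setLIntegral_mono' measurableSet_Ioo h1).trans ?_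
    rw [lintegral_add_left measurable_const, lintegral_const_mul' _ _ ENNReal.ofReal_ne_top]
    refine add_le_add ?_ ?_
    · rw [setLIntegral_const, Real.volume_Ioo, ← ENNReal.ofReal_mul (by positivity),
        ← ENNReal.ofReal_mul (mul_nonneg (mul_nonneg (div_nonneg zero_le_one (by linarith)) hD)
          (Real.rpow_nonneg hts _))]
      refine ENNReal.ofReal_le_ofReal (le_of_eq ?_)
      have e1 : (t - s) ^ (β - α) * (t - s) = (t - s) ^ β * (t - s) ^ (1 - α) := by
        rw [← Real.rpow_add_of_nonneg hts (by linarith) (by linarith),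
          ← Real.rpow_add_one' hts (by linarith)]
        congr 1; ring
      linear_combination (D / (β - α)) * e1
    · refine (mul_le_mul_right (lintegral_weighted_triangle_le (β := β) (by linarith) (by linarith) hwm) _).trans
        (le_of_eq ?_)
      rw [← mul_assoc, ← ENNReal.ofReal_mul hD]
      congr 2; ring
  have hW : W = ENNReal.ofReal W.toReal := (ENNReal.ofReal_toReal hfin.ne).symm
  set r := W.toReal
  have hr : 0 ≤ r := ENNReal.toReal_nonneg
  have hx1 : 0 ≤ 1 / (β - α) * D * (t - s) ^ β :=
    mul_nonneg (mul_nonneg (div_nonneg zero_le_one (by linarith)) hD) (Real.rpow_nonneg hts _)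
  have hx2 : 0 ≤ 4 / β ^ 2 * D * (t - s) ^ β := by positivity
  rw [hW, ← ENNReal.ofReal_mul hx1, ← ENNReal.ofReal_mul hx2,
    ← ENNReal.ofReal_add (by positivity) (by positivity),
    ENNReal.ofReal_le_ofReal_iff (by positivity)] at h4
  rw [hW]
  refine ENNReal.ofReal_le_ofReal ?_
  have hy : 0 ≤ (t - s) ^ (1 - α) := by positivity
  nlinarith [mul_nonneg hx1 hy, mul_nonneg hx2 hr]

/-- An interval of length l is cut into m = ⌈l/Δ⌉ equal pieces. The pieces add up to m D (l/m)^β = D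
m^{1-β} l^β, and m ≤ 2/Δ because l and Δ are at most one. -/
theorem holder_chain {β D Δ T : ℝ} {x : ℝ → ℝ} (hβ : 0 < β) (hβ1 : β < 1) (hD : 0 ≤ D)
    (hΔ : 0 < Δ) (hΔ1 : Δ ≤ 1)
    (h : ∀ s t, 0 ≤ s → s < t → t ≤ T → t - s ≤ Δ → |x t - x s| ≤ D * (t - s) ^ β)
    {s t : ℝ} (hs : 0 ≤ s) (hst : s < t) (ht : t ≤ T) (h1 : t - s ≤ 1) :
    |x t - x s| ≤ 2 * D * Δ ^ (β - 1) * (t - s) ^ β := by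
  set l := t - s with hl
  have hl0 : 0 < l := by linarith
  set m := ⌈l / Δ⌉₊ with hmdef
  have hm : 0 < m := Nat.ceil_pos.2 (div_pos hl0 hΔ)
  have hmR : (0 : ℝ) < m := by exact_mod_cast hm
  have hm1 : l / Δ ≤ m := Nat.le_ceil _
  have hm2 : (m : ℝ) ≤ 2 / Δ := by
    have h2 : (m : ℝ) < l / Δ + 1 := Nat.ceil_lt_add_one (div_pos hl0 hΔ).le
    have h3 : l / Δ + 1 ≤ 2 / Δ := by
      rw [div_add_one hΔ.ne']; gcongr; linarith
    linarith
  set d := l / m with hd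
  have hd0 : 0 < d := div_pos hl0 hmR
  have hdΔ : d ≤ Δ := by rw [hd, div_le_iff₀ hmR]; rwa [div_le_iff₀ hΔ, mul_comm] at hm1
  have hmd : m * d = l := by rw [hd]; field_simp
  have htel : x t - x s = ∑ i ∈ Finset.range m, (x (s + ((i + 1 : ℕ) : ℝ) * d) - x (s + (i : ℝ) * d)) := by
    rw [Finset.sum_range_sub (fun i : ℕ => x (s + (i : ℝ) * d)), hmd, hl]
    simp
  rw [htel]
  have hb : ∀ i ∈ Finset.range m, |x (s + ((i + 1 : ℕ) : ℝ) * d) - x (s + (i : ℝ) * d)| ≤ D * d ^ β := by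
    intro i hi
    have hi' : ((i + 1 : ℕ) : ℝ) ≤ m := by exact_mod_cast Finset.mem_range.1 hi
    have e : (s + ((i + 1 : ℕ) : ℝ) * d) - (s + (i : ℝ) * d) = d := by push_cast; ring
    have := h (s + (i : ℝ) * d) (s + ((i + 1 : ℕ) : ℝ) * d) (by positivity) (by linarith)
      (by nlinarith) (by linarith)
    rwa [e] at this
  refine (Finset.abs_sum_le_sum_abs _ _).trans ((Finset.sum_le_sum hb).trans ?_)
  rw [Finset.sum_const, Finset.card_range, nsmul_eq_mul, hd, Real.div_rpow hl0.le hmR.le]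
  have e1 : (m : ℝ) * (D * (l ^ β / (m : ℝ) ^ β)) = D * (m : ℝ) ^ (1 - β) * l ^ β := by
    rw [Real.rpow_sub hmR, Real.rpow_one]; ring
  rw [e1, mul_comm 2 D, mul_assoc D 2]
  gcongr
  calc (m : ℝ) ^ (1 - β) ≤ (2 / Δ) ^ (1 - β) := Real.rpow_le_rpow hmR.le hm2 (by linarith)
    _ = 2 ^ (1 - β) * Δ ^ (β - 1) := by
      rw [Real.div_rpow zero_le_two hΔ.le, show β - 1 = -(1 - β) by ring, Real.rpow_neg hΔ.le]
      rfl
    _ ≤ 2 * Δ ^ (β - 1) := by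
      gcongr
      calc (2 : ℝ) ^ (1 - β) ≤ 2 ^ (1 : ℝ) :=
            Real.rpow_le_rpow_of_exponent_le one_le_two (by linarith)
        _ = 2 := Real.rpow_one 2

/-! ### Deterministic analysis of the path equation -/

/-- The data of a deterministic path equation `dx = θ a(x) dt + b(x) dg` on `[0, T]`, where the
driver `g` has local Hölder constant `Λ` on intervals of length at most one. -/
structure IsRoughPathSolution (α β θ K L Λ T : ℝ) (a b x g : ℝ → ℝ) : Prop where
  continuous_a : Continuous a
  continuous_b : Continuous b
  continuous_x : Continuous x
  continuous_g : Continuous g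
  bound_a : ∀ y, |a y| ≤ K
  bound_b : ∀ y, |b y| ≤ K
  lip_a : ∀ y z, |a y - a z| ≤ L * |y - z|
  lip_b : ∀ y z, |b y - b z| ≤ L * |y - z|
  one_le : 1 ≤ Λ
  holder : ∀ u v, 0 ≤ u → u ≤ v → v ≤ T → v - u ≤ 1 → |g v - g u| ≤ Λ * (v - u) ^ β
  holder_global : ∃ Λ', 0 ≤ Λ' ∧ ∀ u v, u ≤ v → |g v - g u| ≤ Λ' * (v - u) ^ β
  integrable : IntegrableOn (marchaudLeft α (fun r => b (x r)) 0) (Ioo 0 T)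
  equation : ∀ u v, 0 ≤ u → u ≤ v → v ≤ T → x v - x u = θ * (∫ r in u..v, a (x r)) +
    (glsIntegral α 0 v (fun r => b (x r)) g - glsIntegral α 0 u (fun r => b (x r)) g)

/-- The product of the Gamma factors in the generalized Lebesgue-Stieltjes integral. -/
noncomputable def gammaFactor (α : ℝ) : ℝ := 1 / (Real.Gamma (1 - α) * Real.Gamma α)

theorem gammaFactor_nonneg {α : ℝ} (hα : 0 < α) (hα1 : α < 1) : 0 ≤ gammaFactor α :=
  div_nonneg zero_le_one (mul_nonneg (Real.Gamma_pos_of_pos (by linarith)).le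
    (Real.Gamma_pos_of_pos hα).le)

namespace IsRoughPathSolution

variable {α β θ K L Λ T : ℝ} {a b x g : ℝ → ℝ}

theorem K_nonneg (h : IsRoughPathSolution α β θ K L Λ T a b x g) : 0 ≤ K :=
  (abs_nonneg _).trans (h.bound_a 0)

theorem L_nonneg (h : IsRoughPathSolution α β θ K L Λ T a b x g) : 0 ≤ L := by
  have := (abs_nonneg _).trans (h.lip_a 1 0)
  simpa using this

theorem abs_drift_le (h : IsRoughPathSolution α β θ K L Λ T a b x g) {u v : ℝ} (huv : u ≤ v) :
    |θ * ∫ r in u..v, a (x r)| ≤ |θ| * K * (v - u) := by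
  rw [abs_mul, mul_assoc]
  gcongr
  have := intervalIntegral.norm_integral_le_of_norm_le_const (a := u) (b := v) (C := K)
    (f := fun r => a (x r)) fun y _ => h.bound_a (x y)
  rwa [abs_of_nonneg (sub_nonneg.2 huv)] at this

theorem gls_sub (α : ℝ) (f g : ℝ → ℝ) {u v : ℝ} (hu : 0 ≤ u) (hv : 0 ≤ v) :
    glsIntegral α 0 v f g - glsIntegral α 0 u f g = -(gammaFactor α *
      ((∫ y in (0 : ℝ)..v, marchaudLeft α f 0 y * marchaudRight α g v y) -
        ∫ y in (0 : ℝ)..u, marchaudLeft α f 0 y * marchaudRight α g u y)) := by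
  rw [glsIntegral_eq α f g hu, glsIntegral_eq α f g hv, gammaFactor]
  ring

/-- The equation itself provides the increment hypothesis of the bootstrap. The global constant Λ'
may be arbitrarily large here: only finiteness is asserted, and no quantitative bound depends on it.
-/
theorem lintegral_marchaudAbs_lt_top (h : IsRoughPathSolution α β θ K L Λ T a b x g)
    (hα : 0 < α) (hα1 : α < 1) (hβα : α < β) (hβ1 : β < 1) (hαβ : 1 < α + β) :
    ∫⁻ y in Ioo 0 T, marchaudAbs α (fun r => b (x r)) 0 y < ∞ := by
  obtain ⟨Λ', hΛ0, hΛ'⟩ := h.holder_global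
  rcases le_or_gt T 0 with hT | hT
  · simp [Ioo_eq_empty (not_lt.2 hT)]
  have hH : HolderOnIcc β Λ' g 0 T := fun u v _ huv _ => hΛ' u v huv
  have hK := h.K_nonneg
  have hL := h.L_nonneg
  have hγ := gammaFactor_nonneg hα hα1
  refine hH.lintegral_marchaudAbs_lt_top (A := L * (|θ| * K * T ^ (1 - β)) + L * gammaFactor α)
    h.continuous_g.measurable (h.continuous_b.comp h.continuous_x).measurable hβα hα hα1 hαβ hΛ0
    (by positivity) h.integrable fun s t hs hst ht => ?_
  set I := (∫ y in (0 : ℝ)..t, marchaudLeft α (fun r => b (x r)) 0 y * marchaudRight α g t y) -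
        ∫ y in (0 : ℝ)..s, marchaudLeft α (fun r => b (x r)) 0 y * marchaudRight α g s y
  have hts : 0 < t - s := by linarith
  have h1 : |x t - x s| ≤ |θ| * K * (t - s) + gammaFactor α * |I| := by
    rw [h.equation s t hs.le hst.le ht.le, gls_sub α _ g hs.le (hs.trans hst).le]
    refine (abs_add_le _ _).trans (add_le_add (h.abs_drift_le hst.le) ?_)
    rw [abs_neg, abs_mul, abs_of_nonneg hγ]
  have h2 : t - s ≤ T ^ (1 - β) * (t - s) ^ β := by
    calc t - s = (t - s) ^ (1 - β) * (t - s) ^ β := by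
          rw [← Real.rpow_add hts]; simp
      _ ≤ _ := by gcongr; linarith
  have h3 : 0 ≤ L * (|θ| * K * T ^ (1 - β)) * |I| := by positivity
  have h4 : 0 ≤ L * gammaFactor α * (t - s) ^ β := by positivity
  calc |b (x t) - b (x s)| ≤ L * |x t - x s| := h.lip_b _ _
    _ ≤ L * (|θ| * K * (T ^ (1 - β) * (t - s) ^ β) + gammaFactor α * |I|) := by
        refine mul_le_mul_of_nonneg_left (h1.trans ?_) hL
        gcongr
    _ ≤ _ := by linarith

theorem increment_eq (h : IsRoughPathSolution α β θ K L Λ T a b x g)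
    (hα : 0 < α) (hα1 : α < 1) (hβα : α < β) (hβ1 : β < 1) (hαβ : 1 < α + β) {u v : ℝ}
    (hu : 0 ≤ u) (huv : u ≤ v) (hv : v ≤ T) :
    x v - x u = θ * (∫ r in u..v, a (x r)) - gammaFactor α *
      ∫ y in u..v, marchaudLeft α (fun r => b (x r)) u y * marchaudRight α g v y := by
  obtain ⟨Λ', hΛ0, hΛ'⟩ := h.holder_global
  rw [h.equation u v hu huv hv, gls_sub α _ g hu (hu.trans huv),
    integral_marchaud_additive (f := fun r => b (x r)) hα hα1 (by linarith) hαβ (h.continuous_b.comp h.continuous_x)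
      (fun y => h.bound_b _) hu huv (lintegral_marchaudAbs_restart le_rfl hv
        (h.lintegral_marchaudAbs_lt_top hα hα1 hβα hβ1 hαβ)) h.continuous_g hΛ0 hΛ']
  ring

/-- The constant in the a priori estimate of the increments. -/
noncomputable def incrConst (α β θ K : ℝ) : ℝ :=
  |θ| * K + gammaFactor α * (1 + (1 - α) / (α + β - 1)) * (K / (1 - α) + α)

theorem incrConst_nonneg (hα : 0 < α) (hα1 : α < 1) (hαβ : 1 < α + β) (hK : 0 ≤ K) :
    0 ≤ incrConst α β θ K := by
  have := gammaFactor_nonneg hα hα1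
  have h2 : 0 < 1 - α := by linarith
  have h3 : 0 < α + β - 1 := by linarith
  unfold incrConst
  positivity

theorem enorm_increment_le (h : IsRoughPathSolution α β θ K L Λ T a b x g)
    (hα : 0 < α) (hα1 : α < 1) (hβα : α < β) (hβ1 : β < 1) (hαβ : 1 < α + β) {s u v : ℝ}
    (hu : 0 ≤ u) (hsu : s ≤ u) (huv : u < v) (hv : v ≤ T) (h1 : v - u ≤ 1) :
    ‖x v - x u‖ₑ ≤ ENNReal.ofReal (incrConst α β θ K * Λ * (v - u) ^ β) +
      ENNReal.ofReal (incrConst α β θ K * Λ * (v - u) ^ (α + β - 1)) *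
        ∫⁻ y in Ioo u v, marchaudAbs α (fun r => b (x r)) s y := by
  have hK := h.K_nonneg
  have hγ := gammaFactor_nonneg hα hα1
  have hΛ := h.one_le
  have hp : 0 < v - u := by linarith
  have h2 : 0 < 1 - α := by linarith
  have h3 : 0 < α + β - 1 := by linarith
  set C := 1 + (1 - α) / (α + β - 1)
  have hC : 0 ≤ C := by positivity
  set W := ∫⁻ y in Ioo u v, marchaudAbs α (fun r => b (x r)) s y
  have hH : HolderOnIcc β Λ g u v := fun u' v' h1' h2' h3' =>
    h.holder u' v' (hu.trans h1') h2' (h3'.trans hv) (by linarith)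
  have hI := hH.enorm_integral_marchaud_le (f := fun r => b (x r)) hα hα1 hαβ (by linarith)
    (h.continuous_b.comp h.continuous_x).measurable (fun y => h.bound_b (x y)) hsu huv.le
  have e1 : (v - u) ^ (α + β - 1) * (v - u) ^ (1 - α) = (v - u) ^ β := by
    rw [← Real.rpow_add hp]; congr 1; ring
  have hdr : |θ| * K * (v - u) ≤ |θ| * K * Λ * (v - u) ^ β := by
    have : v - u ≤ (v - u) ^ β := by
      calc v - u = (v - u) ^ (1 : ℝ) := (Real.rpow_one _).symm
        _ ≤ _ := Real.rpow_le_rpow_of_exponent_ge hp h1 hβ1.le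
    calc |θ| * K * (v - u) ≤ |θ| * K * (1 * (v - u) ^ β) := by rw [one_mul]; gcongr
      _ ≤ |θ| * K * (Λ * (v - u) ^ β) := by gcongr
      _ = _ := by ring
  rw [h.increment_eq hα hα1 hβα hβ1 hαβ hu huv.le hv, sub_eq_add_neg]
  refine (enorm_add_le _ _).trans ?_
  rw [enorm_neg, enorm_mul (gammaFactor α), Real.enorm_of_nonneg hγ, Real.enorm_eq_ofReal_abs (θ * _)]
  calc _ ≤ ENNReal.ofReal (|θ| * K * Λ * (v - u) ^ β) + ENNReal.ofReal (gammaFactor α) *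
        (ENNReal.ofReal (C * Λ * (v - u) ^ (α + β - 1)) *
        (ENNReal.ofReal (K * ((v - u) ^ (1 - α) / (1 - α))) + ENNReal.ofReal α * W)) :=
        add_le_add (ENNReal.ofReal_le_ofReal ((h.abs_drift_le huv.le).trans hdr))
          (mul_le_mul_right hI _)
    _ = ENNReal.ofReal (|θ| * K * Λ * (v - u) ^ β +
          gammaFactor α * C * (K / (1 - α)) * Λ * (v - u) ^ β) +
          ENNReal.ofReal (gammaFactor α * C * α * Λ * (v - u) ^ (α + β - 1)) * W := by
        have g1 : gammaFactor α * C * (K / (1 - α)) * Λ * (v - u) ^ β = gammaFactor α *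
            ((C * Λ * (v - u) ^ (α + β - 1)) * (K * ((v - u) ^ (1 - α) / (1 - α)))) := by
          rw [← e1]; ring
        have g2 : gammaFactor α * C * α * Λ * (v - u) ^ (α + β - 1) =
            gammaFactor α * ((C * Λ * (v - u) ^ (α + β - 1)) * α) := by ring
        have g3 : 0 ≤ C * Λ * (v - u) ^ (α + β - 1) := by positivity
        rw [g1, g2, ENNReal.ofReal_add (by positivity) (by positivity), ENNReal.ofReal_mul hγ,
          ENNReal.ofReal_mul hγ, ENNReal.ofReal_mul g3, ENNReal.ofReal_mul g3]
        ring
    _ ≤ _ := by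
        unfold incrConst
        refine add_le_add (ENNReal.ofReal_le_ofReal ?_) (mul_le_mul_left
          (ENNReal.ofReal_le_ofReal ?_) _)
        · have : 0 ≤ gammaFactor α * C * α * Λ * (v - u) ^ β := by positivity
          linarith
        · have h4 : 0 ≤ |θ| * K * Λ * (v - u) ^ (α + β - 1) := by positivity
          have h5 : 0 ≤ gammaFactor α * C * (K / (1 - α)) * Λ * (v - u) ^ (α + β - 1) := by positivity
          linarith

/-- On an interval this short the absorbed bound W ≤ (t-s)^{1-α} applies, and (t-s)^{α+β-1}
(t-s)^{1-α} = (t-s)^β makes both terms of the increment estimate equal. -/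
theorem abs_increment_le_short (h : IsRoughPathSolution α β θ K L Λ T a b x g)
    (hα : 0 < α) (hα1 : α < 1) (hβα : α < β) (hβ1 : β < 1) (hαβ : 1 < α + β) {s t : ℝ}
    (hs : 0 ≤ s) (hst : s < t) (ht : t ≤ T) (h1 : t - s ≤ 1)
    (hsmall : (1 / (β - α) + 4 / β ^ 2) * (L * incrConst α β θ K * Λ) * (t - s) ^ β ≤ 1 / 2) :
    |x t - x s| ≤ 2 * (incrConst α β θ K * Λ) * (t - s) ^ β := by
  have hA := incrConst_nonneg (θ := θ) hα hα1 hαβ h.K_nonneg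
  have hL := h.L_nonneg
  have hΛ := h.one_le
  have hp : 0 < t - s := by linarith
  have hfin := lintegral_marchaudAbs_restart hs ht
    (h.lintegral_marchaudAbs_lt_top hα hα1 hβα hβ1 hαβ)
  have hW := lintegral_marchaudAbs_le_of_increment (f := fun r => b (x r)) (D := L * incrConst α β θ K * Λ) hα hβα hβ1 (by positivity)
    hst.le (h.continuous_b.comp h.continuous_x).measurable hfin (fun u v hu huv hv => by
      have h2 := h.enorm_increment_le hα hα1 hβα hβ1 hαβ (hs.trans hu) hu huv (hv.trans ht)
        (by linarith)
      calc ‖b (x v) - b (x u)‖ₑ ≤ ENNReal.ofReal L * ‖x v - x u‖ₑ := by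
            rw [Real.enorm_eq_ofReal_abs, Real.enorm_eq_ofReal_abs, ← ENNReal.ofReal_mul hL]
            exact ENNReal.ofReal_le_ofReal (h.lip_b _ _)
        _ ≤ _ := mul_le_mul_right h2 _
        _ = _ := by
            rw [mul_add, ← mul_assoc, ← ENNReal.ofReal_mul hL, ← ENNReal.ofReal_mul hL]
            simp only [mul_assoc]) hsmall
  have h2 := h.enorm_increment_le hα hα1 hβα hβ1 hαβ hs le_rfl hst ht h1
  have h3 := h2.trans (add_le_add_right (mul_le_mul_right hW _) _)
  rw [← ENNReal.ofReal_mul (by positivity), ← ENNReal.ofReal_add (by positivity) (by positivity),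
    Real.enorm_eq_ofReal_abs, ENNReal.ofReal_le_ofReal_iff (by positivity)] at h3
  have e1 : (t - s) ^ (α + β - 1) * (t - s) ^ (1 - α) = (t - s) ^ β := by
    rw [← Real.rpow_add hp]; congr 1; ring
  rw [mul_assoc _ _ ((t - s) ^ (1 - α)), e1] at h3
  linarith

/-- The constant in the Hölder estimate of the solution. -/
noncomputable def holderConst (α β θ K L : ℝ) : ℝ :=
  2 * (2 * incrConst α β θ K) *
    (2 * ((1 / (β - α) + 4 / β ^ 2) * (L * incrConst α β θ K) + 1)) ^ (1 / β - 1)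

theorem holderConst_nonneg (hα : 0 < α) (hα1 : α < 1) (hβα : α < β) (hαβ : 1 < α + β) (hK : 0 ≤ K)
    (hL : 0 ≤ L) : 0 ≤ holderConst α β θ K L := by
  have hA := incrConst_nonneg (θ := θ) hα hα1 hαβ hK
  have : 0 < β - α := by linarith
  have : 0 < β := by linarith
  unfold holderConst
  positivity

/-- Short intervals have length of order Λ^{-1/β} and Hölder constant of order Λ. Chaining
multiplies by Δ^{β-1}, of order Λ^{1/β-1}, hence the power 1/β. -/
theorem abs_increment_le (h : IsRoughPathSolution α β θ K L Λ T a b x g)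
    (hα : 0 < α) (hα1 : α < 1) (hβα : α < β) (hβ1 : β < 1) (hαβ : 1 < α + β) {s t : ℝ}
    (hs : 0 ≤ s) (hst : s ≤ t) (ht : t ≤ T) (h1 : t - s ≤ 1) :
    |x t - x s| ≤ holderConst α β θ K L * Λ ^ (1 / β) * (t - s) ^ β := by
  have hA := incrConst_nonneg (θ := θ) hα hα1 hαβ h.K_nonneg
  have hL := h.L_nonneg
  have hΛ := h.one_le
  have hΛ0 : 0 < Λ := by linarith
  have hβ : 0 < β := by linarith
  have hH := holderConst_nonneg (θ := θ) hα hα1 hβα hαβ h.K_nonneg hL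
  rcases eq_or_lt_of_le hst with rfl | hst
  · simp [Real.zero_rpow hβ.ne']
  have hβα' : 0 < β - α := by linarith
  set B := (1 / (β - α) + 4 / β ^ 2) * (L * incrConst α β θ K) + 1 with hB
  have hB0 : 0 ≤ (1 / (β - α) + 4 / β ^ 2) * (L * incrConst α β θ K) := by positivity
  have hB1 : 1 ≤ B := by linarith
  have hBΛ : 1 ≤ 2 * B * Λ := by nlinarith
  -- The length at which B Λ Δ^β = 1/2, so that the smallness condition holds up to Δ. The summand 1
  -- in B ensures 2BΛ ≥ 1, hence Δ ≤ 1.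
  set Δ := (2 * B * Λ) ^ (-(1 / β)) with hΔ
  have hΔ0 : 0 < Δ := by positivity
  have hΔ1 : Δ ≤ 1 := Real.rpow_le_one_of_one_le_of_nonpos hBΛ (by simp [hβ.le])
  have hΔβ : Δ ^ β = (2 * B * Λ)⁻¹ := by
    rw [hΔ, ← Real.rpow_mul (by positivity), show -(1 / β) * β = -1 by field_simp, Real.rpow_neg_one]
  have key := holder_chain (D := 2 * (incrConst α β θ K * Λ)) (x := x) (T := T) hβ hβ1 (by positivity)
    hΔ0 hΔ1 (fun s t hs hst ht hd => h.abs_increment_le_short hα hα1 hβα hβ1 hαβ hs hst ht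
      (hd.trans hΔ1) (by
        have h2 : (t - s) ^ β ≤ (2 * B * Λ)⁻¹ := by
          rw [← hΔβ]; exact Real.rpow_le_rpow (by linarith) hd hβ.le
        calc _ ≤ B * Λ * (t - s) ^ β := by
              have : 0 ≤ Λ * (t - s) ^ β := by
                have : 0 ≤ t - s := by linarith
                positivity
              rw [hB]; linarith
          _ ≤ B * Λ * (2 * B * Λ)⁻¹ := by gcongr
          _ = 1 / 2 := by field_simp)) hs hst ht h1
  refine key.trans (le_of_eq ?_)
  congr 1
  have e1 : Δ ^ (β - 1) = (2 * B) ^ (1 / β - 1) * Λ ^ (1 / β - 1) := by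
    rw [hΔ, ← Real.rpow_mul (by positivity), ← Real.mul_rpow (by positivity) hΛ0.le]
    congr 1; field_simp; ring
  have e2 : Λ ^ (1 / β) = Λ * Λ ^ (1 / β - 1) := by
    rw [← Real.rpow_one_add' hΛ0.le (by ring_nf; positivity)]; congr 1; ring
  rw [e1, e2, holderConst]
  ring

/-- The constant in the local error estimate for the Euler approximation. -/
noncomputable def localErrConst (α β θ K L : ℝ) : ℝ :=
  (|θ| + gammaFactor α * (1 + α / (β - α)) * (1 + (1 - α) / (α + β - 1))) *
    (L * holderConst α β θ K L)

theorem localErrConst_nonneg (hα : 0 < α) (hα1 : α < 1) (hβα : α < β) (hαβ : 1 < α + β)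
    (hK : 0 ≤ K) (hL : 0 ≤ L) : 0 ≤ localErrConst α β θ K L := by
  have hA := holderConst_nonneg (θ := θ) hα hα1 hβα hαβ hK hL
  have := gammaFactor_nonneg hα hα1
  have : 0 < β - α := by linarith
  have h2 : 0 < 1 - α := by linarith
  have h3 : 0 < α + β - 1 := by linarith
  unfold localErrConst
  positivity

/-- After subtraction of b(x_s) the boundary term of the left derivative is no longer singular: the
derivative is of order (t-s)^{β-α}, the right one of order (t-s)^{α+β-1}, and the length t-s
completes the exponent 2β. The drift error is of order (t-s)^{1+β}, which is smaller as β < 1. The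
integrand carries Λ^{1/β} and the driver one more Λ. -/
theorem abs_local_error_le (h : IsRoughPathSolution α β θ K L Λ T a b x g)
    (hα : 0 < α) (hα1 : α < 1) (hβα : α < β) (hβ1 : β < 1) (hαβ : 1 < α + β) {s t : ℝ}
    (hs : 0 ≤ s) (hst : s < t) (ht : t ≤ T) (h1 : t - s ≤ 1) :
    |x t - x s - θ * a (x s) * (t - s) -
      gammaFactor α * marchaudConst α * b (x s) * (g t - g s)| ≤
        localErrConst α β θ K L * Λ ^ (1 / β + 1) * (t - s) ^ (2 * β) := by
  obtain ⟨Λ', hΛ0', hΛ'⟩ := h.holder_global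
  have hL := h.L_nonneg
  have hΛ := h.one_le
  have hΛ0 : 0 < Λ := by linarith
  have hβ : 0 < β := by linarith
  have hp : 0 < t - s := by linarith
  have hγ := gammaFactor_nonneg hα hα1
  have hβα' : 0 < β - α := by linarith
  have h2 : 0 < 1 - α := by linarith
  have h3 : 0 < α + β - 1 := by linarith
  have hH0 := holderConst_nonneg (θ := θ) hα hα1 hβα hαβ h.K_nonneg hL
  set N := L * (holderConst α β θ K L * Λ ^ (1 / β)) with hN
  have hN0 : 0 ≤ N := by positivity
  have hinc : ∀ u v, s ≤ u → u ≤ v → v ≤ t → L * |x v - x u| ≤ N * (v - u) ^ β := by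
    intro u v hu huv hv
    rw [hN, mul_assoc]
    exact mul_le_mul_of_nonneg_left (h.abs_increment_le hα hα1 hβα hβ1 hαβ (hs.trans hu) huv
      (hv.trans ht) (by linarith)) hL
  have hH : HolderOnIcc β Λ g s t := fun u' v' h1' h2' h3' =>
    h.holder u' v' (hs.trans h1') h2' (h3'.trans ht) (by linarith)
  set f := fun r => b (x r)
  have hfc : Continuous f := h.continuous_b.comp h.continuous_x
  have hfin := lintegral_marchaudAbs_restart hs ht
    (h.lintegral_marchaudAbs_lt_top hα hα1 hβα hβ1 hαβ)
  have hψ : ∀ y ∈ Ioo s t, |marchaudLeft α (fun r => f r - f s) s y| ≤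
      N * (1 + α / (β - α)) * (t - s) ^ (β - α) := by
    intro y hy
    have hys : 0 < y - s := by linarith [hy.1]
    have hfi : ∀ u v, s ≤ u → u ≤ v → v ≤ t → |f v - f u| ≤ N * (v - u) ^ β := fun u v hu huv hv =>
      (h.lip_b _ _).trans (hinc u v hu huv hv)
    have i1 : |(f y - f s) * (y - s) ^ (-α)| ≤ N * (y - s) ^ (β - α) := by
      rw [abs_mul, abs_of_nonneg (Real.rpow_nonneg hys.le (-α)), sub_eq_add_neg β,
        Real.rpow_add hys, ← mul_assoc]
      exact mul_le_mul_of_nonneg_right (hfi s y le_rfl hy.1.le hy.2.le) (Real.rpow_nonneg hys.le _)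
    have i2 := intervalIntegral.norm_integral_le_of_norm_le (μ := volume) (a := s) (b := y)
      (f := fun u => ((f y - f s) - (f u - f s)) * (y - u) ^ (-1 - α))
      (g := fun u => N * (y - u) ^ (β - α - 1)) hy.1.le
      (by
        -- The end point u = y is discarded as a null set, since splitting the power needs a
        -- positive base.
        rw [ae_iff]
        refine measure_mono_null (t := {y}) (fun u hu => ?_) (measure_singleton y)
        simp only [mem_ofPred_eq, Classical.not_imp] at hu
        by_contra hne
        refine hu.2 ?_
        have hyu : 0 < y - u := sub_pos.2 (lt_of_le_of_ne hu.1.2 hne)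
        rw [sub_sub_sub_cancel_right, Real.norm_eq_abs, abs_mul,
          abs_of_nonneg (Real.rpow_nonneg hyu.le (-1 - α)), show β - α - 1 = β + (-1 - α) by ring,
          Real.rpow_add hyu, ← mul_assoc]
        exact mul_le_mul_of_nonneg_right (hfi u y hu.1.1.le hu.1.2 hy.2.le)
          (Real.rpow_nonneg hyu.le _))
      ((intervalIntegrable_sub_left_rpow (by linarith) y s y).const_mul N)
    rw [intervalIntegral.integral_const_mul, integral_sub_left_rpow (by linarith), sub_add_cancel,
      Real.norm_eq_abs] at i2
    have i3 : (y - s) ^ (β - α) ≤ (t - s) ^ (β - α) :=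
      Real.rpow_le_rpow hys.le (by linarith [hy.2]) hβα'.le
    unfold marchaudLeft
    refine (abs_add_le _ _).trans ?_
    rw [abs_mul α, abs_of_pos hα]
    calc _ ≤ N * (y - s) ^ (β - α) + α * (N * ((y - s) ^ (β - α) / (β - α))) :=
          add_le_add i1 (mul_le_mul_of_nonneg_left i2 hα.le)
      _ = N * (1 + α / (β - α)) * (y - s) ^ (β - α) := by ring
      _ ≤ _ := by gcongr
  set I := ∫ y in s..t, marchaudLeft α (fun r => f r - f s) s y * marchaudRight α g t y with hI
  have hIb : |I| ≤ N * (1 + α / (β - α)) * (1 + (1 - α) / (α + β - 1)) * Λ * (t - s) ^ (2 * β) := by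
    have j1 : ∀ y ∈ Ioo s t, ‖marchaudLeft α (fun r => f r - f s) s y * marchaudRight α g t y‖ ≤
        (N * (1 + α / (β - α)) * (t - s) ^ (β - α)) *
          ((1 + (1 - α) / (α + β - 1)) * Λ * (t - s) ^ (α + β - 1)) := by
      intro y hy
      rw [norm_mul]
      refine mul_le_mul (hψ y hy) ((hH.abs_marchaudRight_le hα1 hαβ hy.1.le hy.2).trans ?_)
        (norm_nonneg _) (by positivity)
      refine mul_le_mul_of_nonneg_left ?_ (by positivity)
      exact Real.rpow_le_rpow (by linarith [hy.2]) (by linarith [hy.1]) h3.le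
    have j2 : |I| ≤ (N * (1 + α / (β - α)) * (t - s) ^ (β - α)) *
          ((1 + (1 - α) / (α + β - 1)) * Λ * (t - s) ^ (α + β - 1)) * (t - s) := by
      rw [hI, intervalIntegral.integral_of_le hst.le, integral_Ioc_eq_integral_Ioo]
      have := norm_setIntegral_le_of_norm_le_const (μ := volume) (s := Ioo s t) (by simp) j1
      rwa [Real.norm_eq_abs, Measure.real, Real.volume_Ioo, ENNReal.toReal_ofReal hp.le] at this
    refine j2.trans (le_of_eq ?_)
    have e : (t - s) ^ (2 * β) = (t - s) ^ (β - α) * (t - s) ^ (α + β - 1) * (t - s) := by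
      rw [← Real.rpow_add hp, ← Real.rpow_add_one hp.ne']; congr 1; ring
    rw [e]; ring
  have hdrift : |θ * (∫ r in s..t, a (x r)) - θ * a (x s) * (t - s)| ≤
      |θ| * N * Λ * (t - s) ^ (2 * β) := by
    have hac : Continuous fun r => a (x r) := h.continuous_a.comp h.continuous_x
    have k1 : (∫ r in s..t, a (x r)) - a (x s) * (t - s) = ∫ r in s..t, (a (x r) - a (x s)) := by
      rw [intervalIntegral.integral_sub (hac.intervalIntegrable _ _) (by simp)]
      simp [mul_comm]
    have k2 := intervalIntegral.norm_integral_le_of_norm_le_const (a := s) (b := t)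
      (C := N * (t - s) ^ β) (f := fun r => a (x r) - a (x s)) fun y hy => by
        rw [uIoc_of_le hst.le] at hy
        refine (h.lip_a _ _).trans ((hinc s y le_rfl hy.1.le hy.2).trans ?_)
        gcongr
        · linarith [hy.1]
        · exact hy.2
    rw [mul_assoc, ← mul_sub, k1, abs_mul, mul_assoc, mul_assoc]
    refine mul_le_mul_of_nonneg_left (k2.trans ?_) (abs_nonneg θ)
    rw [abs_of_pos hp, mul_assoc]
    refine mul_le_mul_of_nonneg_left ?_ hN0
    have k3 : t - s ≤ (t - s) ^ β := by
      calc t - s = (t - s) ^ (1 : ℝ) := (Real.rpow_one _).symm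
        _ ≤ _ := Real.rpow_le_rpow_of_exponent_ge hp h1 hβ1.le
    have k4 : (t - s) ^ (2 * β) = (t - s) ^ β * (t - s) ^ β := by
      rw [← Real.rpow_add hp]; congr 1; ring
    rw [k4]
    calc (t - s) ^ β * (t - s) ≤ 1 * ((t - s) ^ β * (t - s) ^ β) := by rw [one_mul]; gcongr
      _ ≤ _ := by gcongr
  have e : x t - x s - θ * a (x s) * (t - s) -
      gammaFactor α * marchaudConst α * b (x s) * (g t - g s) =
      (θ * (∫ r in s..t, a (x r)) - θ * a (x s) * (t - s)) - gammaFactor α * I := by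
    have e1 := h.increment_eq hα hα1 hβα hβ1 hαβ hs hst.le ht
    have e2 := integral_marchaud_sub_const hα hα1 hβ hαβ hfc (fun y => h.bound_b (x y)) hst.le hfin
      h.continuous_g hΛ0' hΛ' (f s)
    rw [e1, e2]
    ring
  rw [e]
  refine (abs_sub _ _).trans ?_
  rw [abs_mul (gammaFactor α), abs_of_nonneg hγ]
  refine (add_le_add hdrift (mul_le_mul_of_nonneg_left hIb hγ)).trans (le_of_eq ?_)
  rw [Real.rpow_add hΛ0, Real.rpow_one, localErrConst, hN]
  ring

end IsRoughPathSolution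

/-! ### Exponential moments of Gaussian families -/

/-- For v > 0 the integral is (1 - v/2)^{-1/2}, at most √2. Zero variance is a Dirac mass and is
treated apart, having no density. -/
theorem lintegral_exp_sq_gaussianReal_le {v : ℝ≥0} (hv : v ≤ 1) :
    ∫⁻ x, ENNReal.ofReal (Real.exp (x ^ 2 / 4)) ∂(gaussianReal 0 v) ≤ 2 := by
  by_cases h0 : v = 0
  · subst h0
    rw [gaussianReal_zero_var, lintegral_dirac]
    simp
  have hvp : 0 < (v : ℝ) := by positivity
  have hv1 : (v : ℝ) ≤ 1 := by exact_mod_cast hv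
  set c : ℝ := (2 * (v : ℝ))⁻¹ - 1 / 4 with hc
  have hc0 : 0 < c := by
    have : (1 : ℝ) / 2 ≤ (2 * (v : ℝ))⁻¹ := by
      rw [one_div]
      exact inv_anti₀ (by positivity) (by linarith)
    linarith
  rw [gaussianReal_of_var_ne_zero _ h0, lintegral_withDensity_eq_lintegral_mul _
    (measurable_gaussianPDF 0 v) (by fun_prop)]
  have e : ∀ x, (gaussianPDF 0 v * fun x => ENNReal.ofReal (Real.exp (x ^ 2 / 4))) x =
      ENNReal.ofReal ((√(2 * Real.pi * v))⁻¹ * Real.exp (-c * x ^ 2)) := by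
    intro x
    rw [Pi.mul_apply, gaussianPDF, ← ENNReal.ofReal_mul (gaussianPDFReal_nonneg _ _ _),
      gaussianPDFReal, mul_assoc, ← Real.exp_add]
    congr 3
    rw [hc]; field_simp; ring
  simp_rw [e]
  rw [← ofReal_integral_eq_lintegral_ofReal ((integrable_exp_neg_mul_sq hc0).const_mul _)
    (Eventually.of_forall fun x => by positivity), integral_const_mul, integral_gaussian]
  rw [show (2 : ℝ≥0∞) = ENNReal.ofReal 2 by simp]
  refine ENNReal.ofReal_le_ofReal ?_
  rw [inv_mul_le_iff₀ (by positivity)]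
  refine Real.sqrt_le_iff.2 ⟨by positivity, ?_⟩
  rw [mul_pow, Real.sq_sqrt (by positivity)]
  rw [div_le_iff₀ hc0, hc]
  have : 2 * Real.pi * v * 2 ^ 2 * ((2 * (v : ℝ))⁻¹ - 1 / 4) = 2 * Real.pi * (2 - v) := by
    field_simp; ring
  rw [this]
  nlinarith [Real.pi_pos]

theorem lintegral_exp_sq_le_of_hasGaussianLaw {Ω : Type*} [MeasurableSpace Ω] {P : Measure Ω}
    {X : Ω → ℝ} (hX : HasGaussianLaw X P) (h0 : ∫ ω, X ω ∂P = 0) (h1 : ∫ ω, X ω * X ω ∂P ≤ 1) :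
    ∫⁻ ω, ENNReal.ofReal (Real.exp (X ω ^ 2 / 4)) ∂P ≤ 2 := by
  have hv : Var[X; P] ≤ 1 := by
    rw [variance_of_integral_eq_zero hX.aemeasurable h0]
    simpa only [sq] using h1
  have hm := hX.map_eq_gaussianReal
  rw [h0] at hm
  have := lintegral_map' (μ := P) (f := fun x : ℝ => ENNReal.ofReal (Real.exp (x ^ 2 / 4))) (g := X)
    (by fun_prop) hX.aemeasurable
  rw [← this, hm]
  exact lintegral_exp_sq_gaussianReal_le (Real.toNNReal_le_one.2 hv)

theorem pow_one_add_log_le (s : ℝ) (hs : 0 ≤ s) (m : ℕ) :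
    (1 + Real.log (1 + s)) ^ m ≤ m.factorial * Real.exp 1 * (1 + s) := by
  have hl : 0 ≤ Real.log (1 + s) := Real.log_nonneg (by linarith)
  have := Real.pow_div_factorial_le_exp (x := 1 + Real.log (1 + s)) (by linarith) m
  rw [div_le_iff₀ (by positivity), Real.exp_add, Real.exp_log (by linarith)] at this
  linarith

/-- A countable family of random variables with uniformly bounded Gaussian exponential moments is
dominated, up to a slowly growing factor, by a random variable with all moments. -/
theorem exists_dominating_of_exp_sq {Ω ι : Type*} [MeasurableSpace Ω] {P : Measure Ω}
    [IsProbabilityMeasure P] [Countable ι] {G : ι → Ω → ℝ} {l : ι → ℝ}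
    (hG : ∀ i, AEMeasurable (G i) P)
    (hexp : ∀ i, ∫⁻ ω, ENNReal.ofReal (Real.exp (G i ω ^ 2 / 4)) ∂P ≤ 2)
    (hl : ∀ i, 1 ≤ l i) (hsum : Summable fun i => Real.exp (-l i)) :
    ∃ ζ : Ω → ℝ, Measurable ζ ∧ (∀ ω, 1 ≤ ζ ω) ∧ (∀ m : ℕ, Integrable (fun ω => ζ ω ^ m) P) ∧
      ∀ᵐ ω ∂P, ∀ i, |G i ω| ≤ ζ ω * √(l i) := by
  set G' : ι → Ω → ℝ := fun i => (hG i).mk (G i)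
  have hG' : ∀ i, Measurable (G' i) := fun i => (hG i).measurable_mk
  set S : Ω → ℝ≥0∞ := fun ω => ∑' i, ENNReal.ofReal (Real.exp (-l i)) *
    ENNReal.ofReal (Real.exp (G' i ω ^ 2 / 4)) with hS
  have hSm : Measurable S := Measurable.tsum fun i => by
    have := hG' i
    fun_prop
  have hSi : ∫⁻ ω, S ω ∂P < ∞ := by
    rw [hS, lintegral_tsum fun i => by have := hG' i; fun_prop]
    have h1 : ∀ i, ∫⁻ ω, ENNReal.ofReal (Real.exp (-l i)) *
        ENNReal.ofReal (Real.exp (G' i ω ^ 2 / 4)) ∂P ≤ ENNReal.ofReal (Real.exp (-l i)) * 2 := by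
      intro i
      rw [lintegral_const_mul' _ _ ENNReal.ofReal_ne_top]
      gcongr
      refine (le_of_eq (lintegral_congr_ae ?_)).trans (hexp i)
      filter_upwards [(hG i).ae_eq_mk] with ω hω
      rw [hω]
    refine (ENNReal.tsum_le_tsum h1).trans_lt ?_
    rw [ENNReal.tsum_mul_right]
    refine ENNReal.mul_lt_top ?_ (by simp)
    rw [← ENNReal.ofReal_tsum_of_nonneg (fun i => (Real.exp_pos _).le) hsum]
    exact ENNReal.ofReal_lt_top
  set s : Ω → ℝ := fun ω => (S ω).toReal
  have hs0 : ∀ ω, 0 ≤ s ω := fun ω => ENNReal.toReal_nonneg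
  have hsm : Measurable s := hSm.ennreal_toReal
  have hsi : Integrable s P := integrable_toReal_of_lintegral_ne_top hSm.aemeasurable hSi.ne
  have hlog : ∀ ω, 0 ≤ Real.log (1 + s ω) := fun ω => Real.log_nonneg (by linarith [hs0 ω])
  have hζ : Measurable fun ω => 2 * (1 + Real.log (1 + s ω)) :=
    ((Real.measurable_log.comp (hsm.const_add 1)).const_add 1).const_mul 2
  -- One term of the series gives exp(G²/4 - l) ≤ 1 + s, so G² ≤ 4 (l + log(1+s)) ≤ 4 (1 +
  -- log(1+s))² l because l ≥ 1. All moments of the logarithm are finite although only the first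
  -- moment of s is known.
  refine ⟨fun ω => 2 * (1 + Real.log (1 + s ω)), hζ, fun ω => by linarith [hlog ω],
    fun m => ?_, ?_⟩
  · have hi : Integrable (fun ω => 2 ^ m * (m.factorial * Real.exp 1 * (1 + s ω))) P :=
      (((integrable_const 1).add hsi).const_mul _).const_mul _
    refine hi.mono' (hζ.pow_const m).aestronglyMeasurable (Eventually.of_forall fun ω => ?_)
    have := hlog ω
    rw [Real.norm_of_nonneg (by positivity), mul_pow]
    gcongr
    exact pow_one_add_log_le (s ω) (hs0 ω) m
  · have hall : ∀ᵐ ω ∂P, ∀ i, G i ω = G' i ω := ae_all_iff.2 fun i => (hG i).ae_eq_mk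
    filter_upwards [hall, ae_lt_top hSm hSi.ne] with ω hω hfin i
    have h1 : Real.exp (G i ω ^ 2 / 4 - l i) ≤ 1 + s ω := by
      have h2 : ENNReal.ofReal (Real.exp (-l i)) * ENNReal.ofReal (Real.exp (G' i ω ^ 2 / 4)) ≤ S ω :=
        ENNReal.le_tsum i
      rw [← ENNReal.ofReal_mul (Real.exp_pos _).le, ← Real.exp_add] at h2
      have h3 := (ENNReal.ofReal_le_iff_le_toReal hfin.ne).1 h2
      rw [hω i, show G' i ω ^ 2 / 4 - l i = -l i + G' i ω ^ 2 / 4 by ring]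
      linarith
    have h2 : G i ω ^ 2 / 4 - l i ≤ Real.log (1 + s ω) :=
      (Real.le_log_iff_exp_le (by linarith [hs0 ω])).2 h1
    have hL := hlog ω
    have hli := hl i
    refine abs_le_of_sq_le_sq ?_ (by positivity)
    rw [mul_pow, Real.sq_sqrt (by linarith)]
    nlinarith [mul_nonneg hL (by linarith : 0 ≤ l i - 1), mul_nonneg hL hL,
      mul_nonneg (mul_nonneg hL hL) (by linarith : 0 ≤ l i)]

/-! ### Second moments of fractional Brownian increments -/

section FractionalBrownianMotion

variable {Ω : Type*} [MeasurableSpace Ω] {P : Measure Ω} {H : ℝ}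
  {B : ℝ → Ω → ℝ}

theorem IsFractionalBrownianMotion.memLp_two (hB : IsFractionalBrownianMotion P H B) {t : ℝ}
    (ht : 0 ≤ t) : MemLp (B t) 2 P :=
  (hB.gaussian.hasGaussianLaw_eval ⟨t, ht⟩).memLp_two

theorem IsFractionalBrownianMotion.integrable_mul (hB : IsFractionalBrownianMotion P H B) {s t : ℝ}
    (hs : 0 ≤ s) (ht : 0 ≤ t) : Integrable (fun ω => B s ω * B t ω) P :=
  (hB.memLp_two hs).integrable_mul (hB.memLp_two ht)

theorem IsFractionalBrownianMotion.increment_covariance (hB : IsFractionalBrownianMotion P H B)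
    {s t u v : ℝ} (hs : 0 ≤ s) (ht : 0 ≤ t) (hu : 0 ≤ u) (hv : 0 ≤ v) :
    ∫ ω, (B t ω - B s ω) * (B v ω - B u ω) ∂P =
      (|t - u| ^ (2 * H) + |s - v| ^ (2 * H) - |t - v| ^ (2 * H) - |s - u| ^ (2 * H)) / 2 := by
  have e : ∀ ω, (B t ω - B s ω) * (B v ω - B u ω) =
      (B t ω * B v ω - B t ω * B u ω) - (B s ω * B v ω - B s ω * B u ω) := fun ω => by ring
  have h1 : Integrable (fun ω => B t ω * B v ω - B t ω * B u ω) P :=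
    (hB.integrable_mul ht hv).sub (hB.integrable_mul ht hu)
  have h2 : Integrable (fun ω => B s ω * B v ω - B s ω * B u ω) P :=
    (hB.integrable_mul hs hv).sub (hB.integrable_mul hs hu)
  simp_rw [e]
  rw [integral_sub h1 h2, integral_sub (hB.integrable_mul ht hv) (hB.integrable_mul ht hu),
    integral_sub (hB.integrable_mul hs hv) (hB.integrable_mul hs hu),
    hB.covariance v t hv ht, hB.covariance u t hu ht, hB.covariance v s hv hs,
    hB.covariance u s hu hs]
  ring

theorem IsFractionalBrownianMotion.hasGaussianLaw_sum (hB : IsFractionalBrownianMotion P H B)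
    {ι : Type*} (I : Finset ι) (c s t : ι → ℝ) (hs : ∀ i, 0 ≤ s i) (ht : ∀ i, 0 ≤ t i) :
    HasGaussianLaw (fun ω => ∑ i ∈ I, c i * (B (t i) ω - B (s i) ω)) P := by
  classical
  have hY : IsGaussianProcess (fun (i : ι) ω => c i * (B (t i) ω - B (s i) ω)) P := by
    refine hB.gaussian.of_isGaussianProcess fun i => ?_
    set S : Finset ℝ≥0 := {(t i).toNNReal, (s i).toNNReal} with hS
    refine ⟨S, c i • (ContinuousLinearMap.proj (R := ℝ) (φ := fun _ : S => ℝ)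
      ⟨(t i).toNNReal, by simp [hS]⟩ - ContinuousLinearMap.proj ⟨(s i).toNNReal, by simp [hS]⟩),
      fun ω => ?_⟩
    simp [hs i, ht i]
  exact hY.hasGaussianLaw_fun_sum

theorem IsFractionalBrownianMotion.integral_sum (hB : IsFractionalBrownianMotion P H B)
    {ι : Type*} (I : Finset ι) (c s t : ι → ℝ) (hs : ∀ i, 0 ≤ s i) (ht : ∀ i, 0 ≤ t i) :
    ∫ ω, ∑ i ∈ I, c i * (B (t i) ω - B (s i) ω) ∂P = 0 := by
  have hi : ∀ t, 0 ≤ t → Integrable (B t) P := fun t ht =>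
    (hB.gaussian.hasGaussianLaw_eval ⟨t, ht⟩).integrable
  have hi' : ∀ i, Integrable (fun ω => c i * (B (t i) ω - B (s i) ω)) P :=
    fun i => ((hi _ (ht i)).sub (hi _ (hs i))).const_mul _
  rw [integral_finsetSum _ fun i _ => hi' i]
  refine Finset.sum_eq_zero fun i _ => ?_
  rw [integral_const_mul, integral_sub (hi _ (ht i)) (hi _ (hs i)), hB.centered _ (ht i),
    hB.centered _ (hs i)]
  simp

theorem IsFractionalBrownianMotion.integral_sum_mul_self (hB : IsFractionalBrownianMotion P H B)
    {ι : Type*} (I : Finset ι) (c s t : ι → ℝ) (hs : ∀ i, 0 ≤ s i) (ht : ∀ i, 0 ≤ t i) :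
    ∫ ω, (∑ i ∈ I, c i * (B (t i) ω - B (s i) ω)) * (∑ i ∈ I, c i * (B (t i) ω - B (s i) ω)) ∂P =
      ∑ i ∈ I, ∑ j ∈ I, c i * c j * ∫ ω, (B (t i) ω - B (s i) ω) * (B (t j) ω - B (s j) ω) ∂P := by
  have hi : ∀ i j, Integrable (fun ω => (B (t i) ω - B (s i) ω) * (B (t j) ω - B (s j) ω)) P :=
    fun i j => ((hB.memLp_two (ht i)).sub (hB.memLp_two (hs i))).integrable_mul
      ((hB.memLp_two (ht j)).sub (hB.memLp_two (hs j)))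
  have e : ∀ ω, (∑ i ∈ I, c i * (B (t i) ω - B (s i) ω)) * (∑ i ∈ I, c i * (B (t i) ω - B (s i) ω)) =
      ∑ i ∈ I, ∑ j ∈ I, c i * c j * ((B (t i) ω - B (s i) ω) * (B (t j) ω - B (s j) ω)) := by
    intro ω
    rw [Finset.sum_mul_sum]
    refine Finset.sum_congr rfl fun i _ => Finset.sum_congr rfl fun j _ => by ring
  simp_rw [e]
  rw [integral_finsetSum _ fun i _ => integrable_finsetSum _ fun j _ => (hi i j).const_mul _]
  refine Finset.sum_congr rfl fun i _ => ?_
  rw [integral_finsetSum _ fun j _ => (hi i j).const_mul _]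
  exact Finset.sum_congr rfl fun j _ => integral_const_mul _ _

end FractionalBrownianMotion

/-! ### Dyadic chaining -/

theorem half_rpow_lt_one {β : ℝ} (hβ : 0 < β) : (1 / 2 : ℝ) ^ β < 1 :=
  Real.rpow_lt_one (by norm_num) (by norm_num) hβ

/-- The constant of the dyadic chaining bound. -/
noncomputable def chainingConst (β : ℝ) : ℝ :=
  (1 + 2 / (1 - (1 / 2 : ℝ) ^ β)) / (1 / 2 : ℝ) ^ β

theorem one_le_chainingConst {β : ℝ} (hβ : 0 < β) : 1 ≤ chainingConst β := by
  have h1 := half_rpow_lt_one hβ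
  have h0 : 0 < (1 / 2 : ℝ) ^ β := by positivity
  have h2 : 0 < 2 / (1 - (1 / 2 : ℝ) ^ β) := div_pos two_pos (by linarith)
  rw [chainingConst, le_div_iff₀ h0]
  linarith

section Dyadic

variable {g : ℝ → ℝ} {n : ℕ} {Λ β : ℝ}

theorem abs_sub_le_of_eq_or_succ (hΛ : 0 ≤ Λ)
    (hinc : ∀ m j : ℕ, j + 1 ≤ 2 ^ (n + m) →
      |g ((j + 1 : ℕ) / 2 ^ m) - g (j / 2 ^ m)| ≤ Λ * ((1 / 2 : ℝ) ^ β) ^ m)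
    {m i j : ℕ} (hj : j ≤ 2 ^ (n + m)) (h : j = i ∨ j = i + 1) :
    |g (j / 2 ^ m) - g (i / 2 ^ m)| ≤ Λ * ((1 / 2 : ℝ) ^ β) ^ m := by
  rcases h with rfl | rfl
  · rw [sub_self, abs_zero]
    positivity
  · exact hinc m i hj

theorem floor_mul_two_pow_le {t : ℝ} (ht : t ≤ 2 ^ n) (m : ℕ) : ⌊t * 2 ^ m⌋₊ ≤ 2 ^ (n + m) := by
  refine Nat.floor_le_of_le ?_
  push_cast
  rw [pow_add]
  gcongr

/-- The dyadic floor of t at level m+1 is either the floor at level m or its right neighbour on the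
finer grid. The increments along the floors are thus dominated by a geometric series, and by
continuity they lead to g t. -/
theorem abs_sub_floor_le (hβ : 0 < β) (hg : ContinuousOn g (Ici 0)) (hΛ : 0 ≤ Λ)
    (hinc : ∀ m j : ℕ, j + 1 ≤ 2 ^ (n + m) →
      |g ((j + 1 : ℕ) / 2 ^ m) - g (j / 2 ^ m)| ≤ Λ * ((1 / 2 : ℝ) ^ β) ^ m)
    {t : ℝ} (h0 : 0 ≤ t) (ht : t ≤ 2 ^ n) (m : ℕ) :
    |g (⌊t * 2 ^ m⌋₊ / 2 ^ m) - g t| ≤ Λ * ((1 / 2 : ℝ) ^ β) ^ m / (1 - (1 / 2 : ℝ) ^ β) := by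
  have h1 := half_rpow_lt_one hβ
  have hq : 0 < (1 / 2 : ℝ) ^ β := by positivity
  refine dist_le_of_le_geometric_of_tendsto ((1 / 2 : ℝ) ^ β) Λ h1
    (f := fun m => g (⌊t * 2 ^ m⌋₊ / 2 ^ m)) (fun m => ?_) ?_ m
  · rw [dist_comm, Real.dist_eq]
    have hk : ((2 * ⌊t * 2 ^ m⌋₊ : ℕ) : ℝ) / 2 ^ (m + 1) = ⌊t * 2 ^ m⌋₊ / 2 ^ m := by
      rw [pow_succ]; push_cast; field_simp
    have hx : 0 ≤ t * 2 ^ m := by positivity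
    have hfl := Nat.floor_le hx
    have hlt := Nat.lt_floor_add_one (t * 2 ^ m)
    have h2 : t * 2 ^ (m + 1) = 2 * (t * 2 ^ m) := by ring
    have hlow : 2 * ⌊t * 2 ^ m⌋₊ ≤ ⌊t * 2 ^ (m + 1)⌋₊ := by
      rw [h2]
      refine Nat.le_floor ?_
      push_cast
      linarith
    have hupp : ⌊t * 2 ^ (m + 1)⌋₊ < 2 * ⌊t * 2 ^ m⌋₊ + 2 := by
      rw [h2, Nat.floor_lt (by positivity)]
      push_cast
      linarith
    have := abs_sub_le_of_eq_or_succ hΛ hinc (m := m + 1) (i := 2 * ⌊t * 2 ^ m⌋₊)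
      (floor_mul_two_pow_le ht (m + 1)) (by omega)
    rw [hk] at this
    refine this.trans ?_
    gcongr Λ * ?_
    exact pow_le_pow_of_le_one hq.le h1.le (Nat.le_succ m)
  · have hlim : Tendsto (fun m : ℕ => (⌊t * 2 ^ m⌋₊ : ℝ) / 2 ^ m) atTop (𝓝 t) :=
      (tendsto_nat_floor_mul_div_atTop h0).comp (tendsto_pow_atTop_atTop_of_one_lt one_lt_two)
    exact ((hg t h0).tendsto).comp (tendsto_nhdsWithin_iff.2
      ⟨hlim, Eventually.of_forall fun m => mem_Ici.2 (by positivity)⟩)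

/-- Bounds on all dyadic increments of a continuous function imply a Hölder bound. -/
theorem abs_sub_le_of_dyadic (hβ : 0 < β) (hg : ContinuousOn g (Ici 0)) (hΛ : 0 ≤ Λ)
    (hinc : ∀ m j : ℕ, j + 1 ≤ 2 ^ (n + m) →
      |g ((j + 1 : ℕ) / 2 ^ m) - g (j / 2 ^ m)| ≤ Λ * ((1 / 2 : ℝ) ^ β) ^ m)
    {s t : ℝ} (hs : 0 ≤ s) (hst : s ≤ t) (ht : t ≤ 2 ^ n) (h1 : t - s ≤ 1) :
    |g t - g s| ≤ chainingConst β * Λ * (t - s) ^ β := by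
  rcases hst.eq_or_lt with rfl | hst
  · simp [Real.zero_rpow hβ.ne']
  have hq1 := half_rpow_lt_one hβ
  have hq : 0 < (1 / 2 : ℝ) ^ β := by positivity
  have hq' : 0 < 1 - (1 / 2 : ℝ) ^ β := by linarith
  -- The level with 2^{-m-1} < t-s ≤ 2^{-m}: the floors of s and t are then equal or adjacent, and
  -- 2^{-mβ} is comparable with (t-s)^β.
  obtain ⟨m, hm1, hm2⟩ := exists_nat_pow_near_of_lt_one (x := t - s) (y := (1 / 2 : ℝ))
    (by linarith) h1 (by norm_num) (by norm_num)
  have hts : t * 2 ^ m ≤ s * 2 ^ m + 1 := by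
    have : (t - s) * 2 ^ m ≤ (1 / 2) ^ m * 2 ^ m := by gcongr
    rw [← mul_pow] at this
    norm_num at this
    linarith
  have hmono : ⌊s * 2 ^ m⌋₊ ≤ ⌊t * 2 ^ m⌋₊ := Nat.floor_mono (by gcongr)
  have hle : ⌊t * 2 ^ m⌋₊ ≤ ⌊s * 2 ^ m⌋₊ + 1 := by
    rw [← Nat.floor_add_one (by positivity)]
    exact Nat.floor_mono hts
  have a1 := abs_sub_floor_le hβ hg hΛ hinc hs (hst.le.trans ht) m
  have a2 := abs_sub_floor_le hβ hg hΛ hinc (hs.trans hst.le) ht m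
  have a3 := abs_sub_le_of_eq_or_succ hΛ hinc (m := m) (i := ⌊s * 2 ^ m⌋₊)
    (floor_mul_two_pow_le ht m) (by omega)
  have hpow : ((1 / 2 : ℝ) ^ β) ^ m ≤ (t - s) ^ β / (1 / 2 : ℝ) ^ β := by
    rw [le_div_iff₀ hq, ← pow_succ, ← Real.rpow_mul_natCast (by norm_num), mul_comm β,
      Real.rpow_natCast_mul (by norm_num)]
    gcongr
  calc |g t - g s| ≤ |g (⌊t * 2 ^ m⌋₊ / 2 ^ m) - g t| +
        |g (⌊t * 2 ^ m⌋₊ / 2 ^ m) - g (⌊s * 2 ^ m⌋₊ / 2 ^ m)| +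
        |g (⌊s * 2 ^ m⌋₊ / 2 ^ m) - g s| := by
        rw [abs_sub_comm _ (g t)]
        refine le_trans (le_of_eq ?_) (abs_add_three _ _ _)
        congr 1; ring
    _ ≤ Λ * (1 + 2 / (1 - (1 / 2 : ℝ) ^ β)) * ((1 / 2 : ℝ) ^ β) ^ m := by
        refine (add_le_add (add_le_add a2 a3) a1).trans (le_of_eq ?_)
        field_simp; ring
    _ ≤ Λ * (1 + 2 / (1 - (1 / 2 : ℝ) ^ β)) * ((t - s) ^ β / (1 / 2 : ℝ) ^ β) := by
        gcongr
    _ = chainingConst β * Λ * (t - s) ^ β := by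
        rw [chainingConst]; ring

end Dyadic

/-! ### Variance of the weighted noise -/

theorem sum_Icc_sub_pred (F : ℕ → ℝ) (M : ℕ) :
    ∑ k ∈ Finset.Icc 1 M, (F k - F (k - 1)) = F M - F 0 := by
  induction M with
  | zero => simp
  | succ M ih => rw [Finset.sum_Icc_succ_top (by omega), ih, Nat.add_sub_cancel]; ring

theorem rpow_sub_rpow_le {p x d : ℝ} (hp : 1 ≤ p) (hd : 0 ≤ d) (hx : d ≤ x) :
    x ^ p - (x - d) ^ p ≤ p * d * x ^ (p - 1) := by
  rcases (hd.trans hx).eq_or_lt with rfl | hx0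
  · have : d = 0 := le_antisymm hx hd
    simp [this]
  have h1 := one_add_mul_self_le_rpow_one_add (s := -(d / x)) (p := p)
    (by rw [neg_le_neg_iff]; exact (div_le_one hx0).2 hx) hp
  have h2 : (x - d) ^ p = x ^ p * (1 + -(d / x)) ^ p := by
    rw [← Real.mul_rpow hx0.le]
    · congr 1; field_simp; ring
    · have := (div_le_one hx0).2 hx
      linarith
  have h3 : x ^ p = x ^ (p - 1) * x := by rw [← Real.rpow_add_one hx0.ne', sub_add_cancel]
  have h4 : 0 ≤ x ^ p := by positivity
  have h5 := mul_le_mul_of_nonneg_left h1 h4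
  have h6 : x ^ p * (p * -(d / x)) = -(p * d * x ^ (p - 1)) := by
    rw [h3]; field_simp
  rw [h2]
  linarith

/-- Bernoulli's inequality for the exponent q+1 ∈ (0, 1]. The right side telescopes along a grid of
mesh d, which bounds Riemann sums of a singular power. -/
theorem mul_rpow_le_rpow_sub {q x d : ℝ} (hq0 : -1 < q) (hq : q ≤ 0) (hx0 : 0 < x)
    (hx : d ≤ x) : x ^ q * d ≤ (x ^ (q + 1) - (x - d) ^ (q + 1)) / (q + 1) := by
  have h1 := rpow_one_add_le_one_add_mul_self (s := -(d / x)) (p := q + 1)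
    (by rw [neg_le_neg_iff]; exact (div_le_one hx0).2 hx) (by linarith) (by linarith)
  have h2 : (x - d) ^ (q + 1) = x ^ (q + 1) * (1 + -(d / x)) ^ (q + 1) := by
    rw [← Real.mul_rpow hx0.le]
    · congr 1; field_simp; ring
    · have := (div_le_one hx0).2 hx
      linarith
  have h3 : x ^ (q + 1) = x ^ q * x := Real.rpow_add_one hx0.ne' q
  have h4 : 0 ≤ x ^ (q + 1) := by positivity
  have h5 := mul_le_mul_of_nonneg_left h1 h4
  have h6 : x ^ (q + 1) * ((q + 1) * -(d / x)) = -((q + 1) * (x ^ q * d)) := by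
    rw [h3]; field_simp
  rw [le_div_iff₀ (by linarith), h2]
  linarith

/-- Midpoint convexity. With p = 2H ≥ 1 it says that increments of B over grid cells are
nonnegatively correlated. -/
theorem abs_rpow_second_difference_nonneg {p : ℝ} (hp : 1 ≤ p) (x d : ℝ) :
    0 ≤ |x + d| ^ p + |x - d| ^ p - |x| ^ p - |x| ^ p := by
  have h1 : |x| ≤ (1 / 2 : ℝ) * |x + d| + (1 / 2 : ℝ) * |x - d| := by
    have := abs_add_le (x + d) (x - d)
    rw [show x + d + (x - d) = 2 * x by ring, abs_mul, abs_two] at this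
    linarith
  have h2 := (convexOn_rpow hp).2 (mem_Ici.2 (abs_nonneg (x + d))) (mem_Ici.2 (abs_nonneg (x - d)))
    (by norm_num : (0 : ℝ) ≤ 1 / 2) (by norm_num : (0 : ℝ) ≤ 1 / 2) (by norm_num)
  simp only [smul_eq_mul] at h2
  have h3 := Real.rpow_le_rpow (abs_nonneg x) h1 (by linarith : 0 ≤ p)
  linarith

/-- Quadratic forms with nonnegative symmetric coefficients are controlled by row sums. -/
theorem sum_mul_mul_le_of_row_sum {ι : Type*} (I : Finset ι) (w : ι → ℝ) (r : ι → ι → ℝ) {R : ℝ}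
    (h0 : ∀ i ∈ I, ∀ j ∈ I, 0 ≤ r i j) (hsymm : ∀ i j, r i j = r j i)
    (hrow : ∀ i ∈ I, ∑ j ∈ I, r i j ≤ R) :
    ∑ i ∈ I, ∑ j ∈ I, w i * w j * r i j ≤ R * ∑ i ∈ I, w i ^ 2 := by
  have h1 : ∑ i ∈ I, ∑ j ∈ I, w i ^ 2 * r i j ≤ R * ∑ i ∈ I, w i ^ 2 := by
    rw [Finset.mul_sum]
    refine Finset.sum_le_sum fun i hi => ?_
    rw [← Finset.mul_sum, mul_comm]
    exact mul_le_mul_of_nonneg_right (hrow i hi) (sq_nonneg _)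
  have h2 : ∑ i ∈ I, ∑ j ∈ I, w j ^ 2 * r i j = ∑ i ∈ I, ∑ j ∈ I, w i ^ 2 * r i j := by
    rw [Finset.sum_comm]
    exact Finset.sum_congr rfl fun i _ => Finset.sum_congr rfl fun j _ => by rw [hsymm]
  have h3 : ∑ i ∈ I, ∑ j ∈ I, w i * w j * r i j ≤
      ∑ i ∈ I, ∑ j ∈ I, (1 / 2 * (w i ^ 2 * r i j) + 1 / 2 * (w j ^ 2 * r i j)) := by
    refine Finset.sum_le_sum fun i hi => Finset.sum_le_sum fun j hj => ?_
    nlinarith [mul_nonneg (sq_nonneg (w i - w j)) (h0 i hi j hj)]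
  have h4 : ∑ i ∈ I, ∑ j ∈ I, (1 / 2 * (w i ^ 2 * r i j) + 1 / 2 * (w j ^ 2 * r i j)) =
      1 / 2 * ∑ i ∈ I, ∑ j ∈ I, w i ^ 2 * r i j + 1 / 2 * ∑ i ∈ I, ∑ j ∈ I, w j ^ 2 * r i j := by
    simp only [Finset.sum_add_distrib, Finset.mul_sum]
  linarith

theorem obsTime_nonneg (n k : ℕ) : 0 ≤ obsTime n k := by rw [obsTime]; positivity

theorem obsTime_sub_pred (n : ℕ) {k : ℕ} (hk : 1 ≤ k) :
    obsTime n (k - 1) = obsTime n k - 1 / 2 ^ n := by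
  rw [obsTime, obsTime, Nat.cast_sub hk]; push_cast; ring

theorem obsTime_pos (n : ℕ) {k : ℕ} (hk : 1 ≤ k) : 0 < obsTime n k := by
  have : (0 : ℝ) < k := by exact_mod_cast hk
  rw [obsTime]; positivity

theorem obsTime_succ (n k : ℕ) : obsTime n (k + 1) = obsTime n k + 1 / 2 ^ n := by
  rw [obsTime, obsTime]; push_cast; ring

theorem obsTime_le (n : ℕ) {k : ℕ} (hk : k ≤ 2 ^ (2 * n)) : obsTime n k ≤ 2 ^ n := by
  rw [obsTime, div_le_iff₀ (by positivity), ← pow_add, ← two_mul]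
  exact_mod_cast hk

theorem obsTime_add_le (n : ℕ) {k : ℕ} (hk : k ≤ 2 ^ (2 * n) - 1) :
    obsTime n k + 1 / 2 ^ n ≤ 2 ^ n := by
  have h := Nat.one_le_two_pow (n := 2 * n)
  rw [← obsTime_succ]
  exact obsTime_le n (by omega)

theorem obsTime_last (n : ℕ) : obsTime n (2 ^ (2 * n) - 1 + 1) = 2 ^ n := by
  rw [Nat.sub_add_cancel Nat.one_le_two_pow, obsTime, two_mul, pow_add]
  push_cast
  field_simp

theorem obsTime_sub_pred_eq (n : ℕ) {k : ℕ} (hk : 1 ≤ k) :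
    obsTime n k - obsTime n (k - 1) = 1 / 2 ^ n := by
  rw [obsTime_sub_pred n hk]; ring

theorem sum_obsTime_rpow_le {q : ℝ} (hq0 : -1 < q) (hq : q ≤ 0) (n : ℕ) :
    ∑ k ∈ Finset.Icc 1 (2 ^ (2 * n) - 1), obsTime n k ^ q * (1 / 2 ^ n) ≤
      ((2 : ℝ) ^ n) ^ (q + 1) / (q + 1) := by
  have hq1 : 0 < q + 1 := by linarith
  calc _ ≤ ∑ k ∈ Finset.Icc 1 (2 ^ (2 * n) - 1), (obsTime n k ^ (q + 1) / (q + 1) -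
        obsTime n (k - 1) ^ (q + 1) / (q + 1)) := by
        refine Finset.sum_le_sum fun k hk => ?_
        obtain ⟨h1, h2⟩ := Finset.mem_Icc.1 hk
        have := mul_rpow_le_rpow_sub hq0 hq (d := 1 / 2 ^ n) (obsTime_pos n h1)
          (by have := obsTime_nonneg n (k - 1); rw [obsTime_sub_pred n h1] at this; linarith)
        rwa [← obsTime_sub_pred n h1, sub_div] at this
    _ = _ := sum_Icc_sub_pred (fun k => obsTime n k ^ (q + 1) / (q + 1)) _
    _ ≤ _ := by
        rw [show obsTime n 0 = 0 by simp [obsTime], Real.zero_rpow hq1.ne', zero_div, sub_zero]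
        have := obsTime_nonneg n (2 ^ (2 * n) - 1)
        have := obsTime_le n (Nat.sub_le (2 ^ (2 * n)) 1)
        gcongr

theorem sum_sub_obsTime_rpow_le {q : ℝ} (hq0 : -1 < q) (hq : q ≤ 0) (n : ℕ) :
    ∑ k ∈ Finset.Icc 1 (2 ^ (2 * n) - 1), (2 ^ n - obsTime n k) ^ q * (1 / 2 ^ n) ≤
      ((2 : ℝ) ^ n) ^ (q + 1) / (q + 1) := by
  have hq1 : 0 < q + 1 := by linarith
  have hd : (0 : ℝ) < 1 / 2 ^ n := by positivity
  -- Stepping left from 2^n - t_k leads to 2^n - t_{k+1}, so the telescoping sequence is shifted by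
  -- one index and ends at the point 2^n, where the power vanishes.
  calc _ ≤ ∑ k ∈ Finset.Icc 1 (2 ^ (2 * n) - 1), (-((2 ^ n - obsTime n (k + 1)) ^ (q + 1) / (q + 1)) -
        -((2 ^ n - obsTime n (k - 1 + 1)) ^ (q + 1) / (q + 1))) := by
        refine Finset.sum_le_sum fun k hk => ?_
        obtain ⟨h1, h2⟩ := Finset.mem_Icc.1 hk
        have h3 := obsTime_add_le n h2
        have := mul_rpow_le_rpow_sub hq0 hq (x := 2 ^ n - obsTime n k) (d := 1 / 2 ^ n)
          (by linarith) (by linarith)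
        rw [Nat.sub_add_cancel h1, obsTime_succ, ← sub_sub]
        refine this.trans (le_of_eq ?_)
        ring
    _ = _ := sum_Icc_sub_pred (fun k => -((2 ^ n - obsTime n (k + 1)) ^ (q + 1) / (q + 1))) _
    _ ≤ _ := by
        rw [obsTime_last, sub_self, Real.zero_rpow hq1.ne', zero_div, neg_zero, zero_sub, neg_neg]
        have h1 := obsTime_nonneg n (0 + 1)
        have h2 := obsTime_le n (k := 0 + 1) (by simpa using Nat.one_le_two_pow)
        gcongr
        linarith

/-- The larger of t and u is at least their mean, so its power is at most that of the mean. This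
separates the singularities of the squared weight at the two ends of [0, 2^n]. -/
theorem mul_rpow_neg_le {q t u : ℝ} (hq : q ≤ 0) (ht : 0 < t) (hu : 0 < u) :
    t ^ q * u ^ q ≤ ((t + u) / 2) ^ q * (t ^ q + u ^ q) := by
  have h1 : 0 ≤ t ^ q := by positivity
  have h2 : 0 ≤ u ^ q := by positivity
  have h3 : 0 ≤ ((t + u) / 2) ^ q := by positivity
  rcases le_total t u with h | h
  · have : u ^ q ≤ ((t + u) / 2) ^ q :=
      Real.rpow_le_rpow_of_nonpos (by linarith) (by linarith) hq
    nlinarith [mul_nonneg h3 h2]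
  · have : t ^ q ≤ ((t + u) / 2) ^ q :=
      Real.rpow_le_rpow_of_nonpos (by linarith) (by linarith) hq
    nlinarith [mul_nonneg h3 h1]

theorem sum_obsWeight_sq_le {H : ℝ} (hH : H ∈ Ioo (1 / 2 : ℝ) 1) (n : ℕ) :
    (∑ k ∈ Finset.Icc 1 (2 ^ (2 * n) - 1), obsWeight H n k ^ 2) * (1 / 2 ^ n) ≤
      2 ^ (2 * H) / (2 - 2 * H) * ((2 : ℝ) ^ n) ^ (3 - 4 * H) := by
  obtain ⟨h1, h2⟩ := hH
  set q : ℝ := 1 - 2 * H with hq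
  have hT : (0 : ℝ) < 2 ^ n := by positivity
  rw [Finset.sum_mul]
  calc _ ≤ ∑ k ∈ Finset.Icc 1 (2 ^ (2 * n) - 1), ((2 : ℝ) ^ n / 2) ^ q *
        (obsTime n k ^ q * (1 / 2 ^ n) + (2 ^ n - obsTime n k) ^ q * (1 / 2 ^ n)) := by
        refine Finset.sum_le_sum fun k hk => ?_
        obtain ⟨hk1, hk2⟩ := Finset.mem_Icc.1 hk
        have hd : (0 : ℝ) < 1 / 2 ^ n := by positivity
        have ht := obsTime_pos n hk1
        have hu : 0 < 2 ^ n - obsTime n k := by linarith [obsTime_add_le n hk2]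
        have := mul_rpow_neg_le (q := q) (by linarith) ht hu
        rw [add_sub_cancel] at this
        have e : obsWeight H n k ^ 2 = obsTime n k ^ q * (2 ^ n - obsTime n k) ^ q := by
          rw [obsWeight, mul_pow, ← Real.rpow_mul_natCast ht.le, ← Real.rpow_mul_natCast hu.le]
          congr 2 <;> (push_cast; ring)
        rw [e, ← add_mul, ← mul_assoc]
        gcongr
    _ ≤ ((2 : ℝ) ^ n / 2) ^ q * (((2 : ℝ) ^ n) ^ (q + 1) / (q + 1) +
        ((2 : ℝ) ^ n) ^ (q + 1) / (q + 1)) := by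
        rw [← Finset.mul_sum, Finset.sum_add_distrib]
        gcongr
        · exact sum_obsTime_rpow_le (by linarith) (by linarith) n
        · exact sum_sub_obsTime_rpow_le (by linarith) (by linarith) n
    _ = 2 ^ (2 * H) / (2 - 2 * H) * (((2 : ℝ) ^ n) ^ q * ((2 : ℝ) ^ n) ^ (q + 1)) := by
        clear_value q
        rw [Real.div_rpow hT.le zero_le_two, show 2 * H = 1 - q by rw [hq]; ring,
          Real.rpow_sub two_pos, Real.rpow_one]
        have : q + 1 ≠ 0 := by linarith
        rw [show 2 - (1 - q) = q + 1 by ring]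
        field_simp
        ring
    _ = _ := by
        rw [← Real.rpow_add hT]
        congr 2
        rw [hq]; ring

/-- The martingale-like part of the drift estimator. -/
noncomputable def weightedNoise (H : ℝ) (n : ℕ) (g : ℝ → ℝ) : ℝ :=
  ∑ k ∈ Finset.Icc 1 (2 ^ (2 * n) - 1),
    obsWeight H n k * (g (obsTime n k) - g (obsTime n (k - 1)))

section FractionalBrownianMotion

variable {Ω : Type*} [MeasurableSpace Ω] {P : Measure Ω} {H : ℝ} {B : ℝ → Ω → ℝ}

/-- The covariance matrix of the increments has nonnegative entries, so its quadratic form is at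
most the largest row sum times the sum of squared weights. With T = 2^n and mesh d, a row sum is at
most 2H d T^{2H-1}, the squared weights times d sum to order T^{3-4H}, and the product is of order
T^{2-2H}. -/
theorem IsFractionalBrownianMotion.integral_weightedNoise_sq_le
    (hB : IsFractionalBrownianMotion P H B) (hH : H ∈ Ioo (1 / 2 : ℝ) 1) (n : ℕ) :
    ∫ ω, weightedNoise H n (fun t => B t ω) * weightedNoise H n (fun t => B t ω) ∂P ≤
      2 * H * (2 ^ (2 * H) / (2 - 2 * H)) * ((2 : ℝ) ^ n) ^ (2 - 2 * H) := by
  have hT : (0 : ℝ) < 2 ^ n := by positivity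
  have hp : 1 ≤ 2 * H := by linarith [hH.1]
  set d : ℝ := 1 / 2 ^ n with hd
  have hd0 : 0 < d := by positivity
  simp only [weightedNoise]
  rw [hB.integral_sum_mul_self _ (obsWeight H n) (fun k => obsTime n (k - 1)) (obsTime n)
    (fun k => obsTime_nonneg n _) (fun k => obsTime_nonneg n _)]
  have hrow := sum_mul_mul_le_of_row_sum (Finset.Icc 1 (2 ^ (2 * n) - 1)) (obsWeight H n)
    (fun i j => ∫ ω, (B (obsTime n i) ω - B (obsTime n (i - 1)) ω) *
      (B (obsTime n j) ω - B (obsTime n (j - 1)) ω) ∂P)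
    (R := 2 * H * d * ((2 : ℝ) ^ n) ^ (2 * H - 1)) ?_ ?_ ?_
  · refine hrow.trans ?_
    have := sum_obsWeight_sq_le hH n
    calc _ = 2 * H * ((2 : ℝ) ^ n) ^ (2 * H - 1) *
          ((∑ k ∈ Finset.Icc 1 (2 ^ (2 * n) - 1), obsWeight H n k ^ 2) * (1 / 2 ^ n)) := by
          rw [hd]; ring
      _ ≤ 2 * H * ((2 : ℝ) ^ n) ^ (2 * H - 1) *
          (2 ^ (2 * H) / (2 - 2 * H) * ((2 : ℝ) ^ n) ^ (3 - 4 * H)) := by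
          have := hH.1
          gcongr
      _ = 2 * H * (2 ^ (2 * H) / (2 - 2 * H)) *
          (((2 : ℝ) ^ n) ^ (2 * H - 1) * ((2 : ℝ) ^ n) ^ (3 - 4 * H)) := by ring
      _ = _ := by
          rw [← Real.rpow_add hT]
          congr 2; ring
  · intro i hi j hj
    rw [hB.increment_covariance (obsTime_nonneg _ _) (obsTime_nonneg _ _) (obsTime_nonneg _ _)
      (obsTime_nonneg _ _), obsTime_sub_pred n (Finset.mem_Icc.1 hi).1,
      obsTime_sub_pred n (Finset.mem_Icc.1 hj).1]
    refine div_nonneg ?_ zero_le_two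
    have := abs_rpow_second_difference_nonneg hp (obsTime n i - obsTime n j) d
    rw [show obsTime n i - (obsTime n j - 1 / 2 ^ n) = obsTime n i - obsTime n j + d by
        rw [hd]; ring,
      show obsTime n i - 1 / 2 ^ n - obsTime n j = obsTime n i - obsTime n j - d by
        rw [hd]; ring,
      show obsTime n i - 1 / 2 ^ n - (obsTime n j - 1 / 2 ^ n) = obsTime n i - obsTime n j by ring]
    exact this
  · intro i j
    simp_rw [mul_comm]
  · intro i hi
    obtain ⟨hi1, hi2⟩ := Finset.mem_Icc.1 hi
    simp_rw [fun j => hB.increment_covariance (obsTime_nonneg n (i - 1)) (obsTime_nonneg n i)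
      (obsTime_nonneg n (j - 1)) (obsTime_nonneg n j)]
    -- A row sum is the covariance of one increment with the increment of B over the whole grid. It
    -- reduces to two one-step differences of y^{2H}, one on each side of the cell.
    have htel := sum_Icc_sub_pred (fun j => (|obsTime n (i - 1) - obsTime n j| ^ (2 * H) -
      |obsTime n i - obsTime n j| ^ (2 * H)) / 2) (2 ^ (2 * n) - 1)
    have hle : ∀ y, d ≤ y → y ≤ 2 ^ n → y ^ (2 * H) - (y - d) ^ (2 * H) ≤
        2 * H * d * ((2 : ℝ) ^ n) ^ (2 * H - 1) := by
      intro y hy1 hy2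
      refine (rpow_sub_rpow_le hp hd0.le hy1).trans ?_
      have : 0 ≤ 2 * H * d := by positivity
      have : 0 ≤ y := hd0.le.trans hy1
      have : 0 ≤ 2 * H - 1 := by linarith
      gcongr
    calc _ = _ := Finset.sum_congr rfl fun j _ => by ring
      _ = _ := htel
      _ ≤ _ := ?_
    have h0 : obsTime n 0 = 0 := by simp [obsTime]
    have hi3 := obsTime_nonneg n (i - 1)
    have hpred := obsTime_sub_pred n hi1
    have hlast : obsTime n i ≤ obsTime n (2 ^ (2 * n) - 1) := by
      rw [obsTime, obsTime]
      gcongr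
    have hend := obsTime_le n (Nat.sub_le (2 ^ (2 * n)) 1)
    have b1 := hle (obsTime n i) (by linarith) (by linarith)
    have b2 := hle (obsTime n (2 ^ (2 * n) - 1) - obsTime n (i - 1)) (by linarith) (by linarith)
    rw [h0, sub_zero, sub_zero, abs_of_nonneg hi3, abs_of_nonneg (obsTime_nonneg n i),
      abs_of_nonpos (by linarith : obsTime n (i - 1) - obsTime n (2 ^ (2 * n) - 1) ≤ 0),
      abs_of_nonpos (by linarith : obsTime n i - obsTime n (2 ^ (2 * n) - 1) ≤ 0)]
    rw [show obsTime n i - d = obsTime n (i - 1) by rw [hpred]] at b1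
    rw [show obsTime n (2 ^ (2 * n) - 1) - obsTime n (i - 1) - d =
      -(obsTime n i - obsTime n (2 ^ (2 * n) - 1)) by rw [hpred]; ring,
      ← neg_sub (obsTime n (i - 1))] at b2
    linarith

end FractionalBrownianMotion

/-! ### One random variable controlling Hölder constants and noise -/

theorem lintegral_exp_sq_div_le {Ω : Type*} [MeasurableSpace Ω] {P : Measure Ω} {Y : Ω → ℝ} {c : ℝ}
    (hY : HasGaussianLaw Y P) (h0 : ∫ ω, Y ω ∂P = 0) (hc : 0 < c)
    (h1 : ∫ ω, Y ω * Y ω ∂P ≤ c ^ 2) :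
    ∫⁻ ω, ENNReal.ofReal (Real.exp ((c⁻¹ * Y ω) ^ 2 / 4)) ∂P ≤ 2 := by
  refine lintegral_exp_sq_le_of_hasGaussianLaw (hY.fun_smul c⁻¹) ?_ ?_
  · simp [integral_const_mul, h0]
  · have e : ∀ ω, c⁻¹ • Y ω * c⁻¹ • Y ω = (c ^ 2)⁻¹ * (Y ω * Y ω) := fun ω => by
      simp only [smul_eq_mul]; field_simp
    refine (le_of_eq (integral_congr_ae (Eventually.of_forall e))).trans ?_
    rw [integral_const_mul, inv_mul_le_iff₀ (by positivity), mul_one]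
    exact h1

/-- Used with r = 2^{-(H-β)}: the gap between H and β pays for the linear growth in the dyadic
level. -/
theorem exists_forall_add_one_mul_pow_le {r : ℝ} (h0 : 0 ≤ r) (h1 : r < 1) :
    ∃ D : ℝ, 1 ≤ D ∧ ∀ m : ℕ, (m + 1) * r ^ m ≤ D := by
  have h := (tendsto_self_mul_const_pow_of_lt_one h0 h1).add
    (tendsto_pow_atTop_nhds_zero_of_lt_one h0 h1)
  obtain ⟨D, hD⟩ := h.bddAbove_range
  refine ⟨max D 1, le_max_right _ _, fun m => le_max_of_le_left ?_⟩
  have := hD (mem_range_self m)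
  rw [add_mul, one_mul]
  exact this

/-- The logarithmic weights attached to the dyadic increments and to the weighted sums. -/
noncomputable def chainingWeight : (ℕ × ℕ) ⊕ ℕ → ℝ :=
  Sum.elim (fun p => 1 + 2 * Real.log (p.2 + 1) + p.1) (fun n => 1 + n)

theorem one_le_chainingWeight (i : (ℕ × ℕ) ⊕ ℕ) : 1 ≤ chainingWeight i := by
  rcases i with ⟨m, j⟩ | n
  · have : 0 ≤ Real.log ((j : ℝ) + 1) := Real.log_nonneg (by linarith [Nat.cast_nonneg (α := ℝ) j])
    simp only [chainingWeight, Sum.elim_inl]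
    linarith [Nat.cast_nonneg (α := ℝ) m]
  · simp [chainingWeight]

theorem summable_exp_neg_chainingWeight : Summable fun i => Real.exp (-chainingWeight i) := by
  have he : Summable fun n : ℕ => Real.exp (-1) * Real.exp (-(n : ℝ)) :=
    Real.summable_exp_neg_nat.mul_left _
  refine Summable.sum _ ?_ ?_
  · have hj : Summable fun j : ℕ => 1 / ((j : ℝ) + 1) ^ 2 := by
      have := (summable_nat_add_iff 1).2 (Real.summable_one_div_nat_pow.2 one_lt_two)
      simpa using this
    refine (he.mul_of_nonneg hj (fun n => by positivity) fun n => by positivity).congr ?_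
    rintro ⟨m, j⟩
    have hp : (0 : ℝ) < j + 1 := by positivity
    simp only [Function.comp, chainingWeight, Sum.elim_inl]
    rw [show -(1 + 2 * Real.log ((j : ℝ) + 1) + m) = -1 + -(m : ℝ) + -(2 * Real.log (j + 1)) by ring,
      Real.exp_add, Real.exp_add, Real.exp_neg (2 * _), two_mul, Real.exp_add, Real.exp_log hp,
      one_div, sq]
  · refine he.congr fun n => ?_
    simp only [Function.comp, chainingWeight, Sum.elim_inr]
    rw [← Real.exp_add]
    congr 1; ring

/-- Inside [0, 2^n] the position j at level m is below 2^{n+m}, so the logarithmic weight is linear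
in n+m. The growth in n is therefore only √n, which is below n^γ. -/
theorem sqrt_chainingWeight_inl_le {n m j : ℕ} (hn : 1 ≤ n) (hj : j + 1 ≤ 2 ^ (n + m)) :
    √(chainingWeight (Sum.inl (m, j))) ≤ 3 * √n * (m + 1) := by
  have hn' : (1 : ℝ) ≤ n := by exact_mod_cast hn
  have hm : (0 : ℝ) ≤ m := Nat.cast_nonneg m
  have hlog : Real.log ((j : ℝ) + 1) ≤ n + m := by
    have h1 : Real.log ((j : ℝ) + 1) ≤ Real.log (2 ^ (n + m)) :=
      Real.log_le_log (by positivity) (by exact_mod_cast hj)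
    rw [Real.log_pow] at h1
    push_cast at h1
    have h2 : ((n : ℝ) + m) * Real.log 2 ≤ ((n : ℝ) + m) * 1 := by
      have := Real.log_two_lt_d9
      gcongr
      linarith
    linarith
  refine Real.sqrt_le_iff.2 ⟨by positivity, ?_⟩
  rw [mul_pow, mul_pow, Real.sq_sqrt (by positivity)]
  simp only [chainingWeight, Sum.elim_inl]
  nlinarith [mul_nonneg (by linarith : (0 : ℝ) ≤ n - 1) hm,
    mul_nonneg (by linarith : (0 : ℝ) ≤ n) (mul_nonneg hm hm)]

theorem sqrt_chainingWeight_inr_le {n : ℕ} (hn : 1 ≤ n) :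
    √(chainingWeight (Sum.inr n)) ≤ 2 * √n := by
  have hn' : (1 : ℝ) ≤ n := by exact_mod_cast hn
  refine Real.sqrt_le_iff.2 ⟨by positivity, ?_⟩
  rw [mul_pow, Real.sq_sqrt (by positivity)]
  simp only [chainingWeight, Sum.elim_inr]
  linarith

section FractionalBrownianMotion

variable {Ω : Type*} [MeasurableSpace Ω] {P : Measure Ω} {H : ℝ} {B : ℝ → Ω → ℝ}

theorem IsFractionalBrownianMotion.lintegral_exp_sq_increment_le
    (hB : IsFractionalBrownianMotion P H B) (hH : 0 < H) (m j : ℕ) :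
    HasGaussianLaw (fun ω => B ((j + 1 : ℕ) / 2 ^ m) ω - B (j / 2 ^ m) ω) P ∧
    ∫⁻ ω, ENNReal.ofReal (Real.exp (((((1 / 2 : ℝ) ^ H) ^ m)⁻¹ *
      (B ((j + 1 : ℕ) / 2 ^ m) ω - B (j / 2 ^ m) ω)) ^ 2 / 4)) ∂P ≤ 2 := by
  have h0 : (0 : ℝ) ≤ j / 2 ^ m := by positivity
  have h1 : (0 : ℝ) ≤ (j + 1 : ℕ) / 2 ^ m := by positivity
  have hg := hB.hasGaussianLaw_sum (Finset.univ : Finset Unit) (fun _ => 1) (fun _ => j / 2 ^ m)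
    (fun _ => (j + 1 : ℕ) / 2 ^ m) (fun _ => h0) (fun _ => h1)
  have hi := hB.integral_sum (Finset.univ : Finset Unit) (fun _ => 1) (fun _ => j / 2 ^ m)
    (fun _ => (j + 1 : ℕ) / 2 ^ m) (fun _ => h0) (fun _ => h1)
  simp only [Finset.univ_unique, Finset.sum_singleton, one_mul] at hg hi
  refine ⟨hg, lintegral_exp_sq_div_le hg hi (by positivity) ?_⟩
  rw [hB.increment_covariance h0 h1 h0 h1]
  have e : ((j + 1 : ℕ) : ℝ) / 2 ^ m - j / 2 ^ m = (1 / 2) ^ m := by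
    push_cast; rw [one_div, inv_pow]; field_simp; ring
  have e2 : ((((1 / 2 : ℝ) ^ H) ^ m)) ^ 2 = ((1 / 2 : ℝ) ^ m) ^ (2 * H) := by
    rw [← Real.rpow_mul_natCast (by norm_num), ← Real.rpow_mul_natCast (by norm_num),
      ← Real.rpow_natCast_mul (by norm_num)]
    congr 1; push_cast; ring
  rw [abs_sub_comm (_ / _ : ℝ) ((j + 1 : ℕ) / 2 ^ m : ℝ), e, e2,
    abs_of_nonneg (by positivity : (0 : ℝ) ≤ (1 / 2) ^ m)]
  simp [Real.zero_rpow (by linarith : 2 * H ≠ 0)]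

/-- The constant in the variance bound of the weighted sums. -/
noncomputable def noiseVarConst (H : ℝ) : ℝ := 2 * H * (2 ^ (2 * H) / (2 - 2 * H))

theorem noiseVarConst_pos {H : ℝ} (hH : H ∈ Ioo (1 / 2 : ℝ) 1) : 0 < noiseVarConst H := by
  have h1 : 0 < 2 - 2 * H := by linarith [hH.2]
  have h2 : 0 < H := by linarith [hH.1]
  rw [noiseVarConst]; positivity

theorem IsFractionalBrownianMotion.lintegral_exp_sq_weightedNoise_le
    (hB : IsFractionalBrownianMotion P H B) (hH : H ∈ Ioo (1 / 2 : ℝ) 1) (n : ℕ) :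
    HasGaussianLaw (fun ω => weightedNoise H n (fun t => B t ω)) P ∧
    ∫⁻ ω, ENNReal.ofReal (Real.exp (((√(noiseVarConst H) * ((2 : ℝ) ^ n) ^ (1 - H))⁻¹ *
      weightedNoise H n (fun t => B t ω)) ^ 2 / 4)) ∂P ≤ 2 := by
  have hV := noiseVarConst_pos hH
  have hg : HasGaussianLaw (fun ω => weightedNoise H n (fun t => B t ω)) P :=
    hB.hasGaussianLaw_sum _ (obsWeight H n) (fun k => obsTime n (k - 1)) (obsTime n)
      (fun k => obsTime_nonneg n _) (fun k => obsTime_nonneg n _)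
  refine ⟨hg, lintegral_exp_sq_div_le hg (hB.integral_sum _ (obsWeight H n)
    (fun k => obsTime n (k - 1)) (obsTime n) (fun k => obsTime_nonneg n _)
    (fun k => obsTime_nonneg n _)) (by positivity) ?_⟩
  refine (hB.integral_weightedNoise_sq_le hH n).trans (le_of_eq ?_)
  rw [mul_pow, Real.sq_sqrt hV.le, ← Real.rpow_mul_natCast (by positivity), noiseVarConst]
  congr 2; push_cast; ring

/-- The Hölder constants of a fractional Brownian motion on `[0, 2 ^ n]` and the weighted sums are
controlled by one random variable with all moments. -/
theorem IsFractionalBrownianMotion.exists_moment_bound [IsProbabilityMeasure P]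
    (hB : IsFractionalBrownianMotion P H B) (hH : H ∈ Ioo (1 / 2 : ℝ) 1) {β γ : ℝ} (hβ0 : 0 < β)
    (hβ : β < H) (hγ : 1 / 2 < γ) :
    ∃ C : ℝ, 1 ≤ C ∧ ∃ ζ : Ω → ℝ, Measurable ζ ∧ (∀ ω, 1 ≤ ζ ω) ∧
      (∀ m : ℕ, Integrable (fun ω => ζ ω ^ m) P) ∧ ∀ᵐ ω ∂P, ∀ n : ℕ, 1 ≤ n →
        (∀ u v, 0 ≤ u → u ≤ v → v ≤ 2 ^ n → v - u ≤ 1 →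
          |B v ω - B u ω| ≤ C * ζ ω * (n : ℝ) ^ γ * (v - u) ^ β) ∧
        |weightedNoise H n (fun t => B t ω)| ≤ C * ζ ω * (n : ℝ) ^ γ * ((2 : ℝ) ^ n) ^ (1 - H) := by
  have hH0 : 0 < H := by linarith [hH.1]
  have hV := noiseVarConst_pos hH
  set G : (ℕ × ℕ) ⊕ ℕ → Ω → ℝ := Sum.elim
    (fun p ω => (((1 / 2 : ℝ) ^ H) ^ p.1)⁻¹ * (B ((p.2 + 1 : ℕ) / 2 ^ p.1) ω - B (p.2 / 2 ^ p.1) ω))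
    (fun n ω => (√(noiseVarConst H) * ((2 : ℝ) ^ n) ^ (1 - H))⁻¹ *
      weightedNoise H n (fun t => B t ω)) with hG
  have hGm : ∀ i, AEMeasurable (G i) P := by
    rintro (⟨m, j⟩ | n)
    · exact (hB.lintegral_exp_sq_increment_le hH0 m j).1.aemeasurable.const_mul _
    · exact (hB.lintegral_exp_sq_weightedNoise_le hH n).1.aemeasurable.const_mul _
  have hGe : ∀ i, ∫⁻ ω, ENNReal.ofReal (Real.exp (G i ω ^ 2 / 4)) ∂P ≤ 2 := by
    rintro (⟨m, j⟩ | n)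
    · exact (hB.lintegral_exp_sq_increment_le hH0 m j).2
    · exact (hB.lintegral_exp_sq_weightedNoise_le hH n).2
  obtain ⟨ζ, hζm, hζ1, hζi, hζ⟩ := exists_dominating_of_exp_sq hGm hGe one_le_chainingWeight
    summable_exp_neg_chainingWeight
  obtain ⟨D, hD1, hD⟩ := exists_forall_add_one_mul_pow_le (r := (1 / 2 : ℝ) ^ (H - β))
    (by positivity) (half_rpow_lt_one (by linarith))
  have hcc := one_le_chainingConst hβ0
  refine ⟨chainingConst β * (3 * D) + 2 * √(noiseVarConst H), ?_, ζ, hζm, hζ1, hζi, ?_⟩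
  · have := Real.sqrt_nonneg (noiseVarConst H)
    nlinarith
  filter_upwards [hζ, hB.continuous_paths] with ω hω hcont n hn
  have hz := hζ1 ω
  have hn' : (1 : ℝ) ≤ n := by exact_mod_cast hn
  have hsq : √(n : ℝ) ≤ (n : ℝ) ^ γ := by
    rw [Real.sqrt_eq_rpow]
    exact Real.rpow_le_rpow_of_exponent_le hn' hγ.le
  have hnγ : 0 ≤ (n : ℝ) ^ γ := by positivity
  have hsV := Real.sqrt_nonneg (noiseVarConst H)
  constructor
  · intro u v hu huv hv h1
    refine (abs_sub_le_of_dyadic (n := n) (Λ := 3 * D * ζ ω * (n : ℝ) ^ γ) hβ0 hcont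
      (by positivity) (fun m j hj => ?_) hu huv hv h1).trans ?_
    · have h2 := hω (Sum.inl (m, j))
      simp only [hG, Sum.elim_inl] at h2
      have hq : 0 < ((1 / 2 : ℝ) ^ H) ^ m := by positivity
      rw [abs_mul, abs_of_pos (inv_pos.2 hq), inv_mul_le_iff₀ hq] at h2
      have h3 := sqrt_chainingWeight_inl_le hn hj
      -- The standard deviation 2^{-mH} is split: 2^{-m(H-β)} absorbs the factor m+1 and 2^{-mβ}
      -- remains for chaining.
      have h4 : ((1 / 2 : ℝ) ^ H) ^ m = ((1 / 2 : ℝ) ^ (H - β)) ^ m * ((1 / 2 : ℝ) ^ β) ^ m := by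
        rw [← mul_pow, ← Real.rpow_add (by norm_num), sub_add_cancel]
      calc _ ≤ ((1 / 2 : ℝ) ^ H) ^ m * (ζ ω * (3 * √n * (m + 1))) := by
            refine h2.trans ?_
            gcongr
        _ ≤ ((1 / 2 : ℝ) ^ H) ^ m * (ζ ω * (3 * (n : ℝ) ^ γ * (m + 1))) := by gcongr
        _ = 3 * ζ ω * (n : ℝ) ^ γ * ((m + 1) * ((1 / 2 : ℝ) ^ (H - β)) ^ m) *
            ((1 / 2 : ℝ) ^ β) ^ m := by rw [h4]; ring
        _ ≤ 3 * ζ ω * (n : ℝ) ^ γ * D * ((1 / 2 : ℝ) ^ β) ^ m := by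
            gcongr
            exact hD m
        _ = _ := by ring
    · have : 0 ≤ (v - u) ^ β := Real.rpow_nonneg (sub_nonneg.2 huv) _
      calc _ = chainingConst β * (3 * D) * ζ ω * (n : ℝ) ^ γ * (v - u) ^ β := by ring
        _ ≤ _ := by
          gcongr
          linarith
  · have h2 := hω (Sum.inr n)
    simp only [hG, Sum.elim_inr] at h2
    have hT : 0 < ((2 : ℝ) ^ n) ^ (1 - H) := by positivity
    have hq : 0 < √(noiseVarConst H) * ((2 : ℝ) ^ n) ^ (1 - H) :=
      mul_pos (Real.sqrt_pos.2 hV) hT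
    rw [abs_mul, abs_of_pos (inv_pos.2 hq), inv_mul_le_iff₀ hq] at h2
    calc _ ≤ √(noiseVarConst H) * ((2 : ℝ) ^ n) ^ (1 - H) * (ζ ω * (2 * (n : ℝ) ^ γ)) := by
          refine h2.trans ?_
          gcongr
          exact (sqrt_chainingWeight_inr_le hn).trans (by gcongr)
      _ = 2 * √(noiseVarConst H) * ζ ω * (n : ℝ) ^ γ * ((2 : ℝ) ^ n) ^ (1 - H) := by ring
      _ ≤ _ := by
        gcongr
        have : 0 ≤ chainingConst β * (3 * D) := by positivity
        linarith

end FractionalBrownianMotion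

/-! ### Localization to a finite interval -/

theorem leftFracDeriv_congr {α s x : ℝ} {f f' : ℝ → ℝ} (hx : s ≤ x) (hf : EqOn f f' (Icc s x)) :
    leftFracDeriv α s f x = leftFracDeriv α s f' x := by
  unfold leftFracDeriv
  have hxx := hf (right_mem_Icc.2 hx)
  rw [hxx, intervalIntegral.integral_congr (g := fun u => (f' x - f' u) / (x - u) ^ (1 + α))]
  intro u hu
  rw [uIcc_of_le hx] at hu
  simp only [hf hu]

theorem rightFracDeriv_congr {α t x : ℝ} {g g' : ℝ → ℝ} (hx : x ≤ t) (hg : EqOn g g' (Icc x t)) :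
    rightFracDeriv α t g x = rightFracDeriv α t g' x := by
  unfold rightFracDeriv
  have hxx := hg (left_mem_Icc.2 hx)
  rw [hxx, intervalIntegral.integral_congr (g := fun u => (g' x - g' u) / (u - x) ^ (1 + α))]
  intro u hu
  rw [uIcc_of_le hx] at hu
  simp only [hg hu]

theorem glsIntegral_congr {α s t : ℝ} {f f' g g' : ℝ → ℝ} (hst : s ≤ t)
    (hf : EqOn f f' (Icc s t)) (hg : EqOn g g' (Icc s t)) :
    glsIntegral α s t f g = glsIntegral α s t f' g' := by
  unfold glsIntegral
  rw [neg_inj]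
  refine intervalIntegral.integral_congr fun x hx => ?_
  rw [uIcc_of_le hst] at hx
  have h1 := leftFracDeriv_congr (α := α) hx.1 (hf.mono (Icc_subset_Icc_right hx.2))
  have h2 := rightFracDeriv_congr (α := 1 - α) (g := fun y => g y - g t) (g' := fun y => g' y - g' t)
    hx.2 fun y hy => by
      have hy' : y ∈ Icc s t := Icc_subset_Icc_left hx.1 hy
      simp only [hg hy', hg (right_mem_Icc.2 hst)]
  simp only [h1, h2]

/-- The projection of the real line onto `[0, T]`. -/
def clampTo (T u : ℝ) : ℝ := max 0 (min u T)

section Clamp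

variable {T : ℝ}

theorem clampTo_of_mem {u : ℝ} (hu : u ∈ Icc 0 T) : clampTo T u = u := by
  rw [clampTo, min_eq_left hu.2, max_eq_right hu.1]

theorem clampTo_nonneg (u : ℝ) : 0 ≤ clampTo T u := le_max_left _ _

theorem clampTo_le (hT : 0 ≤ T) (u : ℝ) : clampTo T u ≤ T := max_le hT (min_le_right _ _)

theorem continuous_clampTo : Continuous (clampTo T) := by
  unfold clampTo; fun_prop

theorem clampTo_mono {u v : ℝ} (h : u ≤ v) : clampTo T u ≤ clampTo T v := by
  unfold clampTo; gcongr

theorem clampTo_sub_le {u v : ℝ} (h : u ≤ v) : clampTo T v - clampTo T u ≤ v - u := by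
  unfold clampTo
  rcases le_total u T with h1 | h1 <;> rcases le_total v T with h2 | h2 <;>
    rcases max_cases 0 (min u T) with h3 | h3 <;> rcases max_cases 0 (min v T) with h4 | h4 <;>
    simp_all <;> linarith

theorem continuous_comp_clampTo {f : ℝ → ℝ} (hf : ContinuousOn f (Ici 0)) :
    Continuous fun u => f (clampTo T u) :=
  hf.comp_continuous continuous_clampTo fun u => clampTo_nonneg u

/-- When the clamped points are more than one apart, (v-u)^β ≥ 1 and the supremum of |g| on [0, T]
suffices. The resulting Λ' is not quantitative; it only licenses the Steklov approximation. -/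
theorem holder_comp_clampTo {g : ℝ → ℝ} {Λ β : ℝ} (hβ : 0 ≤ β) (hT : 0 ≤ T) (hΛ : 0 ≤ Λ)
    (hg : ContinuousOn g (Ici 0))
    (h : ∀ u v, 0 ≤ u → u ≤ v → v ≤ T → v - u ≤ 1 → |g v - g u| ≤ Λ * (v - u) ^ β) :
    ∃ Λ', 0 ≤ Λ' ∧ ∀ u v, u ≤ v → |g (clampTo T v) - g (clampTo T u)| ≤ Λ' * (v - u) ^ β := by
  obtain ⟨S, hS⟩ := isCompact_Icc.exists_bound_of_continuousOn (hg.mono Icc_subset_Ici_self :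
    ContinuousOn g (Icc 0 T))
  have hS0 : 0 ≤ S := (norm_nonneg _).trans (hS 0 (left_mem_Icc.2 hT))
  refine ⟨Λ + 2 * S, by positivity, fun u v huv => ?_⟩
  have hle := clampTo_sub_le (T := T) huv
  have hmono := clampTo_mono (T := T) huv
  rcases le_total (clampTo T v - clampTo T u) 1 with h1 | h1
  · refine (h _ _ (clampTo_nonneg u) hmono (clampTo_le hT v) h1).trans ?_
    have : 0 ≤ clampTo T v - clampTo T u := sub_nonneg.2 hmono
    gcongr
    linarith
  · have h2 : 1 ≤ (v - u) ^ β := Real.one_le_rpow (by linarith) hβ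
    have h3 := hS _ ⟨clampTo_nonneg v, clampTo_le hT v⟩
    have h4 := hS _ ⟨clampTo_nonneg u, clampTo_le hT u⟩
    rw [Real.norm_eq_abs] at h3 h4
    calc _ ≤ |g (clampTo T v)| + |g (clampTo T u)| := abs_sub _ _
      _ ≤ (Λ + 2 * S) * 1 := by linarith
      _ ≤ _ := by gcongr

end Clamp

/-- A pathwise solution restricted to `[0, T]`, continued by constants. -/
theorem isRoughPathSolution_clampTo {α β x₀ θ K L Λ T : ℝ} {a b x g : ℝ → ℝ} (hα1 : α < 1)
    (hβ : 0 ≤ β) (hT : 0 ≤ T) (hΛ : 1 ≤ Λ) (ha : ∀ y, |a y| ≤ K) (hb : ∀ y, |b y| ≤ K)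
    (hLa : ∀ y z, |a y - a z| ≤ L * |y - z|) (hLb : ∀ y z, |b y - b z| ≤ L * |y - z|)
    (hx : ContinuousOn x (Ici 0)) (hg : ContinuousOn g (Ici 0))
    (hgβ : ∀ u v, 0 ≤ u → u ≤ v → v ≤ T → v - u ≤ 1 → |g v - g u| ≤ Λ * (v - u) ^ β)
    (hint : IsGLSIntegrable α 0 T (fun s => b (x s)) g)
    (heq : ∀ t, 0 ≤ t → x t = x₀ + θ * (∫ s in (0 : ℝ)..t, a (x s)) +
      glsIntegral α 0 t (fun s => b (x s)) g) :
    IsRoughPathSolution α β θ K L Λ T a b (fun u => x (clampTo T u)) (fun u => g (clampTo T u)) := by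
  have hlip : ∀ f : ℝ → ℝ, (∀ y z, |f y - f z| ≤ L * |y - z|) → Continuous f := by
    intro f hf
    refine (LipschitzWith.of_dist_le_mul (K := L.toNNReal) fun y z => ?_).continuous
    rw [Real.dist_eq, Real.dist_eq]
    exact (hf y z).trans (by gcongr; exact Real.le_coe_toNNReal L)
  have hac := hlip a hLa
  have hbc := hlip b hLb
  have hcl : ∀ {t : ℝ}, t ≤ T → ∀ {u : ℝ}, u ∈ Icc 0 t → clampTo T u = u :=
    fun ht u hu => clampTo_of_mem ⟨hu.1, hu.2.trans ht⟩
  have hxc : Continuous fun u => x (clampTo T u) := continuous_comp_clampTo hx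
  refine
    { continuous_a := hac
      continuous_b := hbc
      continuous_x := hxc
      continuous_g := continuous_comp_clampTo hg
      bound_a := ha
      bound_b := hb
      lip_a := hLa
      lip_b := hLb
      one_le := hΛ
      holder := fun u v hu huv hv h1 => ?_
      holder_global := holder_comp_clampTo hβ hT (by linarith) hg hgβ
      integrable := ?_
      equation := fun u v hu huv hv => ?_ }
  · rw [clampTo_of_mem ⟨hu, huv.trans hv⟩, clampTo_of_mem ⟨hu.trans huv, hv⟩]
    exact hgβ u v hu huv hv h1
  · have h1 : IntegrableOn (leftFracDeriv α 0 fun s => b (x s)) (Ioo 0 T) :=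
      (memLp_one_iff_integrable.1 hint.left_memL1).mono_measure
        (Measure.restrict_mono Ioo_subset_Ioc_self le_rfl)
    have hΓ : Real.Gamma (1 - α) ≠ 0 := (Real.Gamma_pos_of_pos (by linarith)).ne'
    refine (h1.const_mul (Real.Gamma (1 - α))).congr ?_
    refine (ae_restrict_iff' measurableSet_Ioo).2 (Eventually.of_forall fun y hy => ?_)
    have h2 : leftFracDeriv α 0 (fun s => b (x s)) y =
        leftFracDeriv α 0 (fun s => b (x (clampTo T s))) y :=
      leftFracDeriv_congr hy.1.le fun u hu => by simp only [hcl hy.2.le hu]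
    change Real.Gamma (1 - α) * leftFracDeriv α 0 (fun s => b (x s)) y = _
    rw [h2, leftFracDeriv_eq α (fun s => b (x (clampTo T s))) hy.1.le]
    field_simp
  · have hgls : ∀ t, 0 ≤ t → t ≤ T → x (clampTo T t) = x₀ +
        θ * (∫ s in (0 : ℝ)..t, a (x (clampTo T s))) +
        glsIntegral α 0 t (fun s => b (x (clampTo T s))) (fun s => g (clampTo T s)) := by
      intro t ht0 ht
      rw [hcl ht ⟨ht0, le_rfl⟩, heq t ht0]
      congr 1
      · congr 2
        refine intervalIntegral.integral_congr fun s hs => ?_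
        rw [uIcc_of_le ht0] at hs
        simp only [hcl ht hs]
      · exact glsIntegral_congr ht0 (fun s hs => by simp only [hcl ht hs])
          fun s hs => by simp only [hcl ht hs]
    have hi : ∀ p q, IntervalIntegrable (fun s => a (x (clampTo T s))) volume p q :=
      fun p q => (hac.comp hxc).intervalIntegrable p q
    have h1 := hgls u hu (huv.trans hv)
    have h2 := hgls v (hu.trans huv) hv
    rw [← intervalIntegral.integral_interval_sub_left (hi 0 v) (hi 0 u)]
    linarith

/-! ### Error of the estimator along a path -/

theorem forall_pos_or_forall_neg {f : ℝ → ℝ} (hf : Continuous f) (h0 : ∀ y, f y ≠ 0) :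
    (∀ y, 0 < f y) ∨ ∀ y, f y < 0 := by
  by_contra! h
  obtain ⟨⟨y, hy⟩, z, hz⟩ := h
  obtain ⟨c, hc⟩ := mem_range_of_exists_le_of_exists_ge hf ⟨y, hy⟩ ⟨z, hz⟩
  exact h0 c hc

/-- A weighted sum of values of a nonvanishing continuous function is bounded away from zero. -/
theorem mul_sum_le_abs_sum {ι : Type*} {I : Finset ι} {w y : ι → ℝ} {f : ℝ → ℝ} {c : ℝ} (hc : 0 < c)
    (hf : Continuous f) (hfc : ∀ z, c ≤ |f z|) (hw : ∀ i ∈ I, 0 ≤ w i) :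
    c * ∑ i ∈ I, w i ≤ |∑ i ∈ I, w i * f (y i)| := by
  rw [Finset.mul_sum]
  rcases forall_pos_or_forall_neg hf fun z hz => by
    have := hfc z; rw [hz, abs_zero] at this; linarith with h | h
  · refine le_trans (Finset.sum_le_sum fun i hi => ?_) (le_abs_self _)
    have := hfc (y i)
    rw [abs_of_pos (h _)] at this
    rw [mul_comm]
    exact mul_le_mul_of_nonneg_left this (hw i hi)
  · refine le_trans ?_ (neg_le_abs _)
    rw [← Finset.sum_neg_distrib]
    refine Finset.sum_le_sum fun i hi => ?_
    have := hfc (y i)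
    rw [abs_of_neg (h _)] at this
    rw [mul_comm, ← mul_neg]
    exact mul_le_mul_of_nonneg_left this (hw i hi)

theorem obsWeight_nonneg {H : ℝ} {n k : ℕ} (hk : k ≤ 2 ^ (2 * n) - 1) : 0 ≤ obsWeight H n k := by
  have h1 := obsTime_nonneg n k
  have h2 := obsTime_add_le n hk
  have h3 : (0 : ℝ) < 1 / 2 ^ n := by positivity
  exact mul_nonneg (Real.rpow_nonneg h1 _) (Real.rpow_nonneg (by linarith) _)

/-- The exponent 1/2-H is nonpositive and both bases are at most 2^n, so each weight is at least
(2^n)^{1-2H}. For n ≥ 1 there are at least 2^{2n}/2 terms. -/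
theorem le_sum_obsWeight {H : ℝ} (hH : 1 / 2 ≤ H) {n : ℕ} (hn : 1 ≤ n) :
    ((2 : ℝ) ^ n) ^ (2 - 2 * H) / 2 ≤
      (∑ k ∈ Finset.Icc 1 (2 ^ (2 * n) - 1), obsWeight H n k) * (1 / 2 ^ n) := by
  have hT : (0 : ℝ) < 2 ^ n := by positivity
  have hk : ∀ k ∈ Finset.Icc 1 (2 ^ (2 * n) - 1), ((2 : ℝ) ^ n) ^ (1 - 2 * H) ≤ obsWeight H n k := by
    intro k hk
    obtain ⟨h1, h2⟩ := Finset.mem_Icc.1 hk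
    have h3 := obsTime_pos n h1
    have h4 := obsTime_add_le n h2
    have h5 : (0 : ℝ) < 1 / 2 ^ n := by positivity
    rw [obsWeight, show 1 - 2 * H = (1 / 2 - H) + (1 / 2 - H) by ring, Real.rpow_add hT]
    refine mul_le_mul (Real.rpow_le_rpow_of_nonpos h3 (by linarith) (by linarith))
      (Real.rpow_le_rpow_of_nonpos (by linarith) (by linarith) (by linarith)) (by positivity)
      (by positivity)
  have hs := Finset.card_nsmul_le_sum _ _ _ hk
  rw [Nat.card_Icc, Nat.add_sub_cancel, nsmul_eq_mul, Nat.cast_sub Nat.one_le_two_pow] at hs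
  push_cast at hs
  have h2n : (2 : ℝ) ≤ 2 ^ n := by simpa using pow_le_pow_right₀ one_le_two hn
  have hN : (2 : ℝ) ^ n * 2 ^ n / 2 ≤ 2 ^ (2 * n) - 1 := by
    rw [two_mul, pow_add]; nlinarith
  calc ((2 : ℝ) ^ n) ^ (2 - 2 * H) / 2 =
      (2 : ℝ) ^ n * 2 ^ n / 2 * ((2 : ℝ) ^ n) ^ (1 - 2 * H) * (1 / 2 ^ n) := by
        rw [show 2 - 2 * H = 1 - 2 * H + 1 by ring, Real.rpow_add_one hT.ne']
        field_simp
    _ ≤ (2 ^ (2 * n) - 1) * ((2 : ℝ) ^ n) ^ (1 - 2 * H) * (1 / 2 ^ n) := by gcongr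
    _ ≤ _ := by gcongr

/-- The error of the drift estimator in terms of local errors and of the weighted noise. -/
theorem abs_driftEstimator_sub_le {H θ K M ν ε V : ℝ} {a b x g : ℝ → ℝ} {n : ℕ} (hn : 1 ≤ n)
    (hH : 1 / 2 ≤ H) (hK : 0 < K) (hM : 0 < M) (ha : Continuous a) (hb : Continuous b)
    (hbK : ∀ y, |b y| ≤ K) (haM : ∀ y, M ≤ |a y|) (hbM : ∀ y, M ≤ |b y|)
    (hε : ∀ k ∈ Finset.Icc 1 (2 ^ (2 * n) - 1),
      |x (obsTime n k) - x (obsTime n (k - 1)) - θ * a (x (obsTime n (k - 1))) * (1 / 2 ^ n) -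
        ν * b (x (obsTime n (k - 1))) * (g (obsTime n k) - g (obsTime n (k - 1)))| ≤ ε)
    (hV : |weightedNoise H n g| ≤ V) :
    |driftEstimator H a b n x - θ| ≤
      K / M ^ 2 * 2 ^ n * ε + 2 * K / M * |ν| * V / ((2 : ℝ) ^ n) ^ (2 - 2 * H) := by
  set I := Finset.Icc 1 (2 ^ (2 * n) - 1) with hI
  set W := ∑ k ∈ I, obsWeight H n k with hW
  have hT : (0 : ℝ) < 2 ^ n := by positivity
  have hw : ∀ k ∈ I, 0 ≤ obsWeight H n k := fun k hk => obsWeight_nonneg (Finset.mem_Icc.1 hk).2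
  have hb0 : ∀ y, b y ≠ 0 := fun y hy => by
    have := hbM y; rw [hy, abs_zero] at this; linarith
  have hWT := le_sum_obsWeight hH hn
  have hTp : 0 < ((2 : ℝ) ^ n) ^ (2 - 2 * H) := by positivity
  have hW0 : 0 < W := by
    by_contra! h
    have : W * (1 / 2 ^ n) ≤ 0 := mul_nonpos_of_nonpos_of_nonneg h (by positivity)
    linarith
  set D := ∑ k ∈ I, obsWeight H n k * (b (x (obsTime n (k - 1))))⁻¹ * a (x (obsTime n (k - 1))) *
    (1 / 2 ^ n) with hD
  set N := ∑ k ∈ I, obsWeight H n k * (b (x (obsTime n (k - 1))))⁻¹ *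
    (x (obsTime n k) - x (obsTime n (k - 1))) with hN
  have hDW : M / K * (W * (1 / 2 ^ n)) ≤ |D| := by
    have h1 := mul_sum_le_abs_sum (I := I) (w := obsWeight H n) (y := fun k => x (obsTime n (k - 1)))
      (f := fun y => (b y)⁻¹ * a y) (c := M / K) (by positivity) ((hb.inv₀ hb0).mul ha)
      (fun z => ?_) hw
    · have h2 : D = (∑ k ∈ I, obsWeight H n k * ((b (x (obsTime n (k - 1))))⁻¹ *
          a (x (obsTime n (k - 1))))) * (1 / 2 ^ n) := by
        rw [hD, Finset.sum_mul]
        exact Finset.sum_congr rfl fun k _ => by ring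
      rw [h2, abs_mul, abs_of_pos (by positivity : (0 : ℝ) < 1 / 2 ^ n), ← mul_assoc]
      gcongr
    · rw [abs_mul, abs_inv, div_eq_inv_mul]
      have := hbK z
      have := haM z
      have : 0 < |b z| := abs_pos.2 (hb0 z)
      gcongr
  have hDpos : 0 < |D| := lt_of_lt_of_le (by positivity) hDW
  have hnum : |N - θ * D| ≤ W * (ε / M) + |ν| * V := by
    -- The factor 1/b cancels b in the leading noise term, whose weights become deterministic; this
    -- is what keeps it Gaussian.
    have e : N - θ * D = (∑ k ∈ I, obsWeight H n k * ((b (x (obsTime n (k - 1))))⁻¹ *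
        (x (obsTime n k) - x (obsTime n (k - 1)) - θ * a (x (obsTime n (k - 1))) * (1 / 2 ^ n) -
        ν * b (x (obsTime n (k - 1))) * (g (obsTime n k) - g (obsTime n (k - 1)))))) +
        ν * weightedNoise H n g := by
      rw [hN, hD, weightedNoise, Finset.mul_sum, Finset.mul_sum, ← Finset.sum_sub_distrib,
        ← Finset.sum_add_distrib]
      refine Finset.sum_congr rfl fun k _ => ?_
      have := hb0 (x (obsTime n (k - 1)))
      field_simp
      ring
    rw [e]
    refine (abs_add_le _ _).trans (add_le_add ?_ ?_)
    · refine (Finset.abs_sum_le_sum_abs _ _).trans ?_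
      rw [hW, Finset.sum_mul]
      refine Finset.sum_le_sum fun k hk => ?_
      rw [abs_mul, abs_of_nonneg (hw k hk), abs_mul, abs_inv, div_eq_inv_mul ε]
      have h1 := hε k hk
      have h2 := hbM (x (obsTime n (k - 1)))
      have h3 := hw k hk
      gcongr
    · rw [abs_mul]
      gcongr
  have hD0 : D ≠ 0 := abs_pos.1 hDpos
  -- For n ≥ 1 the index k = 1 belongs to the sum, so ε dominates an absolute value.
  have hε0 : 0 ≤ ε := by
    refine (abs_nonneg _).trans (hε 1 (Finset.mem_Icc.2 ⟨le_rfl, ?_⟩))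
    have : 2 ^ 1 ≤ 2 ^ (2 * n) := Nat.pow_le_pow_right two_pos (by omega)
    omega
  have hV0 : 0 ≤ V := (abs_nonneg _).trans hV
  have hest : driftEstimator H a b n x - θ = (N - θ * D) / D := by
    rw [sub_div, mul_div_cancel_right₀ _ hD0]
    rfl
  rw [hest, abs_div]
  calc |N - θ * D| / |D| ≤ (W * (ε / M) + |ν| * V) / |D| := by gcongr
    _ = W * (ε / M) / |D| + |ν| * V / |D| := add_div _ _ _
    -- The sum W of the weights is kept in the first quotient, where it cancels, and replaced by its
    -- lower bound in the second.
    _ ≤ W * (ε / M) / (M / K * (W * (1 / 2 ^ n))) +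
        |ν| * V / (M / K * (((2 : ℝ) ^ n) ^ (2 - 2 * H) / 2)) := by
        gcongr
        exact (mul_le_mul_of_nonneg_left hWT (by positivity)).trans hDW
    _ = _ := by
        field_simp

/-! ### Rates, moments and conclusion -/

theorem memLp_const_mul_pow {Ω : Type*} [MeasurableSpace Ω] {P : Measure Ω} [IsProbabilityMeasure P]
    {ζ : Ω → ℝ} (hm : Measurable ζ) (hi : ∀ m : ℕ, Integrable (fun ω => ζ ω ^ m) P) (c : ℝ) (k : ℕ)
    (p : ℝ≥0) : MemLp (fun ω => c * ζ ω ^ k) p P := by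
  obtain ⟨m, hpm⟩ := exists_nat_gt p
  have hm0 : (m : ℝ≥0∞) ≠ 0 := by
    have : 0 < (m : ℝ≥0) := lt_of_le_of_lt zero_le hpm
    exact_mod_cast this.ne'
  have hmeas : Measurable fun ω => c * ζ ω ^ k := (hm.pow_const k).const_mul c
  have h : MemLp (fun ω => c * ζ ω ^ k) (m : ℝ≥0∞) P := by
    refine (integrable_norm_rpow_iff hmeas.aestronglyMeasurable hm0 (by simp)).1 ?_
    refine (((hi (k * m)).const_mul (c ^ m)).norm).congr (Eventually.of_forall fun ω => ?_)
    simp only [ENNReal.toReal_natCast, Real.rpow_natCast]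
    rw [← norm_pow, mul_pow, pow_mul]
  exact h.mono_exponent (by exact_mod_cast hpm.le)

theorem tendsto_natCast_rpow_mul_two_rpow (s : ℝ) {ρ : ℝ} (hρ : 0 < ρ) :
    Tendsto (fun n : ℕ => (n : ℝ) ^ s * (2 : ℝ) ^ (-ρ * n)) atTop (𝓝 0) := by
  have h := (tendsto_rpow_mul_exp_neg_mul_atTop_nhds_zero s (Real.log 2 * ρ)
    (mul_pos (Real.log_pos one_lt_two) hρ)).comp tendsto_natCast_atTop_atTop
  refine h.congr fun n => ?_
  simp only [Function.comp]
  rw [Real.rpow_def_of_pos two_pos]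
  congr 2; ring

/-- Combination of the local error bound and the noise bound into one rate. -/
theorem rate_bound {H β γ K M E C ν z : ℝ} {n : ℕ} (hβ : 1 / 2 ≤ β) (hγ : 0 ≤ γ) (hK : 0 ≤ K)
    (hM : 0 < M) (hE : 0 ≤ E) (hC : 1 ≤ C) (hz : 1 ≤ z) (hn : 1 ≤ n) :
    K / M ^ 2 * 2 ^ n * (E * (C * z * (n : ℝ) ^ γ) ^ (1 / β + 1) * (1 / 2 ^ n) ^ (2 * β)) +
      2 * K / M * |ν| * (C * z * (n : ℝ) ^ γ * ((2 : ℝ) ^ n) ^ (1 - H)) / ((2 : ℝ) ^ n) ^ (2 - 2 * H) ≤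
    (K / M ^ 2 * E + 2 * K / M * |ν|) * C ^ 3 * z ^ 3 * (n : ℝ) ^ (γ / β + γ) *
      (2 : ℝ) ^ (-min (1 - H) (2 * β - 1) * n) := by
  have hn' : (1 : ℝ) ≤ n := by exact_mod_cast hn
  have hβ0 : 0 < β := by linarith
  have hCz : 1 ≤ C * z := one_le_mul_of_one_le_of_one_le hC hz
  have hT : (0 : ℝ) < 2 ^ n := by positivity
  set R : ℝ := (2 : ℝ) ^ (-min (1 - H) (2 * β - 1) * n) with hR
  have h1 : (C * z * (n : ℝ) ^ γ) ^ (1 / β + 1) ≤ (C * z) ^ 3 * (n : ℝ) ^ (γ / β + γ) := by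
    rw [Real.mul_rpow (by positivity) (by positivity), ← Real.rpow_mul (by positivity)]
    have e1 : γ * (1 / β + 1) = γ / β + γ := by ring
    -- As β ≥ 1/2 the exponent is at most 3, and an integer power of z keeps the moments elementary.
    have e2 : (C * z) ^ (1 / β + 1) ≤ (C * z) ^ 3 := by
      rw [← Real.rpow_natCast]
      refine Real.rpow_le_rpow_of_exponent_le hCz ?_
      have : 1 / β ≤ 2 := by rw [div_le_iff₀ hβ0]; linarith
      push_cast; linarith
    rw [e1]
    gcongr
  have h2 : (2 : ℝ) ^ n * (1 / 2 ^ n) ^ (2 * β) ≤ R := by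
    rw [one_div, ← Real.rpow_natCast, ← Real.rpow_neg zero_le_two, ← Real.rpow_mul zero_le_two,
      ← Real.rpow_add two_pos, hR]
    refine Real.rpow_le_rpow_of_exponent_le one_le_two ?_
    have := min_le_right (1 - H) (2 * β - 1)
    nlinarith
  have h3 : ((2 : ℝ) ^ n) ^ (1 - H) / ((2 : ℝ) ^ n) ^ (2 - 2 * H) ≤ R := by
    rw [← Real.rpow_sub hT, ← Real.rpow_natCast, ← Real.rpow_mul zero_le_two, hR]
    refine Real.rpow_le_rpow_of_exponent_le one_le_two ?_
    have := min_le_left (1 - H) (2 * β - 1)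
    nlinarith
  have h4 : C * z * (n : ℝ) ^ γ ≤ (C * z) ^ 3 * (n : ℝ) ^ (γ / β + γ) := by
    have e1 : C * z ≤ (C * z) ^ 3 := le_self_pow₀ hCz (by norm_num)
    have e2 : (n : ℝ) ^ γ ≤ (n : ℝ) ^ (γ / β + γ) := by
      refine Real.rpow_le_rpow_of_exponent_le hn' ?_
      have : 0 ≤ γ / β := by positivity
      linarith
    gcongr
  have hR0 : 0 ≤ R := by positivity
  calc _ = K / M ^ 2 * E * (C * z * (n : ℝ) ^ γ) ^ (1 / β + 1) *
          ((2 : ℝ) ^ n * (1 / 2 ^ n) ^ (2 * β)) +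
        2 * K / M * |ν| * (C * z * (n : ℝ) ^ γ) *
          (((2 : ℝ) ^ n) ^ (1 - H) / ((2 : ℝ) ^ n) ^ (2 - 2 * H)) := by ring
    _ ≤ K / M ^ 2 * E * ((C * z) ^ 3 * (n : ℝ) ^ (γ / β + γ)) * R +
        2 * K / M * |ν| * ((C * z) ^ 3 * (n : ℝ) ^ (γ / β + γ)) * R := by gcongr
    _ = _ := by ring

theorem theorem3 {Ω : Type*} [MeasurableSpace Ω] (P : Measure Ω) [IsProbabilityMeasure P]
    (H α β γ κ ρ δ K L M x₀ θ : ℝ) (a b : ℝ → ℝ) (B X : ℝ → Ω → ℝ)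
    (hH : H ∈ Ioo (1 / 2 : ℝ) 1)
    (hα : α ∈ Ioo (1 - H) (1 / 2)) (hβ : β ∈ Ioo (1 - α) H)
    (hγ : 1 / 2 < γ) (hκ : κ = γ / β) (hρ : ρ = min (1 - H) (2 * β - 1))
    -- (A) boundedness
    (hK : 0 < K) (hA : ∀ x, |a x| + |b x| ≤ K)
    -- (B) Lipschitz continuity
    (hL : 0 < L) (hB : ∀ x y, |a x - a y| + |b x - b y| ≤ L * |x - y|)
    -- (C) local Hölder continuity of the derivative of b
    (hδ : δ ∈ Ioc (1 / H - 1) 1) (hb : Differentiable ℝ b)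
    (hC : ∀ N : ℕ, 1 ≤ N → ∃ R : ℝ, 0 < R ∧ ∀ x ∈ Icc (-(N : ℝ)) N, ∀ y ∈ Icc (-(N : ℝ)) N,
      |deriv b x - deriv b y| ≤ R * |x - y| ^ δ)
    -- (D) non-degeneracy
    (hM : 0 < M) (hD : ∀ x, M ≤ |a x| ∧ M ≤ |b x|)
    (hfbm : IsFractionalBrownianMotion P H B)
    (hX : IsSDESolution P α x₀ θ a b B X) :
    (∀ᵐ ω ∂P, Tendsto (fun n : ℕ => driftEstimator H a b n (fun t => X t ω)) atTop (𝓝 θ)) ∧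
    ∃ η : Ω → ℝ, Measurable η ∧ (∀ p : ℝ≥0, MemLp η p P) ∧
      ∀ᵐ ω ∂P, ∀ n : ℕ, 1 ≤ n →
        |driftEstimator H a b n (fun t => X t ω) - θ| ≤
          η ω * (n : ℝ) ^ (κ + γ) * (2 : ℝ) ^ (-ρ * n) := by
  obtain ⟨hH1, hH2⟩ := id hH
  obtain ⟨hα1, hα2⟩ := hα
  obtain ⟨hβ1, hβ2⟩ := hβ
  have haK : ∀ y, |a y| ≤ K := fun y => by linarith [hA y, abs_nonneg (b y)]
  have hbK : ∀ y, |b y| ≤ K := fun y => by linarith [hA y, abs_nonneg (a y)]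
  have haL : ∀ y z, |a y - a z| ≤ L * |y - z| := fun y z => by
    linarith [hB y z, abs_nonneg (b y - b z)]
  have hbL : ∀ y z, |b y - b z| ≤ L * |y - z| := fun y z => by
    linarith [hB y z, abs_nonneg (a y - a z)]
  obtain ⟨C, hC1, ζ, hζm, hζ1, hζi, hζ⟩ :=
    hfbm.exists_moment_bound hH (β := β) (γ := γ) (by linarith) hβ2 hγ
  set ν : ℝ := gammaFactor α * marchaudConst α with hν
  set E : ℝ := IsRoughPathSolution.localErrConst α β θ K L with hE
  have hE0 : 0 ≤ E := IsRoughPathSolution.localErrConst_nonneg (by linarith) (by linarith) (by linarith) (by linarith)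
    hK.le hL.le
  set c : ℝ := (K / M ^ 2 * E + 2 * K / M * |ν|) * C ^ 3 with hc
  have hbound : ∀ᵐ ω ∂P, ∀ n : ℕ, 1 ≤ n → |driftEstimator H a b n (fun t => X t ω) - θ| ≤
      c * ζ ω ^ 3 * (n : ℝ) ^ (κ + γ) * (2 : ℝ) ^ (-ρ * n) := by
    filter_upwards [hζ, hfbm.continuous_paths, hX.integrable, hX.equation]
      with ω hω hcont hint heq n hn
    obtain ⟨hhol, hnoise⟩ := hω n hn
    have hn' : (1 : ℝ) ≤ n := by exact_mod_cast hn
    have hz := hζ1 ω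
    have hΛ : 1 ≤ C * ζ ω * (n : ℝ) ^ γ :=
      one_le_mul_of_one_le_of_one_le (one_le_mul_of_one_le_of_one_le hC1 hz)
        (Real.one_le_rpow hn' (by linarith))
    have hT : (0 : ℝ) ≤ 2 ^ n := by positivity
    -- Each n has its own clamped solution on [0, 2^n], with driver constant Λ = C ζ n^γ; the
    -- constants of the path estimates do not depend on n or ω.
    have hsol := isRoughPathSolution_clampTo (α := α) (β := β) (θ := θ) (x₀ := x₀) (T := 2 ^ n)
      (x := fun t => X t ω) (g := fun t => B t ω) (by linarith) (by linarith) hT hΛ haK hbK haL hbL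
      (hX.continuous_paths ω) hcont hhol (hint _ hT) heq
    rw [hκ, hρ]
    refine (abs_driftEstimator_sub_le (M := M) (ν := ν) (g := fun t => B t ω) hn hH1.le hK hM
      hsol.continuous_a hsol.continuous_b hbK (fun y => (hD y).1) (fun y => (hD y).2)
      (ε := E * (C * ζ ω * (n : ℝ) ^ γ) ^ (1 / β + 1) * (1 / 2 ^ n) ^ (2 * β))
      (fun k hk => ?_) hnoise).trans
      (rate_bound (by linarith) (by linarith) hK.le hM hE0 hC1 hz hn)
    obtain ⟨hk1, hk2⟩ := Finset.mem_Icc.1 hk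
    have hkT : obsTime n k ≤ 2 ^ n := obsTime_le n (by omega)
    have hpT : obsTime n (k - 1) ≤ 2 ^ n := obsTime_le n (by omega)
    have hstep := obsTime_sub_pred_eq n hk1
    have hd : (0 : ℝ) < 1 / 2 ^ n := by positivity
    have hd1 : (1 : ℝ) / 2 ^ n ≤ 1 := (div_le_one (by positivity)).2 (one_le_pow₀ one_le_two)
    have := hsol.abs_local_error_le (by linarith) (by linarith) (by linarith) (by linarith)
      (by linarith) (obsTime_nonneg n (k - 1)) (by linarith : obsTime n (k - 1) < obsTime n k) hkT
      (by linarith)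
    rw [hstep, clampTo_of_mem ⟨obsTime_nonneg n k, hkT⟩,
      clampTo_of_mem ⟨obsTime_nonneg n (k - 1), hpT⟩] at this
    exact this
  refine ⟨?_, fun ω => c * ζ ω ^ 3, (hζm.pow_const 3).const_mul c,
    memLp_const_mul_pow hζm hζi c 3, hbound⟩
  filter_upwards [hbound] with ω hω
  -- Both rates are positive: H < 1, and β > 1-α > 1/2.
  have hρ0 : 0 < ρ := by rw [hρ]; exact lt_min (by linarith) (by linarith)
  rw [tendsto_iff_dist_tendsto_zero]
  refine squeeze_zero' (Eventually.of_forall fun n => dist_nonneg) ?_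
    (by simpa only [mul_zero] using
      (tendsto_natCast_rpow_mul_two_rpow (κ + γ) hρ0).const_mul (c * ζ ω ^ 3))
  filter_upwards [eventually_ge_atTop 1] with n hn
  rw [Real.dist_eq, ← mul_assoc]
  exact hω n hn
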